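/- Let $G$ be a finite-dimensional Lie group with identity $e$, acting smoothly and transitively from the right on a finite-dimensional smooth manifold $B$; write $b\cdot g$ for the action. Fix $b\in B$, put $\pi_b(g)=b\cdot g$ and $G_b=\{g\in G : b\cdot g=b\}$. Let $\mathsf g_G$ be a smooth Riemannian metric on $G$ that is right-invariant (every right translation $x\mapsto xg$ is an isometry) and that descends to a smooth Riemannian metric $\mathsf g_B$ on $B$ with respect to $\pi_b$. This means that $\pi_b\colon G\to B$ is a smooth submersion and $\mathsf g_G(u,v)=\mathsf g_B(T\pi_b u,T\pi_b v)$ for all $u,v\in T_gG$, $g\in G$, that are orthogonal to $\ker T_g\pi_b$; that is, $\pi_b$ is a Riemannian submersion. For a Riemannian manifold, $\operatorname{dist}(x,y)\in[0,\infty]$ is the infimum of the lengths of the curves from $x$ to $y$ (it is $\infty$ if there are none). A minimal geodesic from $x$ to $y$ is a $C^1$ curve $\zeta\colon[0,1]\to M$ from $x$ to $y$ of constant speed whose length equals $\operatorname{dist}(x,y)$ (such a curve is automatically a smooth geodesic). Uniqueness of a minimal geodesic means uniqueness as a map on $[0,1]$. Define the polar cone $$K=\{k\in G : \operatorname{dist}_G(e,k)\le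 \operatorname{dist}_G(h,k)\ \text{ for all } h\in G_b\}.$$ Then the following statements are equivalent: 1. For any $b'\in B$ there exists a unique minimal geodesic in $B$ from $b$ to $b'$. 2. For any $b'',b'\in B$ there exists a unique minimal geodesic in $B$ from $b''$ to $b'$. 3. For any $b'\in B$ there exists a unique solution to the optimal transport problem "find $T\in\{g\in G : b\cdot g=b'\}$ minimising $\operatorname{dist}_G^2(e,T)$", and that solution is connected to $e$ by a unique minimal geodesic in $G$. 4. Every $g\in G$ has a unique factorisation $g=hk$ with $h\in G_b$ and $k\in K$, and every $k\in K$ is connected to $e$ by a unique minimal geodesic in $G$. -/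

import Mathlib

open Manifold Set
open scoped ContDiff ENNReal Bundle

noncomputable section

namespace DescendingMetric

section Curves

variable {E : Type*} [NormedAddCommGroup E] [NormedSpace ℝ E]
  {M : Type*} [TopologicalSpace M] [ChartedSpace E M]
  [Bundle.RiemannianBundle (fun x : M ↦ TangentSpace 𝓘(ℝ, E) x)]

/-- The velocity vector of a curve `γ : [0, 1] → M` at time `t ∈ [0, 1]` (one-sided at the two
endpoints). -/
def velocity {x y : M} (γ : Path x y) (t : ℝ) : TangentSpace 𝓘(ℝ, E) (γ.extend t) :=
  mfderivWithin 𝓘(ℝ, ℝ) 𝓘(ℝ, E) γ.extend (Icc 0 1) t (1 : ℝ)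

/-- The geodesic distance of a Riemannian metric: the infimum of the lengths of the curves which
join the two points. It is `∞` when there is no such curve, i.e. for points in different connected
components. -/
def dist (x y : M) : ℝ≥0∞ := riemannianEDist 𝓘(ℝ, E) x y

/-- A curve `γ : [0, 1] → M` from `x` to `y` is a minimal geodesic if it is continuously
differentiable, is parametrised with constant speed, and is a shortest curve between its endpoints:
its length is the geodesic distance from `x` to `y`. (On a finite-dimensional manifold with a smooth
metric, such curves are automatically smooth and solve the geodesic equation, and conversely every
length-minimising solution of the geodesic equation is such a curve.) -/
structure IsMinimalGeodesic {x y : M} (γ : Path x y) : Prop where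
  contMDiffOn : ContMDiffOn 𝓘(ℝ, ℝ) 𝓘(ℝ, E) 1 γ.extend (Icc 0 1)
  constant_speed : ∃ c : ℝ, ∀ t ∈ Icc (0 : ℝ) 1, ‖velocity (E := E) γ t‖ = c
  length_eq : pathELength 𝓘(ℝ, E) γ.extend 0 1 = dist (E := E) x y

variable (E) in
/-- There exists a unique minimal geodesic from `x` to `y`. -/
def HasUniqueMinimalGeodesic (x y : M) : Prop :=
  ∃! γ : Path x y, IsMinimalGeodesic (E := E) γ

end Curves

section Submersion

variable {E : Type*} [NormedAddCommGroup E] [NormedSpace ℝ E]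
  {M : Type*} [TopologicalSpace M] [ChartedSpace E M]
  [Bundle.RiemannianBundle (fun x : M ↦ TangentSpace 𝓘(ℝ, E) x)]
  {F : Type*} [NormedAddCommGroup F] [NormedSpace ℝ F]
  {B : Type*} [TopologicalSpace B] [ChartedSpace F B]
  [Bundle.RiemannianBundle (fun x : B ↦ TangentSpace 𝓘(ℝ, F) x)]

variable (E F) in
/-- A tangent vector is horizontal with respect to `p : M → B` if it is orthogonal to the vertical
space, the kernel of the derivative of `p`. -/
def IsHorizontal (p : M → B) (x : M) (u : TangentSpace 𝓘(ℝ, E) x) : Prop :=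
  ∀ w : TangentSpace 𝓘(ℝ, E) x, mfderiv 𝓘(ℝ, E) 𝓘(ℝ, F) p x w = 0 → inner ℝ u w = 0

variable (E F) in
/-- The metric on `M` descends to the metric on `B` with respect to `p : M → B`: the map `p` is a
smooth submersion, and the metric on `M` agrees with the pullback by `p` of the metric on `B` on
all horizontal vectors. In other words, `p` is a Riemannian submersion. -/
structure DescendsTo (p : M → B) : Prop where
  smooth : ContMDiff 𝓘(ℝ, E) 𝓘(ℝ, F) ∞ p
  submersion : ∀ x : M, Function.Surjective (mfderiv 𝓘(ℝ, E) 𝓘(ℝ, F) p x)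
  inner_eq : ∀ (x : M) (u v : TangentSpace 𝓘(ℝ, E) x),
    IsHorizontal E F p x u → IsHorizontal E F p x v →
      inner ℝ u v =
        inner ℝ (mfderiv 𝓘(ℝ, E) 𝓘(ℝ, F) p x u) (mfderiv 𝓘(ℝ, E) 𝓘(ℝ, F) p x v)

end Submersion

section Group

variable {E : Type*} [NormedAddCommGroup E] [NormedSpace ℝ E]
  {G : Type*} [TopologicalSpace G] [ChartedSpace E G] [Group G]
  [Bundle.RiemannianBundle (fun x : G ↦ TangentSpace 𝓘(ℝ, E) x)]

variable (E G) in
/-- The metric on the Lie group `G` is invariant under all right translations `R_g : x ↦ x * g`. -/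
def IsRightInvariantMetric : Prop :=
  ∀ (g x : G) (u v : TangentSpace 𝓘(ℝ, E) x),
    inner ℝ (mfderiv 𝓘(ℝ, E) 𝓘(ℝ, E) (fun y : G ↦ y * g) x u)
      (mfderiv 𝓘(ℝ, E) 𝓘(ℝ, E) (fun y : G ↦ y * g) x v) = inner ℝ u v

variable {B : Type*} [MulAction Gᵐᵒᵖ B]

/-- The map `π_b : G → B`, `g ↦ b · g`, of a right action of `G` on `B`. A right action of `G` is
an action of the opposite group. -/
def orbitMap (b : B) (g : G) : B := MulOpposite.op g • b

/-- The isotropy subgroup `G_b = {g | b · g = b}` of a right action. -/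
def isotropy (G : Type*) [Group G] {B : Type*} [MulAction Gᵐᵒᵖ B] (b : B) : Set G :=
  {g | orbitMap b g = b}

/-- `T` solves the abstract optimal transport problem from `b` to `b'` with cost function `c`:
it carries `b` to `b'`, and minimises `c e T` among all group elements which do so. -/
def IsOptimalTransport (c : G → G → ℝ≥0∞) (b b' : B) (T : G) : Prop :=
  orbitMap b T = b' ∧ ∀ S : G, orbitMap b S = b' → c 1 T ≤ c 1 S

variable (E G) in
/-- The polar cone: the elements of `G` for which `e` is a closest point of the identity fibre
`G_b`. -/
def polarCone (b : B) : Set G :=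
  {k | ∀ h ∈ isotropy G b, dist (E := E) 1 k ≤ dist (E := E) h k}

end Group

end DescendingMetric

end

/-!
The orbit map `π = orbitMap b : G → B` is a Riemannian submersion. Since right translations of `G`
are isometries which cover the action on `B`, the group also acts on `B` by isometries
(`riemannianEDist_action`), and `dist (π x) y` is the distance in `G` from `x` to the fibre of `π`
over `y` (`riemannianEDist_orbitMap_le` and `exists_lift_lt`). Hence both the optimality of `T` and
the condition defining the polar cone `K` say that `dist 1 T = dist b (π T)`: the optimal transports
from `b` to `b'` are exactly the points of `K` over `b'` (`isOptimalTransport_iff`). With this, the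
equivalence of the last two statements is algebra: factoring `g = h * k` with `h` in the isotropy
group means choosing `k` in the fibre of `g`. The first two statements are equivalent because `G`
acts transitively by isometries.

The remaining equivalence compares minimal geodesics `ζ` in `G` from `1` to an optimal `T` with
minimal geodesics `η` in `B` from `b` to `b'`: the projection of `ζ` is minimal, and `η` has a
unique horizontal lift, which is minimal and ends at an optimal point. No geodesic equation is used.
Instead, curves are studied through the condition that `dist (f s) (f t) = d * |t - s|`
(`IsMetricGeodesic`); minimal geodesics are the metric geodesics which are `C¹`.

* Existence of lifts (`exists_lift`): lift `η` at equidistant times, and pass to the limit along an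
  ultrafilter, using that balls in `G` are compact (`isCompact_closedBall`). The same compactness
  argument joins points of `G` by metric geodesics (`exists_isMetricGeodesic`).
* Regularity and uniqueness of lifts: a metric geodesic in `G` over a differentiable curve of the
  same speed is differentiable with horizontal velocity
  (`IsMetricGeodesic.hasDerivWithinAt_of_map`). In charts, such lifts therefore solve an ordinary
  differential equation (`exists_horizontal_field`), so that they are `C¹`
  (`IsMetricGeodesic.contMDiffOn_of_map`) and determined by their starting point
  (`IsMetricGeodesic.eqOn_of_map`).
* Uniqueness of the optimal transport: an optimal `S` is joined to `1` by a metric geodesic, whose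
  projection is a metric geodesic. When minimal geodesics in `B` are unique, it has to be `η`,
  because minimal geodesics that are concatenated to a metric geodesic cannot form a corner
  (`IsMetricGeodesic.eqOn_of_unique`); hence `S` is the endpoint of the horizontal lift of `η`.
-/

noncomputable section

namespace RiemannianDescent

open Filter MeasureTheory Bundle
open scoped Topology NNReal

/-! ### The geodesic distance in a chart -/

section Metric

variable {E : Type*} [NormedAddCommGroup E] [NormedSpace ℝ E]
  {M : Type*} [TopologicalSpace M] [ChartedSpace E M]

theorem trivializationAt_symmL_self [IsManifold 𝓘(ℝ, E) 1 M] (p : M) (v : E) :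
    (trivializationAt E (fun x : M ↦ TangentSpace 𝓘(ℝ, E) x) p).symmL ℝ p v =
      (v : TangentSpace 𝓘(ℝ, E) p) := by
  rw [TangentBundle.symmL_trivializationAt_eq_core (by simp)]
  simpa using! (tangentBundleCore 𝓘(ℝ, E) M).coordChange_self (achart E p) p
    (mem_chart_source E p) v

theorem trivializationAt_continuousLinearMapAt_self [IsManifold 𝓘(ℝ, E) 1 M] (p : M)
    (v : TangentSpace 𝓘(ℝ, E) p) :
    (trivializationAt E (fun x : M ↦ TangentSpace 𝓘(ℝ, E) x) p).continuousLinearMapAt ℝ p v =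
      (v : E) := by
  rw [TangentBundle.continuousLinearMapAt_trivializationAt_eq_core (by simp)]
  simpa using! (tangentBundleCore 𝓘(ℝ, E) M).coordChange_self (achart E p) p
    (mem_chart_source E p) v

variable (E) in
/-- The tautological identification of the model space with the tangent space at `p`. It is the
identity map, but it switches from the norm of the model space to the Riemannian norm at `p`. -/
def toFiber (p : M) : E ≃L[ℝ] TangentSpace 𝓘(ℝ, E) p := ContinuousLinearEquiv.refl ℝ E

variable [RiemannianBundle (fun x : M ↦ TangentSpace 𝓘(ℝ, E) x)]
  [IsManifold 𝓘(ℝ, E) 1 M] [IsContinuousRiemannianBundle E (fun x : M ↦ TangentSpace 𝓘(ℝ, E) x)]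

theorem continuous_riemannianEDist [RegularSpace M] :
    Continuous fun q : M × M ↦ riemannianEDist 𝓘(ℝ, E) q.1 q.2 := by
  -- the topology of this space is the given one
  let : PseudoEMetricSpace M := PseudoEMetricSpace.ofRiemannianMetric 𝓘(ℝ, E) M
  exact continuous_edist (α := M)

/-- Near `p`, the chart at `p` increases norms at most by a factor close to `1`, if its target
carries the Riemannian norm at `p`. -/
theorem eventually_norm_toFiber_mfderiv_le (p : M) {r : ℝ} (hr : 1 < r) :
    ∀ᶠ y in 𝓝 p, ∀ v : TangentSpace 𝓘(ℝ, E) y,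
      ‖toFiber E p (mfderiv 𝓘(ℝ, E) 𝓘(ℝ, E) (extChartAt 𝓘(ℝ, E) p) y v)‖ ≤ r * ‖v‖ := by
  filter_upwards [eventually_norm_symmL_trivializationAt_self_comp_lt E
    (fun x : M ↦ TangentSpace 𝓘(ℝ, E) x) p hr, chart_source_mem_nhds E p] with y hy h'y v
  have := (ContinuousLinearMap.le_opNorm _ v).trans
    (mul_le_mul_of_nonneg_right hy.le (norm_nonneg v))
  rw [ContinuousLinearMap.comp_apply, trivializationAt_symmL_self,
    TangentBundle.continuousLinearMapAt_trivializationAt h'y] at this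
  exact this

/-- Near `p`, the inverse of the chart at `p` increases norms at most by a factor close to `1`, if
its source carries the Riemannian norm at `p`. -/
theorem eventually_norm_mfderiv_symm_le (p : M) {r : ℝ} (hr : 1 < r) :
    ∀ᶠ z in 𝓝 (extChartAt 𝓘(ℝ, E) p p), ∀ v : E,
      ‖mfderiv 𝓘(ℝ, E) 𝓘(ℝ, E) (extChartAt 𝓘(ℝ, E) p).symm z v‖ ≤ r * ‖toFiber E p v‖ := by
  have h := eventually_norm_symmL_trivializationAt_comp_self_lt E
    (fun x : M ↦ TangentSpace 𝓘(ℝ, E) x) p hr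
  have h2 : ∀ᶠ z in 𝓝 (extChartAt 𝓘(ℝ, E) p p), z ∈ (extChartAt 𝓘(ℝ, E) p).target :=
    extChartAt_target_mem_nhds p
  have h3 : Tendsto (extChartAt 𝓘(ℝ, E) p).symm (𝓝 (extChartAt 𝓘(ℝ, E) p p)) (𝓝 p) := by
    simpa [ContinuousAt] using continuousAt_extChartAt_symm (I := 𝓘(ℝ, E)) p
  filter_upwards [h3.eventually h, h3.eventually (chart_source_mem_nhds E p), h2]
    with z hz h'z ht v
  have := (ContinuousLinearMap.le_opNorm _ (toFiber E p v)).trans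
    (mul_le_mul_of_nonneg_right hz.le (norm_nonneg (toFiber E p v)))
  rw [ContinuousLinearMap.comp_apply, trivializationAt_continuousLinearMapAt_self,
    TangentBundle.symmL_trivializationAt h'z] at this
  have hrange : range 𝓘(ℝ, E) = (univ : Set E) := by simp
  rw [hrange, mfderivWithin_univ] at this
  have e : extChartAt 𝓘(ℝ, E) p ((extChartAt 𝓘(ℝ, E) p).symm z) = z :=
    (extChartAt 𝓘(ℝ, E) p).right_inv ht
  rw [e] at this
  exact this

/-- Near `p`, the geodesic distance is at most `r` times the distance measured in the chart with
the Riemannian norm at `p`: the chart pulls segments back to curves of controlled length. -/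
theorem eventually_riemannianEDist_le (p : M) {r : ℝ} (hr : 1 < r) :
    ∀ᶠ q in 𝓝 (p, p), riemannianEDist 𝓘(ℝ, E) q.1 q.2 ≤
      ENNReal.ofReal
        (r * ‖toFiber E p (extChartAt 𝓘(ℝ, E) p q.2 - extChartAt 𝓘(ℝ, E) p q.1)‖) := by
  set φ := extChartAt 𝓘(ℝ, E) p with hφ
  obtain ⟨ρ, ρpos, hρ⟩ : ∃ ρ > 0, Metric.ball (φ p) ρ ⊆ φ.target ∩
      {z | ∀ v : E, ‖mfderiv 𝓘(ℝ, E) 𝓘(ℝ, E) φ.symm z v‖ ≤ r * ‖toFiber E p v‖} :=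
    Metric.mem_nhds_iff.1 (inter_mem (extChartAt_target_mem_nhds p)
      (eventually_norm_mfderiv_symm_le p hr))
  have hU : ∀ᶠ y in 𝓝 p, y ∈ φ.source ∧ φ y ∈ Metric.ball (φ p) ρ :=
    Filter.Eventually.and (extChartAt_source_mem_nhds p)
      ((continuousAt_extChartAt p).preimage_mem_nhds (Metric.ball_mem_nhds _ ρpos))
  rw [nhds_prod_eq]
  filter_upwards [hU.prod_mk hU] with q hq
  obtain ⟨⟨h1s, h1b⟩, h2s, h2b⟩ := hq
  let η : ℝ → E := AffineMap.lineMap (φ q.1) (φ q.2)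
  have hη : ∀ t ∈ Icc (0 : ℝ) 1, η t ∈ Metric.ball (φ p) ρ := fun t ht ↦
    (convex_ball _ _).segment_subset h1b h2b (by
      rw [segment_eq_image_lineMap]; exact mem_image_of_mem _ ht)
  have hηs : ContMDiff 𝓘(ℝ, ℝ) 𝓘(ℝ, E) 1 η := by
    rw [contMDiff_iff_contDiff]
    exact (ContinuousAffineMap.lineMap (R := ℝ) (φ q.1) (φ q.2)).contDiff
  have hηd : ∀ t, HasMFDerivAt 𝓘(ℝ, ℝ) 𝓘(ℝ, E) η t
      (ContinuousLinearMap.toSpanSingleton ℝ (φ q.2 - φ q.1)) := fun t ↦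
    (AffineMap.hasDerivAt_lineMap (a := φ q.1) (b := φ q.2) (x := t)).hasFDerivAt.hasMFDerivAt
  have key : riemannianEDist 𝓘(ℝ, E) q.1 q.2 ≤ pathELength 𝓘(ℝ, E) (φ.symm ∘ η) 0 1 := by
    apply riemannianEDist_le_pathELength _ _ _ zero_le_one
    · exact (contMDiffOn_extChartAt_symm p).comp hηs.contMDiffOn fun t ht ↦ (hρ (hη t ht)).1
    · simp [η, φ.left_inv h1s]
    · simp [η, φ.left_inv h2s]
  refine key.trans ?_
  rw [pathELength_eq_lintegral_mfderiv_Ioo]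
  calc ∫⁻ t in Ioo (0 : ℝ) 1, ‖mfderiv 𝓘(ℝ, ℝ) 𝓘(ℝ, E) (φ.symm ∘ η) t 1‖ₑ
      ≤ ∫⁻ t in Ioo (0 : ℝ) 1, ENNReal.ofReal (r * ‖toFiber E p (φ q.2 - φ q.1)‖) := by
        refine setLIntegral_mono' measurableSet_Ioo fun t ht ↦ ?_
        have hb := hρ (hη t (Ioo_subset_Icc_self ht))
        have hd : MDifferentiableAt 𝓘(ℝ, E) 𝓘(ℝ, E) φ.symm (η t) := by
          have := mdifferentiableWithinAt_extChartAt_symm (I := 𝓘(ℝ, E)) hb.1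
          rwa [show range 𝓘(ℝ, E) = (univ : Set E) by simp, mdifferentiableWithinAt_univ] at this
        rw [(hd.hasMFDerivAt.comp t (hηd t)).mfderiv, ← ofReal_norm]
        apply ENNReal.ofReal_le_ofReal
        have := hb.2 (φ q.2 - φ q.1)
        exact (congrArg (fun w : E ↦ ‖mfderiv 𝓘(ℝ, E) 𝓘(ℝ, E) φ.symm (η t) w‖)
          (one_smul ℝ (φ q.2 - φ q.1))).trans_le this
    _ = _ := by simp

/-- Near `p`, the distance measured in the chart with the Riemannian norm at `p` is at most `r`
times the geodesic distance: the chart maps short curves to curves of controlled length. -/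
theorem eventually_norm_toFiber_le [RegularSpace M] (p : M) {r : ℝ} (hr : 1 < r) :
    ∀ᶠ q in 𝓝 (p, p),
      ENNReal.ofReal ‖toFiber E p (extChartAt 𝓘(ℝ, E) p q.2 - extChartAt 𝓘(ℝ, E) p q.1)‖ ≤
        ENNReal.ofReal r * riemannianEDist 𝓘(ℝ, E) q.1 q.2 := by
  set φ := extChartAt 𝓘(ℝ, E) p with hφ
  have hU : {y | y ∈ φ.source ∧ ∀ v : TangentSpace 𝓘(ℝ, E) y,
      ‖toFiber E p (mfderiv 𝓘(ℝ, E) 𝓘(ℝ, E) φ y v)‖ ≤ r * ‖v‖} ∈ 𝓝 p :=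
    inter_mem (extChartAt_source_mem_nhds p) (eventually_norm_toFiber_mfderiv_le p hr)
  obtain ⟨c, cpos, hc⟩ := setOfPred_riemannianEDist_lt_subset_nhds' 𝓘(ℝ, E) hU
  have c2 : 0 < c / 2 := ENNReal.half_pos cpos.ne'
  have h1 : ∀ᶠ q : M × M in 𝓝 (p, p), riemannianEDist 𝓘(ℝ, E) p q.1 < c / 2 :=
    (continuous_fst.tendsto (p, p)).eventually (eventually_riemannianEDist_lt 𝓘(ℝ, E) p c2)
  -- short curves between points close to `p` stay in the region where the chart is controlled
  have h2 : ∀ᶠ q : M × M in 𝓝 (p, p), riemannianEDist 𝓘(ℝ, E) q.1 q.2 < c / 2 := by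
    refine continuous_riemannianEDist.continuousAt.eventually (gt_mem_nhds ?_)
    simpa [riemannianEDist_self] using c2
  filter_upwards [h1, h2] with q hq1 hq2
  have r0 : ENNReal.ofReal r ≠ 0 := by simpa using (by linarith : 0 < r)
  rw [mul_comm, ← ENNReal.div_le_iff r0 ENNReal.ofReal_ne_top]
  refine le_of_forall_gt fun a ha ↦ ?_
  obtain ⟨γ, γ0, γ1, γs, hγ⟩ := exists_lt_of_riemannianEDist_lt (lt_min ha hq2)
  have hγU : ∀ t ∈ Icc (0 : ℝ) 1, γ t ∈ φ.source ∧ ∀ v : TangentSpace 𝓘(ℝ, E) (γ t),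
      ‖toFiber E p (mfderiv 𝓘(ℝ, E) 𝓘(ℝ, E) φ (γ t) v)‖ ≤ r * ‖v‖ := by
    intro t ht
    apply hc
    have h3 : riemannianEDist 𝓘(ℝ, E) q.1 (γ t) < c / 2 :=
      ((riemannianEDist_le_pathELength (γs.mono (Icc_subset_Icc_right ht.2)) γ0 rfl ht.1).trans
        (pathELength_mono le_rfl ht.2)).trans_lt (hγ.trans_le (min_le_right _ _))
    calc riemannianEDist 𝓘(ℝ, E) p (γ t) ≤ _ := riemannianEDist_triangle (y := q.1)
      _ < c / 2 + c / 2 := ENNReal.add_lt_add hq1 h3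
      _ = c := ENNReal.add_halves c
  have hsm : ContMDiffOn 𝓘(ℝ, ℝ) 𝓘(ℝ, E) 1 (φ ∘ γ) (Icc 0 1) :=
    contMDiffOn_extChartAt.comp γs fun t ht ↦ by simpa [φ] using (hγU t ht).1
  have hsm' : ContDiffOn ℝ 1 (toFiber E p ∘ φ ∘ γ) (Icc 0 1) :=
    (toFiber E p).contDiff.comp_contDiffOn hsm.contDiffOn
  have := enorm_sub_le_lintegral_deriv_of_contDiffOn_Icc hsm' zero_le_one
  rw [ENNReal.div_lt_iff (Or.inl r0) (Or.inl ENNReal.ofReal_ne_top)]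
  have e1 : ENNReal.ofReal ‖toFiber E p (φ q.2 - φ q.1)‖ =
      ‖(toFiber E p ∘ φ ∘ γ) 1 - (toFiber E p ∘ φ ∘ γ) 0‖ₑ := by
    rw [← ofReal_norm]; simp [γ0, γ1, map_sub]
  rw [e1]
  refine this.trans_lt ?_
  have : (∫⁻ t in Icc (0 : ℝ) 1, ‖deriv (toFiber E p ∘ φ ∘ γ) t‖ₑ) ≤
      ENNReal.ofReal r * pathELength 𝓘(ℝ, E) γ 0 1 := by
    rw [pathELength_eq_lintegral_mfderiv_Ioo, restrict_Ioo_eq_restrict_Icc.symm,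
      ← lintegral_const_mul' _ _ ENNReal.ofReal_ne_top]
    refine setLIntegral_mono' measurableSet_Ioo fun t ht ↦ ?_
    have hb := hγU t (Ioo_subset_Icc_self ht)
    have hd : MDifferentiableAt 𝓘(ℝ, ℝ) 𝓘(ℝ, E) γ t :=
      (γs.contMDiffAt (Icc_mem_nhds ht.1 ht.2)).mdifferentiableAt one_ne_zero
    have hd' : HasMFDerivAt 𝓘(ℝ, ℝ) 𝓘(ℝ, E) (φ ∘ γ) t _ :=
      (mdifferentiableAt_extChartAt (by simpa [φ] using hb.1)).hasMFDerivAt.comp t hd.hasMFDerivAt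
    have hd2 := ((toFiber E p).hasFDerivAt.comp t hd'.hasFDerivAt).hasDerivAt
    rw [hd2.deriv, ← ofReal_norm, ← ofReal_norm, ← ENNReal.ofReal_mul (by linarith)]
    exact ENNReal.ofReal_le_ofReal (hb.2 _)
  calc _ ≤ _ := this
    _ < ENNReal.ofReal r * a :=
      ENNReal.mul_lt_mul_right r0 ENNReal.ofReal_ne_top (hγ.trans_le (min_le_left _ _))
    _ = _ := mul_comm _ _

end Metric

/-! ### Curves, and metric geodesics -/

section Curves

variable {E : Type*} [NormedAddCommGroup E] [NormedSpace ℝ E]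
  {M : Type*} [TopologicalSpace M] [ChartedSpace E M]

theorem hasMFDerivWithinAt_curve_iff {f : ℝ → M} {s : Set ℝ} {t : ℝ}
    {L : TangentSpace 𝓘(ℝ, ℝ) t →L[ℝ] TangentSpace 𝓘(ℝ, E) (f t)} :
    HasMFDerivWithinAt 𝓘(ℝ, ℝ) 𝓘(ℝ, E) f s t L ↔ ContinuousWithinAt f s t ∧
      HasFDerivWithinAt (𝕜 := ℝ) (E := ℝ) (F := E) (extChartAt 𝓘(ℝ, E) (f t) ∘ f) L s t := by
  simp only [HasMFDerivWithinAt, writtenInExtChartAt, chartAt_self_eq, mfld_simps]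

/-- A curve is `C¹` at a point if and only if, in the chart around that point, it has a continuous
derivative nearby. -/
theorem contMDiffWithinAt_curve_iff {f : ℝ → M} {s : Set ℝ} {t : ℝ} (ht : t ∈ s) :
    ContMDiffWithinAt 𝓘(ℝ, ℝ) 𝓘(ℝ, E) 1 f s t ↔ ContinuousWithinAt f s t ∧
      ∃ V : ℝ → E, ∃ u ∈ 𝓝[s] t, ContinuousOn V u ∧
        ∀ τ ∈ u, HasDerivWithinAt (extChartAt 𝓘(ℝ, E) (f t) ∘ f) (V τ) u τ := by
  rw [contMDiffWithinAt_iff]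
  simp only [chartAt_self_eq, modelWithCornersSelf_coe, range_id, inter_univ,
    mfld_simps, Function.comp_id, preimage_id]
  refine and_congr_right fun _ ↦ ?_
  have : (1 : ℕ∞ω) = 0 + 1 := (zero_add 1).symm
  rw [this, contDiffWithinAt_succ_iff_hasFDerivWithinAt (by simp), insert_eq_of_mem ht]
  constructor
  · rintro ⟨u, hu, -, f', hf', h0⟩
    obtain ⟨v, hv, hc⟩ := (contDiffWithinAt_zero (mem_of_mem_nhdsWithin ht hu)).1 h0
    refine ⟨fun τ ↦ f' τ 1, u ∩ v, inter_mem hu ?_, hc.clm_apply continuousOn_const, ?_⟩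
    · exact nhdsWithin_le_of_mem hu hv
    · exact fun τ hτ ↦ ((hf' τ hτ.1).mono inter_subset_left).hasDerivWithinAt
  · rintro ⟨V, u, hu, hV, hd⟩
    refine ⟨u, hu, by simp, fun τ ↦ ContinuousLinearMap.toSpanSingleton ℝ (V τ),
      fun τ hτ ↦ (hd τ hτ).hasFDerivWithinAt, ?_⟩
    rw [contDiffWithinAt_zero (mem_of_mem_nhdsWithin ht hu)]
    exact ⟨u, self_mem_nhdsWithin,
      ((ContinuousLinearMap.toSpanSingletonCLE (𝕜 := ℝ) (E := E)).continuous.comp_continuousOn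
        hV).mono inter_subset_left⟩

theorem union_mem_nhdsWithin_of_lt {u w : Set ℝ} {t₀ τ : ℝ} (h : τ < t₀) :
    u ∩ Iic t₀ ∈ 𝓝[u ∩ Iic t₀ ∪ w ∩ Ici t₀] τ := by
  rw [mem_nhdsWithin]
  refine ⟨Iio t₀, isOpen_Iio, h, ?_⟩
  rintro σ ⟨hσ, hσ' | hσ'⟩
  · exact hσ'
  · exact absurd (mem_Ici.1 hσ'.2) (not_le.2 hσ)

theorem union_mem_nhdsWithin_of_gt {u w : Set ℝ} {t₀ τ : ℝ} (h : t₀ < τ) :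
    w ∩ Ici t₀ ∈ 𝓝[u ∩ Iic t₀ ∪ w ∩ Ici t₀] τ := by
  rw [mem_nhdsWithin]
  refine ⟨Ioi t₀, isOpen_Ioi, h, ?_⟩
  rintro σ ⟨hσ, hσ' | hσ'⟩
  · exact absurd (mem_Iic.1 hσ'.2) (not_le.2 hσ)
  · exact hσ'

/-- Two functions with continuous derivatives `V` and `W` to the left and to the right of `t₀`
have a continuous derivative on both sides, provided `V` and `W` agree at `t₀`. -/
theorem hasDerivWithinAt_ite_union {g V W : ℝ → E} {u w : Set ℝ} {t₀ : ℝ} (h : V t₀ = W t₀)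
    (htu : t₀ ∈ u) (htw : t₀ ∈ w) (hVc : ContinuousOn V u) (hWc : ContinuousOn W w)
    (hV : ∀ τ ∈ u, HasDerivWithinAt g (V τ) u τ) (hW : ∀ τ ∈ w, HasDerivWithinAt g (W τ) w τ) :
    ContinuousOn (fun τ ↦ if τ ≤ t₀ then V τ else W τ) (u ∩ Iic t₀ ∪ w ∩ Ici t₀) ∧
      ∀ τ ∈ u ∩ Iic t₀ ∪ w ∩ Ici t₀,
        HasDerivWithinAt g (if τ ≤ t₀ then V τ else W τ) (u ∩ Iic t₀ ∪ w ∩ Ici t₀) τ := by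
  have el : ∀ σ ∈ u ∩ Iic t₀, (if σ ≤ t₀ then V σ else W σ) = V σ := fun σ hσ ↦ if_pos hσ.2
  have er : ∀ σ ∈ w ∩ Ici t₀, (if σ ≤ t₀ then V σ else W σ) = W σ := fun σ hσ ↦ by
    rcases (mem_Ici.1 hσ.2).eq_or_lt with rfl | h'
    · simp [h]
    · exact if_neg (not_le.2 h')
  have hl : ContinuousOn (fun τ ↦ if τ ≤ t₀ then V τ else W τ) (u ∩ Iic t₀) :=
    (hVc.mono inter_subset_left).congr el
  have hr : ContinuousOn (fun τ ↦ if τ ≤ t₀ then V τ else W τ) (w ∩ Ici t₀) :=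
    (hWc.mono inter_subset_left).congr er
  have dl : ∀ τ ∈ u ∩ Iic t₀, HasDerivWithinAt g (if τ ≤ t₀ then V τ else W τ) (u ∩ Iic t₀) τ :=
    fun τ hτ ↦ by rw [el τ hτ]; exact (hV τ hτ.1).mono inter_subset_left
  have dr : ∀ τ ∈ w ∩ Ici t₀, HasDerivWithinAt g (if τ ≤ t₀ then V τ else W τ) (w ∩ Ici t₀) τ :=
    fun τ hτ ↦ by rw [er τ hτ]; exact (hW τ hτ.1).mono inter_subset_left
  have key : ∀ τ ∈ u ∩ Iic t₀ ∪ w ∩ Ici t₀,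
      ContinuousWithinAt (fun τ ↦ if τ ≤ t₀ then V τ else W τ) (u ∩ Iic t₀ ∪ w ∩ Ici t₀) τ ∧
        HasDerivWithinAt g (if τ ≤ t₀ then V τ else W τ) (u ∩ Iic t₀ ∪ w ∩ Ici t₀) τ := by
    intro τ hτ
    rcases lt_trichotomy τ t₀ with hlt | rfl | hgt
    · have hm : τ ∈ u ∩ Iic t₀ := hτ.resolve_right fun h' ↦ absurd h'.2 (not_le.2 hlt)
      have hn := union_mem_nhdsWithin_of_lt (u := u) (w := w) hlt
      exact ⟨(hl τ hm).mono_of_mem_nhdsWithin hn, (dl τ hm).mono_of_mem_nhdsWithin hn⟩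
    · exact ⟨(hl τ ⟨htu, self_mem_Iic⟩).union (hr τ ⟨htw, self_mem_Ici⟩),
        (dl τ ⟨htu, self_mem_Iic⟩).union (dr τ ⟨htw, self_mem_Ici⟩)⟩
    · have hm : τ ∈ w ∩ Ici t₀ := hτ.resolve_left fun h' ↦ absurd h'.2 (not_le.2 hgt)
      have hn := union_mem_nhdsWithin_of_gt (u := u) (w := w) hgt
      exact ⟨(hr τ hm).mono_of_mem_nhdsWithin hn, (dr τ hm).mono_of_mem_nhdsWithin hn⟩
  exact ⟨fun τ hτ ↦ (key τ hτ).1, fun τ hτ ↦ (key τ hτ).2⟩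

variable [RiemannianBundle (fun x : M ↦ TangentSpace 𝓘(ℝ, E) x)]

variable (E) in
/-- A curve is a metric geodesic of speed `d` on `[0, 1]` if the geodesic distance of any two of its
points is proportional to the time needed to travel from one to the other. -/
def IsMetricGeodesic (d : ℝ) (f : ℝ → M) : Prop :=
  0 ≤ d ∧ ∀ s ∈ Icc (0 : ℝ) 1, ∀ t ∈ Icc (0 : ℝ) 1,
    riemannianEDist 𝓘(ℝ, E) (f s) (f t) = ENNReal.ofReal (d * |t - s|)

/-- A curve which is `d`-Lipschitz and whose endpoints have distance `d` is a metric geodesic: a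
deficit on some subinterval would produce a shortcut. -/
theorem isMetricGeodesic_of_le {d : ℝ} (hd : 0 ≤ d) {f : ℝ → M}
    (h : ∀ s ∈ Icc (0 : ℝ) 1, ∀ t ∈ Icc (0 : ℝ) 1, s ≤ t →
      riemannianEDist 𝓘(ℝ, E) (f s) (f t) ≤ ENNReal.ofReal (d * (t - s)))
    (h01 : ENNReal.ofReal d ≤ riemannianEDist 𝓘(ℝ, E) (f 0) (f 1)) :
    IsMetricGeodesic E d f := by
  have key : ∀ s ∈ Icc (0 : ℝ) 1, ∀ t ∈ Icc (0 : ℝ) 1, s ≤ t →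
      riemannianEDist 𝓘(ℝ, E) (f s) (f t) = ENNReal.ofReal (d * (t - s)) := by
    intro s hs t ht hst
    refine le_antisymm (h s hs t ht hst) ?_
    have h1 := h 0 (by simp) s hs hs.1
    have h2 := h t ht 1 (by simp) ht.2
    have hfin : riemannianEDist 𝓘(ℝ, E) (f s) (f t) ≠ ⊤ :=
      ne_top_of_le_ne_top ENNReal.ofReal_ne_top (h s hs t ht hst)
    rw [← ENNReal.ofReal_toReal hfin]
    have h3 : ENNReal.ofReal d ≤ ENNReal.ofReal (d * (s - 0)) +
        ENNReal.ofReal (riemannianEDist 𝓘(ℝ, E) (f s) (f t)).toReal +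
        ENNReal.ofReal (d * (1 - t)) := by
      rw [ENNReal.ofReal_toReal hfin]
      exact (h01.trans riemannianEDist_triangle).trans
        (add_le_add (riemannianEDist_triangle.trans (add_le_add h1 le_rfl)) h2)
    have e1 : 0 ≤ d * (s - 0) := mul_nonneg hd (by linarith [hs.1])
    have e2 : 0 ≤ d * (1 - t) := mul_nonneg hd (by linarith [ht.2])
    rw [← ENNReal.ofReal_add e1 ENNReal.toReal_nonneg,
      ← ENNReal.ofReal_add (add_nonneg e1 ENNReal.toReal_nonneg) e2,
      ENNReal.ofReal_le_ofReal_iff (by positivity)] at h3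
    apply ENNReal.ofReal_le_ofReal
    linarith
  refine ⟨hd, fun s hs t ht ↦ ?_⟩
  rcases le_total s t with hst | hst
  · rw [key s hs t ht hst, abs_of_nonneg (by linarith)]
  · rw [riemannianEDist_comm, key t ht s hs hst, abs_of_nonpos (by linarith), neg_sub]

theorem IsMetricGeodesic.edist_zero_one {d : ℝ} {f : ℝ → M} (h : IsMetricGeodesic E d f) :
    riemannianEDist 𝓘(ℝ, E) (f 0) (f 1) = ENNReal.ofReal d := by
  simpa using h.2 0 (by simp) 1 (by simp)

theorem IsMetricGeodesic.congr {d : ℝ} {f g : ℝ → M} (h : IsMetricGeodesic E d f)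
    (hfg : EqOn f g (Icc 0 1)) : IsMetricGeodesic E d g :=
  ⟨h.1, fun s hs t ht ↦ by rw [← hfg hs, ← hfg ht, h.2 s hs t ht]⟩

variable [IsManifold 𝓘(ℝ, E) 1 M]
  [IsContinuousRiemannianBundle E (fun x : M ↦ TangentSpace 𝓘(ℝ, E) x)]

theorem tendsto_mul_nhdsGT_one (c : ℝ) : Tendsto (fun r : ℝ ↦ r * c) (𝓝[>] 1) (𝓝 c) := by
  have : Tendsto (fun r : ℝ ↦ r * c) (𝓝 1) (𝓝 (1 * c)) := tendsto_id.mul_const c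
  rw [one_mul] at this
  exact this.mono_left nhdsWithin_le_nhds

/-- If the distance of `α` and `β` is at most `d * δ` along a filter converging to `p`, then the
norms of the difference quotients in the chart at `p` have a limit at most `d`. -/
theorem le_of_tendsto_norm_toFiber [RegularSpace M] {p : M} {α β : ℝ → M} {δ : ℝ → ℝ}
    {l : Filter ℝ} [l.NeBot] {c d : ℝ} (hα : Tendsto α l (𝓝 p)) (hβ : Tendsto β l (𝓝 p))
    (hδ : ∀ᶠ s in l, 0 < δ s)
    (hc : Tendsto (fun s ↦ (δ s)⁻¹ *
      ‖toFiber E p (extChartAt 𝓘(ℝ, E) p (β s) - extChartAt 𝓘(ℝ, E) p (α s))‖) l (𝓝 c))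
    (hd : ∀ᶠ s in l, riemannianEDist 𝓘(ℝ, E) (α s) (β s) ≤ ENNReal.ofReal (d * δ s)) (d0 : 0 ≤ d) :
    c ≤ d := by
  refine ge_of_tendsto (tendsto_mul_nhdsGT_one d)
    (eventually_mem_nhdsWithin.mono fun r (hr : 1 < r) ↦ le_of_tendsto hc ?_)
  have h := (hα.prodMk_nhds hβ).eventually (eventually_norm_toFiber_le (E := E) p hr)
  filter_upwards [h, hδ, hd] with s h1 h2 h3
  rw [inv_mul_le_iff₀ h2]
  have h4 := h1.trans (mul_le_mul_right h3 _)
  rw [← ENNReal.ofReal_mul (by linarith), ENNReal.ofReal_le_ofReal_iff (by positivity)] at h4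
  linarith

/-- If the distance of `α` and `β` is at least `d * δ` along a filter converging to `p`, then the
norms of the difference quotients in the chart at `p` have a limit at least `d`. -/
theorem ge_of_tendsto_norm_toFiber {p : M} {α β : ℝ → M} {δ : ℝ → ℝ}
    {l : Filter ℝ} [l.NeBot] {c d : ℝ} (hα : Tendsto α l (𝓝 p)) (hβ : Tendsto β l (𝓝 p))
    (hδ : ∀ᶠ s in l, 0 < δ s)
    (hc : Tendsto (fun s ↦ (δ s)⁻¹ *
      ‖toFiber E p (extChartAt 𝓘(ℝ, E) p (β s) - extChartAt 𝓘(ℝ, E) p (α s))‖) l (𝓝 c))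
    (hd : ∀ᶠ s in l, ENNReal.ofReal (d * δ s) ≤ riemannianEDist 𝓘(ℝ, E) (α s) (β s)) :
    d ≤ c := by
  refine ge_of_tendsto (tendsto_mul_nhdsGT_one c)
    (eventually_mem_nhdsWithin.mono fun r (hr : 1 < r) ↦ ge_of_tendsto (hc.const_mul r) ?_)
  have h := (hα.prodMk_nhds hβ).eventually (eventually_riemannianEDist_le (E := E) p hr)
  filter_upwards [h, hδ, hd] with s h1 h2 h3
  have h4 := h3.trans h1
  rw [ENNReal.ofReal_le_ofReal_iff (by positivity)] at h4
  rw [← mul_le_mul_iff_left₀ h2]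
  refine h4.trans_eq ?_
  field_simp

/-- The speed of a differentiable metric geodesic. -/
theorem IsMetricGeodesic.norm_deriv [RegularSpace M] {d : ℝ} {f : ℝ → M}
    (h : IsMetricGeodesic E d f) {t : ℝ} {s : Set ℝ} (hs : s ⊆ Icc 0 1) (ht : t ∈ s)
    (hne : (𝓝[s \ {t}] t).NeBot) {v : E} (hc : ContinuousWithinAt f s t)
    (hv : HasDerivWithinAt (extChartAt 𝓘(ℝ, E) (f t) ∘ f) v s t) :
    ‖toFiber E (f t) v‖ = d := by
  have hc' : Tendsto f (𝓝[s \ {t}] t) (𝓝 (f t)) := hc.mono_left (nhdsWithin_mono _ sdiff_subset)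
  have hn : Tendsto (fun u ↦ |u - t|⁻¹ * ‖toFiber E (f t)
      (extChartAt 𝓘(ℝ, E) (f t) (f u) - extChartAt 𝓘(ℝ, E) (f t) (f t))‖)
      (𝓝[s \ {t}] t) (𝓝 ‖toFiber E (f t) v‖) := by
    refine (((toFiber E (f t)).continuous.norm.tendsto v).comp
      (hasDerivWithinAt_iff_tendsto_slope.1 hv)).congr fun u ↦ ?_
    simp only [slope, vsub_eq_sub, map_smul, norm_smul, norm_inv, Real.norm_eq_abs,
      Function.comp_apply]
  have hmem : ∀ᶠ u in 𝓝[s \ {t}] t, u ∈ s \ {t} := self_mem_nhdsWithin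
  have hpos : ∀ᶠ u in 𝓝[s \ {t}] t, 0 < |u - t| := by
    filter_upwards [hmem] with u hu using abs_pos.2 (sub_ne_zero.2 hu.2)
  have hdist : ∀ᶠ u in 𝓝[s \ {t}] t,
      riemannianEDist 𝓘(ℝ, E) (f t) (f u) = ENNReal.ofReal (d * |u - t|) := by
    filter_upwards [hmem] with u hu using h.2 t (hs ht) u (hs hu.1)
  exact le_antisymm
    (le_of_tendsto_norm_toFiber tendsto_const_nhds hc' hpos hn (hdist.mono fun _ h ↦ h.le) h.1)
    (ge_of_tendsto_norm_toFiber tendsto_const_nhds hc' hpos hn (hdist.mono fun _ h ↦ h.ge))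

/-- A metric geodesic has no corner: if it is `C¹` on both sides of `t₀`, it is `C¹` at `t₀`. If
`u` and `w` are the one-sided velocities at `t₀`, both of norm `d`, then the chord from
`f (t₀ - δ)` to `f (t₀ + δ)` has length about `δ * ‖u + w‖`, so that `2 * d ≤ ‖u + w‖`, and the
parallelogram law gives `u = w`. -/
theorem IsMetricGeodesic.contMDiffWithinAt_corner [RegularSpace M] {d : ℝ} {f : ℝ → M}
    (h : IsMetricGeodesic E d f) {t₀ : ℝ} (ht₀ : t₀ ∈ Ioo (0 : ℝ) 1)
    (hl : ContMDiffWithinAt 𝓘(ℝ, ℝ) 𝓘(ℝ, E) 1 f (Icc 0 t₀) t₀)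
    (hr : ContMDiffWithinAt 𝓘(ℝ, ℝ) 𝓘(ℝ, E) 1 f (Icc t₀ 1) t₀) :
    ContMDiffWithinAt 𝓘(ℝ, ℝ) 𝓘(ℝ, E) 1 f (Icc 0 1) t₀ := by
  have h0 := ht₀.1
  have h1 := ht₀.2
  have hIcc : Icc (0 : ℝ) 1 = Icc 0 t₀ ∪ Icc t₀ 1 := (Icc_union_Icc_eq_Icc h0.le h1.le).symm
  set φ := extChartAt 𝓘(ℝ, E) (f t₀) with hφ
  obtain ⟨cl, V, u, hu, hVc, hV⟩ := (contMDiffWithinAt_curve_iff (right_mem_Icc.2 h0.le)).1 hl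
  obtain ⟨cr, W, w, hw, hWc, hW⟩ := (contMDiffWithinAt_curve_iff (left_mem_Icc.2 h1.le)).1 hr
  have hul : u ∈ 𝓝[≤] t₀ := by rwa [nhdsWithin_Icc_eq_nhdsLE h0] at hu
  have hwr : w ∈ 𝓝[≥] t₀ := by rwa [nhdsWithin_Icc_eq_nhdsGE h1] at hw
  have hIl : Icc 0 t₀ ∈ 𝓝[≤] t₀ := Icc_mem_nhdsLE h0
  have hIr : Icc t₀ 1 ∈ 𝓝[≥] t₀ := Icc_mem_nhdsGE h1
  have htu : t₀ ∈ u := mem_of_mem_nhdsWithin self_mem_Iic hul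
  have htw : t₀ ∈ w := mem_of_mem_nhdsWithin self_mem_Ici hwr
  have dl : HasDerivWithinAt (φ ∘ f) (V t₀) (Iic t₀) t₀ := (hV t₀ htu).mono_of_mem_nhdsWithin hul
  have dr : HasDerivWithinAt (φ ∘ f) (W t₀) (Ici t₀) t₀ := (hW t₀ htw).mono_of_mem_nhdsWithin hwr
  -- Both one-sided velocities have norm `d`.
  have nl : ‖toFiber E (f t₀) (V t₀)‖ = d :=
    h.norm_deriv (Icc_subset_Icc_right h1.le) (right_mem_Icc.2 h0.le)
      (by rw [Icc_sdiff_right]; exact right_nhdsWithin_Ico_neBot h0) cl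
      (dl.mono Icc_subset_Iic_self)
  have nr : ‖toFiber E (f t₀) (W t₀)‖ = d :=
    h.norm_deriv (Icc_subset_Icc_left h0.le) (left_mem_Icc.2 h1.le)
      (by rw [Icc_sdiff_left]; exact left_nhdsWithin_Ioc_neBot h1) cr
      (dr.mono Icc_subset_Ici_self)
  have tl : Tendsto (fun δ : ℝ ↦ t₀ - δ) (𝓝[>] 0) (𝓝[<] t₀) := by
    refine tendsto_nhdsWithin_iff.2 ⟨?_, eventually_mem_nhdsWithin.mono fun δ (hδ : 0 < δ) ↦ ?_⟩
    · exact ((continuous_sub_left t₀).tendsto' 0 t₀ (by simp)).mono_left nhdsWithin_le_nhds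
    · simpa using hδ
  have tr : Tendsto (fun δ : ℝ ↦ t₀ + δ) (𝓝[>] 0) (𝓝[>] t₀) := by
    refine tendsto_nhdsWithin_iff.2 ⟨?_, eventually_mem_nhdsWithin.mono fun δ (hδ : 0 < δ) ↦ ?_⟩
    · exact ((continuous_const_add t₀).tendsto' 0 t₀ (by simp)).mono_left nhdsWithin_le_nhds
    · simpa using hδ
  have sl : Tendsto (fun δ : ℝ ↦ δ⁻¹ • (φ (f t₀) - φ (f (t₀ - δ)))) (𝓝[>] 0) (𝓝 (V t₀)) := by
    have := ((hasDerivWithinAt_iff_tendsto_slope' (by simp)).1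
      (dl.mono Iio_subset_Iic_self)).comp tl
    refine this.congr fun δ ↦ ?_
    simp only [slope, Function.comp_apply, vsub_eq_sub]
    rw [show t₀ - δ - t₀ = -δ by ring, inv_neg, neg_smul, ← smul_neg, neg_sub]
  have sr : Tendsto (fun δ : ℝ ↦ δ⁻¹ • (φ (f (t₀ + δ)) - φ (f t₀))) (𝓝[>] 0) (𝓝 (W t₀)) := by
    have := ((hasDerivWithinAt_iff_tendsto_slope' (by simp)).1
      (dr.mono Ioi_subset_Ici_self)).comp tr
    refine this.congr fun δ ↦ ?_
    simp only [slope, Function.comp_apply, vsub_eq_sub, add_sub_cancel_left]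
  have hsum : 2 * d ≤ ‖toFiber E (f t₀) (V t₀ + W t₀)‖ := by
    refine ge_of_tendsto_norm_toFiber (E := E) (p := f t₀) (l := 𝓝[>] (0 : ℝ)) (δ := fun δ ↦ δ)
      (α := fun δ ↦ f (t₀ - δ)) (β := fun δ ↦ f (t₀ + δ)) ?_ ?_ eventually_mem_nhdsWithin ?_ ?_
    · have : Tendsto f (𝓝[≤] t₀) (𝓝 (f t₀)) := by
        rw [← nhdsWithin_Icc_eq_nhdsLE h0]; exact cl
      exact (this.mono_left (nhdsWithin_mono _ Iio_subset_Iic_self)).comp tl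
    · have : Tendsto f (𝓝[≥] t₀) (𝓝 (f t₀)) := by
        rw [← nhdsWithin_Icc_eq_nhdsGE h1]; exact cr
      exact (this.mono_left (nhdsWithin_mono _ Ioi_subset_Ici_self)).comp tr
    · refine (((toFiber E (f t₀)).continuous.norm.tendsto _).comp (sl.add sr)).congr' ?_
      filter_upwards [self_mem_nhdsWithin] with δ (hδ : 0 < δ)
      rw [Function.comp_apply, ← smul_add, map_smul, norm_smul, norm_inv, Real.norm_of_nonneg hδ.le]
      congr 3
      abel
    · have e1 : ∀ᶠ δ : ℝ in 𝓝[>] 0, δ < t₀ :=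
        (Filter.Tendsto.eventually_lt_const h0 tendsto_id).filter_mono nhdsWithin_le_nhds
      have e2 : ∀ᶠ δ : ℝ in 𝓝[>] 0, δ < 1 - t₀ :=
        (Filter.Tendsto.eventually_lt_const (sub_pos.2 h1) tendsto_id).filter_mono
          nhdsWithin_le_nhds
      filter_upwards [e1, e2, self_mem_nhdsWithin] with δ h1' h2' (h3' : 0 < δ)
      rw [h.2 (t₀ - δ) ⟨by linarith, by linarith⟩ (t₀ + δ) ⟨by linarith, by linarith⟩,
        abs_of_nonneg (by linarith)]
      exact ENNReal.ofReal_le_ofReal (by linarith)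
  have hVW : V t₀ = W t₀ := by
    have para := parallelogram_law_with_norm ℝ (toFiber E (f t₀) (V t₀)) (toFiber E (f t₀) (W t₀))
    rw [← map_add, nl, nr] at para
    have : ‖toFiber E (f t₀) (V t₀) - toFiber E (f t₀) (W t₀)‖ = 0 := by
      nlinarith [h.1, norm_nonneg (toFiber E (f t₀) (V t₀) - toFiber E (f t₀) (W t₀))]
    exact (toFiber E (f t₀)).injective (sub_eq_zero.1 (norm_eq_zero.1 this))
  refine (contMDiffWithinAt_curve_iff (Ioo_subset_Icc_self ht₀)).2 ⟨?_,
    fun τ ↦ if τ ≤ t₀ then V τ else W τ, (u ∩ Iic t₀) ∪ (w ∩ Ici t₀), ?_, ?_, ?_⟩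
  · rw [hIcc]; exact cl.union cr
  · rw [hIcc, nhdsWithin_union]
    refine ⟨mem_of_superset (inter_mem hu ?_) subset_union_left,
      mem_of_superset (inter_mem hw ?_) subset_union_right⟩
    · exact mem_of_superset self_mem_nhdsWithin Icc_subset_Iic_self
    · exact mem_of_superset self_mem_nhdsWithin Icc_subset_Ici_self
  · exact (hasDerivWithinAt_ite_union hVW htu htw hVc hWc hV hW).1
  · exact (hasDerivWithinAt_ite_union hVW htu htw hVc hWc hV hW).2

end Curves

/-! ### Minimal geodesics -/

section Geodesics

variable {E : Type*} [NormedAddCommGroup E] [NormedSpace ℝ E]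
  {M : Type*} [TopologicalSpace M] [ChartedSpace E M]
  [RiemannianBundle (fun x : M ↦ TangentSpace 𝓘(ℝ, E) x)]

variable (E) in
/-- A minimal geodesic from `x` to `y`, as a function on the real line of which only the restriction
to `[0, 1]` matters: a `C¹` metric geodesic. -/
structure IsMinGeodesic (x y : M) (f : ℝ → M) : Prop where
  map_zero : f 0 = x
  map_one : f 1 = y
  contMDiffOn : ContMDiffOn 𝓘(ℝ, ℝ) 𝓘(ℝ, E) 1 f (Icc 0 1)
  exists_isMetricGeodesic : ∃ d : ℝ, IsMetricGeodesic E d f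

theorem IsMinGeodesic.isMetricGeodesic {x y : M} {f : ℝ → M} (h : IsMinGeodesic E x y f) :
    IsMetricGeodesic E (riemannianEDist 𝓘(ℝ, E) x y).toReal f := by
  obtain ⟨d, hd⟩ := h.exists_isMetricGeodesic
  have := hd.edist_zero_one
  rw [h.map_zero, h.map_one] at this
  rwa [this, ENNReal.toReal_ofReal hd.1]

theorem IsMinGeodesic.edist_ne_top {x y : M} {f : ℝ → M} (h : IsMinGeodesic E x y f) :
    riemannianEDist 𝓘(ℝ, E) x y ≠ ⊤ := by
  obtain ⟨d, hd⟩ := h.exists_isMetricGeodesic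
  have := hd.edist_zero_one
  rw [h.map_zero, h.map_one] at this
  rw [this]
  exact ENNReal.ofReal_ne_top

/-- A `C¹` curve whose velocity has norm at most `d` is `d`-Lipschitz for the geodesic distance. -/
theorem riemannianEDist_le_of_norm_mfderivWithin_le {f : ℝ → M} {d : ℝ}
    (hf : ContMDiffOn 𝓘(ℝ, ℝ) 𝓘(ℝ, E) 1 f (Icc 0 1))
    (hd : ∀ t ∈ Icc (0 : ℝ) 1, ‖mfderivWithin 𝓘(ℝ, ℝ) 𝓘(ℝ, E) f (Icc 0 1) t (1 : ℝ)‖ ≤ d)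
    {s t : ℝ} (hs : s ∈ Icc (0 : ℝ) 1) (ht : t ∈ Icc (0 : ℝ) 1) (hst : s ≤ t) :
    riemannianEDist 𝓘(ℝ, E) (f s) (f t) ≤ ENNReal.ofReal (d * (t - s)) := by
  have d0 : 0 ≤ d := (norm_nonneg _).trans (hd 0 (by simp))
  refine (riemannianEDist_le_pathELength (hf.mono (Icc_subset_Icc hs.1 ht.2)) rfl rfl hst).trans ?_
  rw [pathELength_eq_lintegral_mfderiv_Ioo]
  calc ∫⁻ τ in Ioo s t, ‖mfderiv 𝓘(ℝ, ℝ) 𝓘(ℝ, E) f τ 1‖ₑ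
      ≤ ∫⁻ τ in Ioo s t, ENNReal.ofReal d := by
        refine setLIntegral_mono' measurableSet_Ioo fun τ hτ ↦ ?_
        have h0 : 0 < τ := hs.1.trans_lt hτ.1
        have h1 : τ < 1 := hτ.2.trans_le ht.2
        rw [← mfderivWithin_of_mem_nhds (Icc_mem_nhds h0 h1), ← ofReal_norm]
        exact ENNReal.ofReal_le_ofReal (hd τ ⟨h0.le, h1.le⟩)
    _ = ENNReal.ofReal (d * (t - s)) := by
        simp [ENNReal.ofReal_mul d0]

/-- The length of a curve of constant speed on `[0, 1]` is its speed, and the curve is Lipschitz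
with that constant, so that it is a metric geodesic if its length is the distance of the
endpoints. -/
theorem isMinGeodesic_of_isMinimalGeodesic {x y : M} {γ : Path x y}
    (h : DescendingMetric.IsMinimalGeodesic (E := E) γ) : IsMinGeodesic E x y γ.extend := by
  obtain ⟨c, hc⟩ := h.constant_speed
  refine ⟨by simp, by simp, h.contMDiffOn, c, ?_⟩
  have c0 : 0 ≤ c := (hc 0 (by simp)) ▸ norm_nonneg _
  refine isMetricGeodesic_of_le c0 (fun s hs t ht hst ↦
    riemannianEDist_le_of_norm_mfderivWithin_le h.contMDiffOn (fun τ hτ ↦ (hc τ hτ).le) hs ht hst)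
    ?_
  have hl := h.length_eq
  rw [pathELength_eq_lintegral_mfderivWithin_Icc, DescendingMetric.dist] at hl
  rw [Path.extend_zero, Path.extend_one, ← hl]
  have : ENNReal.ofReal c = ∫⁻ _ in Icc (0 : ℝ) 1, ENNReal.ofReal c := by simp
  rw [this]
  refine setLIntegral_mono' measurableSet_Icc fun t ht ↦ ?_
  rw [← hc t ht, ofReal_norm]
  rfl

variable [IsManifold 𝓘(ℝ, E) 1 M]
  [IsContinuousRiemannianBundle E (fun x : M ↦ TangentSpace 𝓘(ℝ, E) x)]

theorem neBot_nhdsWithin_Icc_sdiff {t : ℝ} (ht : t ∈ Icc (0 : ℝ) 1) :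
    (𝓝[Icc (0 : ℝ) 1 \ {t}] t).NeBot := by
  have := (uniqueDiffOn_Icc (zero_lt_one (α := ℝ)) t ht).accPt
  rwa [accPt_principal_iff_nhdsWithin] at this

theorem IsMetricGeodesic.norm_mfderivWithin [RegularSpace M] {d : ℝ} {f : ℝ → M}
    (h : IsMetricGeodesic E d f) {t : ℝ} (ht : t ∈ Icc (0 : ℝ) 1)
    (hd : MDifferentiableWithinAt 𝓘(ℝ, ℝ) 𝓘(ℝ, E) f (Icc 0 1) t) :
    ‖mfderivWithin 𝓘(ℝ, ℝ) 𝓘(ℝ, E) f (Icc 0 1) t (1 : ℝ)‖ = d := by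
  obtain ⟨hc, hd⟩ := hasMFDerivWithinAt_curve_iff.1 hd.hasMFDerivWithinAt
  have hd' : HasDerivWithinAt (F := E) (extChartAt 𝓘(ℝ, E) (f t) ∘ f)
      (mfderivWithin 𝓘(ℝ, ℝ) 𝓘(ℝ, E) f (Icc 0 1) t (1 : ℝ)) (Icc 0 1) t :=
    HasFDerivWithinAt.hasDerivWithinAt (F := E) hd
  exact h.norm_deriv subset_rfl ht (neBot_nhdsWithin_Icc_sdiff ht) hc hd'

theorem IsMinGeodesic.exists_path [RegularSpace M] {x y : M} {f : ℝ → M}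
    (h : IsMinGeodesic E x y f) : ∃ γ : Path x y,
      DescendingMetric.IsMinimalGeodesic (E := E) γ ∧ EqOn γ.extend f (Icc 0 1) := by
  obtain ⟨d, hd⟩ := h.exists_isMetricGeodesic
  let γ : Path x y :=
    { toFun := fun t ↦ f t
      continuous_toFun := h.contMDiffOn.continuousOn.comp_continuous continuous_subtype_val
        fun t ↦ t.2
      source' := by simpa using h.map_zero
      target' := by simpa using h.map_one }
  have hγ : EqOn γ.extend f (Icc 0 1) := fun t ht ↦ by
    rw [Path.extend_apply _ ht]; rfl
  have hs : ContMDiffOn 𝓘(ℝ, ℝ) 𝓘(ℝ, E) 1 γ.extend (Icc 0 1) := h.contMDiffOn.congr hγ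
  have hv : ∀ t ∈ Icc (0 : ℝ) 1, ‖DescendingMetric.velocity (E := E) γ t‖ = d := fun t ht ↦
    (hd.congr hγ.symm).norm_mfderivWithin ht (hs.mdifferentiableOn one_ne_zero t ht)
  refine ⟨γ, ⟨hs, ⟨d, hv⟩, ?_⟩, hγ⟩
  rw [pathELength_eq_lintegral_mfderivWithin_Icc, DescendingMetric.dist]
  have h1 := hd.edist_zero_one
  rw [h.map_zero, h.map_one] at h1
  rw [h1]
  have : ENNReal.ofReal d = ∫⁻ _ in Icc (0 : ℝ) 1, ENNReal.ofReal d := by simp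
  rw [this]
  refine setLIntegral_congr_fun measurableSet_Icc fun t ht ↦ ?_
  rw [← hv t ht, ofReal_norm]
  rfl

/-- Unique existence of minimal geodesics, in terms of functions on the real line. -/
theorem hasUniqueMinimalGeodesic_iff [RegularSpace M] {x y : M} :
    DescendingMetric.HasUniqueMinimalGeodesic E x y ↔
      (∃ f, IsMinGeodesic E x y f) ∧
        ∀ f g, IsMinGeodesic E x y f → IsMinGeodesic E x y g → EqOn f g (Icc 0 1) := by
  constructor
  · rintro ⟨γ, hγ, huniq⟩
    refine ⟨⟨_, isMinGeodesic_of_isMinimalGeodesic hγ⟩, fun f g hf hg ↦ ?_⟩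
    obtain ⟨γ₁, h₁, e₁⟩ := hf.exists_path
    obtain ⟨γ₂, h₂, e₂⟩ := hg.exists_path
    rw [huniq γ₁ h₁] at e₁
    rw [huniq γ₂ h₂] at e₂
    exact e₁.symm.trans e₂
  · rintro ⟨⟨f, hf⟩, huniq⟩
    obtain ⟨γ, hγ, -⟩ := hf.exists_path
    refine ⟨γ, hγ, fun γ' hγ' ↦ ?_⟩
    have := huniq _ _ (isMinGeodesic_of_isMinimalGeodesic hγ')
      (isMinGeodesic_of_isMinimalGeodesic hγ)
    ext t
    simpa using this t.2

/-- Two points at distance `d` are joined by curves which are `d`-Lipschitz up to an arbitrarily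
small additive error. On a curve of length `< d + ε`, the point for time `t` is chosen at distance
`t * d` from the start, by the intermediate value theorem. -/
theorem exists_almost_geodesic [RegularSpace M] {x y : M} {d ε : ℝ} (d0 : 0 ≤ d) (hε : 0 < ε)
    (hd : riemannianEDist 𝓘(ℝ, E) x y = ENNReal.ofReal d) :
    ∃ σ : ℝ → M, σ 0 = x ∧ σ 1 = y ∧ ∀ s ∈ Icc (0 : ℝ) 1, ∀ t ∈ Icc (0 : ℝ) 1, s ≤ t →
      riemannianEDist 𝓘(ℝ, E) (σ s) (σ t) ≤ ENNReal.ofReal (d * (t - s) + ε) := by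
  have hlt : riemannianEDist 𝓘(ℝ, E) x y < ENNReal.ofReal (d + ε) := by
    rw [hd]; exact (ENNReal.ofReal_lt_ofReal_iff (by linarith)).2 (by linarith)
  obtain ⟨γ, γ0, γ1, γs, hγ⟩ := exists_lt_of_riemannianEDist_lt hlt
  have hcont : ContinuousOn (fun τ ↦ riemannianEDist 𝓘(ℝ, E) x (γ τ)) (Icc 0 1) :=
    continuous_riemannianEDist.comp_continuousOn (continuousOn_const.prodMk γs.continuousOn)
  have hivt : ∀ t : ℝ, ∃ τ ∈ Icc (0 : ℝ) 1, t ∈ Icc (0 : ℝ) 1 →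
      riemannianEDist 𝓘(ℝ, E) x (γ τ) = ENNReal.ofReal (d * t) ∧ (t = 0 → τ = 0) ∧
        (t = 1 → τ = 1) := by
    intro t
    by_cases ht : t ∈ Icc (0 : ℝ) 1
    · rcases eq_or_ne t 0 with rfl | h0
      · exact ⟨0, by simp, fun _ ↦ ⟨by simp [γ0, riemannianEDist_self], by simp, by simp⟩⟩
      rcases eq_or_ne t 1 with rfl | h1
      · exact ⟨1, by simp, fun _ ↦ ⟨by simp [γ1, hd], by simp, by simp⟩⟩
      obtain ⟨τ, hτ, he⟩ := intermediate_value_Icc zero_le_one hcont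
        (show ENNReal.ofReal (d * t) ∈ _ from ⟨by simp [γ0, riemannianEDist_self], by
          simp only [γ1, hd]
          exact ENNReal.ofReal_le_ofReal (mul_le_of_le_one_right d0 ht.2)⟩)
      exact ⟨τ, hτ, fun _ ↦ ⟨he, fun h ↦ absurd h h0, fun h ↦ absurd h h1⟩⟩
    · exact ⟨0, by simp, fun h ↦ absurd h ht⟩
  choose τ hτ hτd using hivt
  refine ⟨γ ∘ τ, ?_, ?_, fun s hs t ht hst ↦ ?_⟩
  · rw [Function.comp_apply, (hτd 0 (by simp)).2.1 rfl, γ0]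
  · rw [Function.comp_apply, (hτd 1 (by simp)).2.2 rfl, γ1]
  have hL : ∀ a b : ℝ, 0 ≤ a → b ≤ 1 → pathELength 𝓘(ℝ, E) γ a b ≠ ⊤ := fun a b ha hb ↦
    ne_top_of_le_ne_top (hγ.trans ENNReal.ofReal_lt_top).ne (pathELength_mono ha hb)
  have hLd : ∀ a ∈ Icc (0 : ℝ) 1, ∀ b ∈ Icc (0 : ℝ) 1, a ≤ b →
      riemannianEDist 𝓘(ℝ, E) (γ a) (γ b) ≤ pathELength 𝓘(ℝ, E) γ a b := fun a ha b hb hab ↦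
    riemannianEDist_le_pathELength (γs.mono (Icc_subset_Icc ha.1 hb.2)) rfl rfl hab
  -- Lengths of the initial and final portions of the curve are bounded below.
  have hini : ∀ t ∈ Icc (0 : ℝ) 1, d * t ≤ (pathELength 𝓘(ℝ, E) γ 0 (τ t)).toReal := by
    intro t ht
    rw [← ENNReal.ofReal_le_iff_le_toReal (hL _ _ le_rfl (hτ t).2), ← (hτd t ht).1, ← γ0]
    exact hLd 0 (by simp) _ (hτ t) (hτ t).1
  have hfin : ∀ t ∈ Icc (0 : ℝ) 1, d * (1 - t) ≤ (pathELength 𝓘(ℝ, E) γ (τ t) 1).toReal := by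
    intro t ht
    have h1 : ENNReal.ofReal d ≤ ENNReal.ofReal (d * t) +
        ENNReal.ofReal (pathELength 𝓘(ℝ, E) γ (τ t) 1).toReal := by
      rw [ENNReal.ofReal_toReal (hL _ _ (hτ t).1 le_rfl), ← hd, ← (hτd t ht).1]
      refine riemannianEDist_triangle.trans (add_le_add le_rfl ?_)
      have := hLd _ (hτ t) 1 (by simp) (hτ t).2
      rwa [γ1] at this
    rw [← ENNReal.ofReal_add (mul_nonneg d0 ht.1) ENNReal.toReal_nonneg,
      ENNReal.ofReal_le_ofReal_iff (add_nonneg (mul_nonneg d0 ht.1) ENNReal.toReal_nonneg)] at h1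
    linarith
  have hsum : ∀ a b : ℝ, 0 ≤ a → a ≤ b → b ≤ 1 → (pathELength 𝓘(ℝ, E) γ 0 a).toReal +
      (pathELength 𝓘(ℝ, E) γ a b).toReal + (pathELength 𝓘(ℝ, E) γ b 1).toReal < d + ε := by
    intro a b ha hab hb
    rw [← ENNReal.toReal_add (hL _ _ le_rfl (hab.trans hb)) (hL _ _ ha hb), pathELength_add ha hab,
      ← ENNReal.toReal_add (hL _ _ le_rfl hb) (hL _ _ (ha.trans hab) le_rfl),
      pathELength_add (ha.trans hab) hb]
    exact (ENNReal.lt_ofReal_iff_toReal_lt (hL _ _ le_rfl le_rfl)).1 hγ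
  have hle : ∀ a b c : ℝ, 0 ≤ a → a ≤ b → b ≤ 1 → (pathELength 𝓘(ℝ, E) γ a b).toReal ≤ c →
      riemannianEDist 𝓘(ℝ, E) (γ a) (γ b) ≤ ENNReal.ofReal c := fun a b c ha hab hb hc ↦
    (hLd a ⟨ha, hab.trans hb⟩ b ⟨ha.trans hab, hb⟩ hab).trans
      ((ENNReal.ofReal_toReal (hL _ _ ha hb)).symm.le.trans (ENNReal.ofReal_le_ofReal hc))
  have hdts : 0 ≤ d * (t - s) := mul_nonneg d0 (sub_nonneg.2 hst)
  rcases le_total (τ s) (τ t) with hc | hc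
  · apply hle _ _ _ (hτ s).1 hc (hτ t).2
    linarith [hsum _ _ (hτ s).1 hc (hτ t).2, hini s hs, hfin t ht]
  · rw [riemannianEDist_comm]
    apply hle _ _ _ (hτ t).1 hc (hτ s).2
    linarith [hsum _ _ (hτ t).1 hc (hτ s).2, hini t ht, hfin s hs]

end Geodesics

/-! ### Uniqueness of metric geodesics -/

section Gluing

variable {E : Type*} [NormedAddCommGroup E] [NormedSpace ℝ E]
  {M : Type*} [TopologicalSpace M] [ChartedSpace E M]
  [RiemannianBundle (fun x : M ↦ TangentSpace 𝓘(ℝ, E) x)] [IsManifold 𝓘(ℝ, E) 1 M]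
  [IsContinuousRiemannianBundle E (fun x : M ↦ TangentSpace 𝓘(ℝ, E) x)]

/-- If all pairs of points are joined by minimal geodesics, then a minimal geodesic which is unique
for its endpoints is also the only metric geodesic between them, without any assumption of
differentiability. Indeed, two minimal geodesics which meet at a point of a metric geodesic
concatenate to a minimal geodesic, because corners are impossible. -/
theorem IsMetricGeodesic.eqOn_of_unique [RegularSpace M]
    (hex : ∀ x y : M, ∃ f, IsMinGeodesic E x y f) {x y : M} {η θ : ℝ → M} {d : ℝ}
    (huniq : ∀ f, IsMinGeodesic E x y f → EqOn f η (Icc 0 1))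
    (hθ : IsMetricGeodesic E d θ) (h0 : θ 0 = x) (h1 : θ 1 = y) : EqOn θ η (Icc 0 1) := by
  obtain ⟨g, hg⟩ := hex x y
  intro t₀ ht₀
  rcases ht₀.1.eq_or_lt with rfl | hpos
  · rw [h0, ← huniq g hg ht₀, hg.map_zero]
  rcases ht₀.2.eq_or_lt with rfl | hlt
  · rw [h1, ← huniq g hg ht₀, hg.map_one]
  obtain ⟨α, hα⟩ := hex x (θ t₀)
  obtain ⟨β, hβ⟩ := hex (θ t₀) y
  have hlt' : 0 < 1 - t₀ := sub_pos.2 hlt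
  have dα := hα.isMetricGeodesic
  have dβ := hβ.isMetricGeodesic
  have eα : riemannianEDist 𝓘(ℝ, E) x (θ t₀) = ENNReal.ofReal (d * t₀) := by
    rw [← h0, hθ.2 0 (by simp) t₀ ht₀, sub_zero, abs_of_pos hpos]
  have eβ : riemannianEDist 𝓘(ℝ, E) (θ t₀) y = ENNReal.ofReal (d * (1 - t₀)) := by
    rw [← h1, hθ.2 t₀ ht₀ 1 (by simp), abs_of_pos hlt']
  rw [eα, ENNReal.toReal_ofReal (mul_nonneg hθ.1 hpos.le)] at dα
  rw [eβ, ENNReal.toReal_ofReal (mul_nonneg hθ.1 hlt'.le)] at dβ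
  let f : ℝ → M := fun t ↦ if t ≤ t₀ then α (t / t₀) else β ((t - t₀) / (1 - t₀))
  have fl : EqOn f (fun t ↦ α (t / t₀)) (Icc 0 t₀) := fun t ht ↦ if_pos ht.2
  have fr : EqOn f (fun t ↦ β ((t - t₀) / (1 - t₀))) (Icc t₀ 1) := fun t ht ↦ by
    rcases ht.1.eq_or_lt with rfl | h'
    · simp [f, div_self hpos.ne', hα.map_one, hβ.map_zero]
    · exact if_neg (not_le.2 h')
  have ml : ∀ t ∈ Icc 0 t₀, t / t₀ ∈ Icc (0 : ℝ) 1 := fun t ht ↦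
    ⟨div_nonneg ht.1 hpos.le, (div_le_one hpos).2 ht.2⟩
  have mr : ∀ t ∈ Icc t₀ 1, (t - t₀) / (1 - t₀) ∈ Icc (0 : ℝ) 1 := fun t ht ↦
    ⟨div_nonneg (sub_nonneg.2 ht.1) hlt'.le, (div_le_one hlt').2 (by linarith [ht.2])⟩
  have distl : ∀ s ∈ Icc 0 t₀, ∀ t ∈ Icc 0 t₀, s ≤ t →
      riemannianEDist 𝓘(ℝ, E) (f s) (f t) ≤ ENNReal.ofReal (d * (t - s)) := by
    intro s hs t ht hst
    rw [fl hs, fl ht, dα.2 _ (ml s hs) _ (ml t ht),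
      abs_of_nonneg (sub_nonneg.2 (div_le_div_of_nonneg_right hst hpos.le))]
    exact ENNReal.ofReal_le_ofReal (le_of_eq (by field_simp))
  have distr : ∀ s ∈ Icc t₀ 1, ∀ t ∈ Icc t₀ 1, s ≤ t →
      riemannianEDist 𝓘(ℝ, E) (f s) (f t) ≤ ENNReal.ofReal (d * (t - s)) := by
    intro s hs t ht hst
    rw [fr hs, fr ht, dβ.2 _ (mr s hs) _ (mr t ht),
      abs_of_nonneg (sub_nonneg.2 (div_le_div_of_nonneg_right (by linarith) hlt'.le))]
    exact ENNReal.ofReal_le_ofReal (le_of_eq (by field_simp; ring))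
  have f0 : f 0 = x := by rw [fl ⟨le_rfl, hpos.le⟩]; simp [hα.map_zero]
  have f1 : f 1 = y := by rw [fr ⟨hlt.le, le_rfl⟩]; simp [div_self hlt'.ne', hβ.map_one]
  have hf : IsMetricGeodesic E d f := by
    refine isMetricGeodesic_of_le hθ.1 (fun s hs t ht hst ↦ ?_) ?_
    · rcases le_total t t₀ with h | h
      · exact distl s ⟨hs.1, hst.trans h⟩ t ⟨ht.1, h⟩ hst
      rcases le_total t₀ s with h' | h'
      · exact distr s ⟨h', hs.2⟩ t ⟨h, ht.2⟩ hst
      have a := distl s ⟨hs.1, h'⟩ t₀ ⟨hpos.le, le_rfl⟩ h'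
      have b := distr t₀ ⟨le_rfl, hlt.le⟩ t ⟨h, ht.2⟩ h
      refine riemannianEDist_triangle.trans ((add_le_add a b).trans ?_)
      rw [← ENNReal.ofReal_add (mul_nonneg hθ.1 (by linarith)) (mul_nonneg hθ.1 (by linarith))]
      exact ENNReal.ofReal_le_ofReal (le_of_eq (by ring))
    · rw [f0, f1, ← h0, ← h1, hθ.edist_zero_one]
  have sl : ContMDiffOn 𝓘(ℝ, ℝ) 𝓘(ℝ, E) 1 f (Icc 0 t₀) := by
    refine ContMDiffOn.congr ?_ fl
    exact hα.contMDiffOn.comp (g := α) (f := fun t ↦ t / t₀)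
      (contDiff_id.div_const t₀).contMDiff.contMDiffOn ml
  have sr : ContMDiffOn 𝓘(ℝ, ℝ) 𝓘(ℝ, E) 1 f (Icc t₀ 1) := by
    refine ContMDiffOn.congr ?_ fr
    exact hβ.contMDiffOn.comp (g := β) (f := fun t ↦ (t - t₀) / (1 - t₀))
      ((contDiff_id.sub contDiff_const).div_const _).contMDiff.contMDiffOn mr
  have hs : ContMDiffOn 𝓘(ℝ, ℝ) 𝓘(ℝ, E) 1 f (Icc 0 1) := by
    intro t ht
    rcases lt_trichotomy t t₀ with h | rfl | h
    · refine (sl t ⟨ht.1, h.le⟩).mono_of_mem_nhdsWithin ?_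
      rw [mem_nhdsWithin]
      exact ⟨Iio t₀, isOpen_Iio, h, fun τ hτ ↦ ⟨hτ.2.1, le_of_lt hτ.1⟩⟩
    · exact hf.contMDiffWithinAt_corner ⟨hpos, hlt⟩ (sl t ⟨ht.1, le_rfl⟩) (sr t ⟨le_rfl, ht.2⟩)
    · refine (sr t ⟨h.le, ht.2⟩).mono_of_mem_nhdsWithin ?_
      rw [mem_nhdsWithin]
      exact ⟨Ioi t₀, isOpen_Ioi, h, fun τ hτ ↦ ⟨le_of_lt hτ.1, hτ.2.2⟩⟩
  rw [← huniq f ⟨f0, f1, hs, d, hf⟩ ht₀, fl ⟨hpos.le, le_rfl⟩]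
  simp [div_self hpos.ne', hα.map_one]

end Gluing

/-! ### Maps which do not increase distances -/

section Lipschitz

variable {E : Type*} [NormedAddCommGroup E] [NormedSpace ℝ E]
  {M : Type*} [TopologicalSpace M] [ChartedSpace E M]
  [RiemannianBundle (fun x : M ↦ TangentSpace 𝓘(ℝ, E) x)]
  {F : Type*} [NormedAddCommGroup F] [NormedSpace ℝ F]
  {N : Type*} [TopologicalSpace N] [ChartedSpace F N]
  [RiemannianBundle (fun x : N ↦ TangentSpace 𝓘(ℝ, F) x)]

theorem riemannianEDist_map_le {f : M → N} (hf : ContMDiff 𝓘(ℝ, E) 𝓘(ℝ, F) 1 f)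
    (hd : ∀ (x : M) (v : TangentSpace 𝓘(ℝ, E) x), ‖mfderiv 𝓘(ℝ, E) 𝓘(ℝ, F) f x v‖ ≤ ‖v‖) (x y : M) :
    riemannianEDist 𝓘(ℝ, F) (f x) (f y) ≤ riemannianEDist 𝓘(ℝ, E) x y := by
  refine le_of_forall_gt fun a ha ↦ ?_
  obtain ⟨γ, γ0, γ1, γs, hγ⟩ := exists_lt_of_riemannianEDist_lt ha
  refine lt_of_le_of_lt ?_ hγ
  refine (riemannianEDist_le_pathELength (γ := f ∘ γ) (hf.comp_contMDiffOn γs)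
    (by simp [γ0]) (by simp [γ1]) zero_le_one).trans ?_
  rw [pathELength_eq_lintegral_mfderiv_Ioo, pathELength_eq_lintegral_mfderiv_Ioo]
  refine setLIntegral_mono' measurableSet_Ioo fun t ht ↦ ?_
  have hγd : MDifferentiableAt 𝓘(ℝ, ℝ) 𝓘(ℝ, E) γ t :=
    (γs.contMDiffAt (Icc_mem_nhds ht.1 ht.2)).mdifferentiableAt one_ne_zero
  rw [mfderiv_comp t (hf.mdifferentiableAt one_ne_zero) hγd, ← ofReal_norm, ← ofReal_norm]
  exact ENNReal.ofReal_le_ofReal (hd _ _)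

end Lipschitz

/-! ### Horizontal and vertical vectors -/

section LinearAlgebra

variable {V W : Type*} [NormedAddCommGroup V] [InnerProductSpace ℝ V]
  [NormedAddCommGroup W] [InnerProductSpace ℝ W] {P : V →L[ℝ] W}

theorem norm_eq_of_horizontal (hP : ∀ u v : V, (∀ w, P w = 0 → inner ℝ u w = 0) →
    (∀ w, P w = 0 → inner ℝ v w = 0) → inner ℝ u v = inner ℝ (P u) (P v))
    {u : V} (hu : ∀ w, P w = 0 → inner ℝ u w = 0) : ‖P u‖ = ‖u‖ := by
  have := hP u u hu hu
  rw [real_inner_self_eq_norm_sq, real_inner_self_eq_norm_sq] at this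
  exact ((sq_eq_sq₀ (norm_nonneg _) (norm_nonneg _)).1 this).symm

variable [FiniteDimensional ℝ V]

theorem exists_horizontal_add_vertical (P : V →L[ℝ] W) (v : V) :
    ∃ h w : V, v = h + w ∧ P w = 0 ∧ ∀ z, P z = 0 → inner ℝ h z = 0 := by
  let K : Submodule ℝ V := LinearMap.ker (P : V →ₗ[ℝ] W)
  refine ⟨Kᗮ.starProjection v, K.starProjection v, ?_, ?_, ?_⟩
  · rw [add_comm, K.starProjection_add_starProjection_orthogonal]
  · exact (LinearMap.mem_ker.1 (K.starProjection_apply_mem v) : _)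
  · intro z hz
    exact Submodule.inner_left_of_mem_orthogonal (K := K) (LinearMap.mem_ker.2 hz)
      (Kᗮ.starProjection_apply_mem v)

/-- A linear map which is isometric on the orthogonal complement of its kernel does not increase
norms. -/
theorem norm_map_le_of_horizontal (hP : ∀ u v : V, (∀ w, P w = 0 → inner ℝ u w = 0) →
    (∀ w, P w = 0 → inner ℝ v w = 0) → inner ℝ u v = inner ℝ (P u) (P v)) (v : V) :
    ‖P v‖ ≤ ‖v‖ := by
  obtain ⟨h, w, rfl, hw, hh⟩ := exists_horizontal_add_vertical P v
  rw [map_add, hw, add_zero, norm_eq_of_horizontal hP hh]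
  have := norm_add_sq_real h w
  rw [hh w hw] at this
  exact (sq_le_sq₀ (norm_nonneg _) (norm_nonneg _)).1 (by nlinarith [sq_nonneg ‖w‖])

/-- A vector whose norm is preserved is orthogonal to the kernel. -/
theorem inner_eq_zero_of_norm_eq (hP : ∀ u v : V, (∀ w, P w = 0 → inner ℝ u w = 0) →
    (∀ w, P w = 0 → inner ℝ v w = 0) → inner ℝ u v = inner ℝ (P u) (P v)) {v : V}
    (hv : ‖P v‖ = ‖v‖) : ∀ z, P z = 0 → inner ℝ v z = 0 := by
  obtain ⟨h, w, rfl, hw, hh⟩ := exists_horizontal_add_vertical P v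
  rw [map_add, hw, add_zero, norm_eq_of_horizontal hP hh] at hv
  have := norm_add_sq_real h w
  rw [hh w hw, ← hv] at this
  have hw0 : w = 0 := by
    rw [← norm_eq_zero, ← sq_eq_zero_iff]; linarith
  simpa [hw0] using hh

/-- The horizontal lift: an isometric linear right inverse. -/
theorem exists_isometric_rightInverse (hP : ∀ u v : V, (∀ w, P w = 0 → inner ℝ u w = 0) →
    (∀ w, P w = 0 → inner ℝ v w = 0) → inner ℝ u v = inner ℝ (P u) (P v))
    (hs : Function.Surjective P) :
    ∃ S : W →ₗ[ℝ] V, (∀ w, P (S w) = w) ∧ ∀ w, ‖S w‖ = ‖w‖ := by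
  obtain ⟨Q, hQ⟩ := (P : V →ₗ[ℝ] W).exists_rightInverse_of_surjective (LinearMap.range_eq_top.2 hs)
  let K : Submodule ℝ V := LinearMap.ker (P : V →ₗ[ℝ] W)
  have h1 : ∀ w, P ((Kᗮ.starProjection : V →ₗ[ℝ] V) (Q w)) = w := fun w ↦ by
    have e : P (Q w) = w := LinearMap.congr_fun hQ w
    have e2 : P (K.starProjection (Q w)) = 0 := LinearMap.mem_ker.1 (K.starProjection_apply_mem _)
    have e3 := K.starProjection_add_starProjection_orthogonal (Q w)
    rw [← e3, map_add, e2, zero_add] at e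
    exact e
  refine ⟨(Kᗮ.starProjection : V →ₗ[ℝ] V) ∘ₗ Q, h1, fun w ↦ ?_⟩
  have h2 := norm_eq_of_horizontal hP (u := Kᗮ.starProjection (Q w)) fun z hz ↦
    Submodule.inner_left_of_mem_orthogonal (K := K) (LinearMap.mem_ker.2 hz)
      (Kᗮ.starProjection_apply_mem _)
  rw [LinearMap.comp_apply]
  exact h2.symm.trans (congrArg norm (h1 w))

end LinearAlgebra

/-! ### Local sections of Riemannian submersions -/

section Submersion

variable {E : Type*} [NormedAddCommGroup E] [NormedSpace ℝ E]
  {M : Type*} [TopologicalSpace M] [ChartedSpace E M]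
  [RiemannianBundle (fun x : M ↦ TangentSpace 𝓘(ℝ, E) x)]
  {F : Type*} [NormedAddCommGroup F] [NormedSpace ℝ F]
  {N : Type*} [TopologicalSpace N] [ChartedSpace F N]
  [RiemannianBundle (fun x : N ↦ TangentSpace 𝓘(ℝ, F) x)]

theorem norm_toFiber_congr {x x' : M} (h : x' = x) (w : E) :
    ‖toFiber E x' w‖ = ‖toFiber E x w‖ := by
  subst h; rfl

/-- A map which is differentiable at `y₀` with a norm nonincreasing derivative increases distances
from `y₀` by a factor arbitrarily close to `1`. -/
theorem eventually_riemannianEDist_map_le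
    [IsManifold 𝓘(ℝ, E) 1 M] [IsContinuousRiemannianBundle E (fun x : M ↦ TangentSpace 𝓘(ℝ, E) x)]
    [IsManifold 𝓘(ℝ, F) 1 N] [IsContinuousRiemannianBundle F (fun x : N ↦ TangentSpace 𝓘(ℝ, F) x)]
    [RegularSpace N] {f : N → M} {y₀ : N} (hf : MDifferentiableAt 𝓘(ℝ, F) 𝓘(ℝ, E) f y₀)
    (hd : ∀ v : TangentSpace 𝓘(ℝ, F) y₀, ‖mfderiv 𝓘(ℝ, F) 𝓘(ℝ, E) f y₀ v‖ ≤ ‖v‖) {r : ℝ}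
    (hr : 1 < r) :
    ∀ᶠ y in 𝓝 y₀, riemannianEDist 𝓘(ℝ, E) (f y₀) (f y) ≤
      ENNReal.ofReal r * riemannianEDist 𝓘(ℝ, F) y₀ y := by
  set φ := extChartAt 𝓘(ℝ, E) (f y₀) with hφ
  set ψ := extChartAt 𝓘(ℝ, F) y₀ with hψ
  let D : F →L[ℝ] E := mfderiv 𝓘(ℝ, F) 𝓘(ℝ, E) f y₀
  have hD : ∀ w, ‖toFiber E (f y₀) (D w)‖ ≤ ‖toFiber F y₀ w‖ := hd
  have hg : HasFDerivAt (φ ∘ f ∘ ψ.symm) D (ψ y₀) := by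
    have : HasFDerivWithinAt (E := F) (F := E) (φ ∘ f ∘ ψ.symm) D (range 𝓘(ℝ, F)) (ψ y₀) :=
      hf.hasMFDerivAt.2
    rwa [show range 𝓘(ℝ, F) = (univ : Set F) by simp, hasFDerivWithinAt_univ] at this
  have hg0 : (φ ∘ f ∘ ψ.symm) (ψ y₀) = φ (f y₀) := by simp [ψ]
  obtain ⟨r', hr'1, hr'⟩ : ∃ r' : ℝ, 1 < r' ∧ r' ^ 3 < r := by
    have : ∀ᶠ s : ℝ in 𝓝[>] 1, s ^ 3 < r := by
      have h1 : Tendsto (fun s : ℝ ↦ s ^ 3) (𝓝 1) (𝓝 (1 ^ 3)) := (continuous_pow 3).tendsto 1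
      rw [one_pow] at h1
      exact (h1.mono_left nhdsWithin_le_nhds).eventually_lt_const hr
    obtain ⟨s, hs, hs'⟩ := (this.and self_mem_nhdsWithin).exists
    exact ⟨s, hs', hs⟩
  have hkn : ∀ᶠ w in 𝓝 (ψ y₀), ‖toFiber E (f y₀) ((φ ∘ f ∘ ψ.symm) w - φ (f y₀))‖ ≤
      r' * ‖toFiber F y₀ (w - ψ y₀)‖ := by
    have h1 : HasFDerivAt (toFiber E (f y₀) ∘ φ ∘ f ∘ ψ.symm)
        ((toFiber E (f y₀) : E →L[ℝ] _) ∘L D) (ψ y₀) :=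
      (toFiber E (f y₀)).hasFDerivAt.comp (ψ y₀) hg
    let C : ℝ := ‖((toFiber F y₀).symm : TangentSpace 𝓘(ℝ, F) y₀ →L[ℝ] F)‖
    have C0 : 0 ≤ C := ContinuousLinearMap.opNorm_nonneg _
    have c0 : 0 < (r' - 1) / (C + 1) := div_pos (by linarith) (by linarith)
    filter_upwards [h1.isLittleO.def c0] with w hw
    have hC : ‖w - ψ y₀‖ ≤ C * ‖toFiber F y₀ (w - ψ y₀)‖ :=
      ((toFiber F y₀).symm : TangentSpace 𝓘(ℝ, F) y₀ →L[ℝ] F).le_opNorm (toFiber F y₀ (w - ψ y₀))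
    have hC' : (r' - 1) / (C + 1) * ‖w - ψ y₀‖ ≤ (r' - 1) * ‖toFiber F y₀ (w - ψ y₀)‖ := by
      rw [div_mul_eq_mul_div, div_le_iff₀ (by linarith), mul_assoc]
      refine mul_le_mul_of_nonneg_left (hC.trans ?_) (by linarith)
      nlinarith [norm_nonneg (toFiber F y₀ (w - ψ y₀))]
    have e : toFiber E (f y₀) ((φ ∘ f ∘ ψ.symm) w - φ (f y₀)) =
        (toFiber E (f y₀) ((φ ∘ f ∘ ψ.symm) w) - toFiber E (f y₀) ((φ ∘ f ∘ ψ.symm) (ψ y₀)) -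
          toFiber E (f y₀) (D (w - ψ y₀))) + toFiber E (f y₀) (D (w - ψ y₀)) := by
      rw [hg0, map_sub, sub_add_cancel]
    rw [e]
    exact (norm_add_le _ _).trans ((add_le_add (hw.trans hC') (hD _)).trans_eq (by ring))
  have pair : Tendsto (fun y : N ↦ (f y₀, f y)) (𝓝 y₀) (𝓝 (f y₀, f y₀)) :=
    tendsto_const_nhds.prodMk_nhds hf.continuousAt
  have pairN : Tendsto (fun y : N ↦ (y₀, y)) (𝓝 y₀) (𝓝 (y₀, y₀)) :=
    tendsto_const_nhds.prodMk_nhds tendsto_id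
  have cψ : Tendsto ψ (𝓝 y₀) (𝓝 (ψ y₀)) := continuousAt_extChartAt y₀
  filter_upwards [pair.eventually (eventually_riemannianEDist_le (E := E) (f y₀) hr'1),
    pairN.eventually (eventually_norm_toFiber_le (E := F) y₀ hr'1),
    cψ.eventually hkn, extChartAt_source_mem_nhds (I := 𝓘(ℝ, F)) y₀] with y h1 h2 h3 h4
  simp only [Function.comp_apply] at h3
  rw [ψ.left_inv h4] at h3
  refine h1.trans ?_
  calc ENNReal.ofReal (r' * ‖toFiber E (f y₀) (φ (f y) - φ (f y₀))‖)
      ≤ ENNReal.ofReal (r' * (r' * ‖toFiber F y₀ (ψ y - ψ y₀)‖)) := by gcongr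
    _ = ENNReal.ofReal (r' ^ 2) * ENNReal.ofReal ‖toFiber F y₀ (ψ y - ψ y₀)‖ := by
        rw [← ENNReal.ofReal_mul (by positivity), pow_two, mul_assoc]
    _ ≤ ENNReal.ofReal (r' ^ 2) * (ENNReal.ofReal r' * riemannianEDist 𝓘(ℝ, F) y₀ y) := by
        gcongr
    _ = ENNReal.ofReal (r' ^ 3) * riemannianEDist 𝓘(ℝ, F) y₀ y := by
        rw [← mul_assoc, ← ENNReal.ofReal_mul (by positivity), ← pow_succ]
    _ ≤ _ := by gcongr

variable {p : M → N}

theorem norm_mfderiv_le_of_descendsTo [FiniteDimensional ℝ E]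
    (h : DescendingMetric.DescendsTo E F p) (x : M)
    (v : TangentSpace 𝓘(ℝ, E) x) : ‖mfderiv 𝓘(ℝ, E) 𝓘(ℝ, F) p x v‖ ≤ ‖v‖ :=
  have : FiniteDimensional ℝ (TangentSpace 𝓘(ℝ, E) x) := inferInstanceAs (FiniteDimensional ℝ E)
  norm_map_le_of_horizontal (fun u v hu hv ↦ h.inner_eq x u v hu hv) v

theorem exists_isometric_rightInverse_mfderiv [FiniteDimensional ℝ E]
    (h : DescendingMetric.DescendsTo E F p) (x : M) :
    ∃ S : TangentSpace 𝓘(ℝ, F) (p x) →ₗ[ℝ] TangentSpace 𝓘(ℝ, E) x,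
      (∀ v, mfderiv 𝓘(ℝ, E) 𝓘(ℝ, F) p x (S v) = v) ∧ ∀ v, ‖S v‖ = ‖v‖ :=
  have : FiniteDimensional ℝ (TangentSpace 𝓘(ℝ, E) x) := inferInstanceAs (FiniteDimensional ℝ E)
  exists_isometric_rightInverse (fun u v hu hv ↦ h.inner_eq x u v hu hv) (h.submersion x)

/-- A Riemannian submersion has smooth local sections through every point, which are horizontal and
hence infinitesimally isometric at that point. In charts, the section is the inverse function
of the restriction of `p` to the affine subspace of horizontal directions at `x`. -/
theorem exists_local_section [FiniteDimensional ℝ E] [FiniteDimensional ℝ F]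
    [IsManifold 𝓘(ℝ, E) ∞ M] [IsManifold 𝓘(ℝ, F) ∞ N]
    (h : DescendingMetric.DescendsTo E F p) (x : M) :
    ∃ s : N → M, s (p x) = x ∧ ContMDiffAt 𝓘(ℝ, F) 𝓘(ℝ, E) ∞ s (p x) ∧
      (∀ᶠ y in 𝓝 (p x), p (s y) = y) ∧
      ∀ v : TangentSpace 𝓘(ℝ, F) (p x), ‖mfderiv 𝓘(ℝ, F) 𝓘(ℝ, E) s (p x) v‖ = ‖v‖ := by
  obtain ⟨S, hPS, hS⟩ := exists_isometric_rightInverse_mfderiv h x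
  let P : E →L[ℝ] F := mfderiv 𝓘(ℝ, E) 𝓘(ℝ, F) p x
  let S' : F →L[ℝ] E := LinearMap.toContinuousLinearMap (F' := E) (E := F) S
  have hPS' : ∀ w, P (S' w) = w := hPS
  have hS' : ∀ w, ‖toFiber E x (S' w)‖ = ‖toFiber F (p x) w‖ := hS
  set φ := extChartAt 𝓘(ℝ, E) x with hφ
  set ψ := extChartAt 𝓘(ℝ, F) (p x) with hψ
  -- `p` read in the charts
  have hp1 : ContDiffAt ℝ ∞ (ψ ∘ p ∘ φ.symm) (φ x) := by
    have := (contMDiffAt_iff.1 (h.smooth.contMDiffAt (x := x))).2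
    rwa [show range 𝓘(ℝ, E) = (univ : Set E) by simp, contDiffWithinAt_univ] at this
  have hp2 : HasFDerivAt (ψ ∘ p ∘ φ.symm) P (φ x) := by
    have : HasFDerivWithinAt (E := E) (F := F) (ψ ∘ p ∘ φ.symm) P (range 𝓘(ℝ, E)) (φ x) :=
      (h.smooth.mdifferentiableAt (x := x) (by simp)).hasMFDerivAt.2
    rwa [show range 𝓘(ℝ, E) = (univ : Set E) by simp, hasFDerivWithinAt_univ] at this
  let y₀ : F := ψ (p x)
  let a : F → E := fun w ↦ φ x + S' (w - y₀)
  have ha0 : a y₀ = φ x := by simp [a]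
  have had : HasFDerivAt a S' y₀ :=
    (S'.hasFDerivAt.comp y₀ ((hasFDerivAt_id y₀).sub_const y₀)).const_add (φ x)
  have has : ContDiff ℝ ∞ a :=
    contDiff_const.add (S'.contDiff.comp (contDiff_id.sub contDiff_const))
  have hh : HasFDerivAt ((ψ ∘ p ∘ φ.symm) ∘ a)
      ((ContinuousLinearEquiv.refl ℝ F : F ≃L[ℝ] F) : F →L[ℝ] F) y₀ := by
    rw [← ha0] at hp2
    have := hp2.comp y₀ had
    rwa [show P ∘L S' = ((ContinuousLinearEquiv.refl ℝ F : F ≃L[ℝ] F) : F →L[ℝ] F) from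
      ContinuousLinearMap.ext hPS'] at this
  have hs : ContDiffAt ℝ ∞ ((ψ ∘ p ∘ φ.symm) ∘ a) y₀ := by
    rw [← ha0] at hp1
    exact hp1.comp y₀ has.contDiffAt
  have hh0 : ((ψ ∘ p ∘ φ.symm) ∘ a) y₀ = y₀ := by simp [ha0, y₀, φ]
  have hstr := hs.hasStrictFDerivAt' hh (by simp)
  let k : F → F := hs.localInverse hh (by simp)
  have hk0 : k y₀ = y₀ := by
    have := hs.localInverse_apply_image hh (by simp)
    rwa [hh0] at this
  have hkd : HasFDerivAt k (ContinuousLinearMap.id ℝ F) y₀ := by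
    have := hstr.to_localInverse
    rw [hh0] at this
    exact this.hasFDerivAt
  have hks : ContDiffAt ℝ ∞ k y₀ := by
    have := hs.to_localInverse hh (by simp)
    rwa [hh0] at this
  have hkr : ∀ᶠ w in 𝓝 y₀, ((ψ ∘ p ∘ φ.symm) ∘ a) (k w) = w := by
    have := hstr.eventually_right_inverse
    rwa [hh0] at this
  have cψ : Tendsto ψ (𝓝 (p x)) (𝓝 y₀) := continuousAt_extChartAt (p x)
  have hak0 : a (k y₀) = φ x := by rw [hk0, ha0]
  have hsx : φ.symm (a (k (ψ (p x)))) = x := by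
    rw [show ψ (p x) = y₀ from rfl, hak0]; simp [φ]
  have hsm : ContMDiffAt 𝓘(ℝ, F) 𝓘(ℝ, E) ∞ (fun y ↦ φ.symm (a (k (ψ y)))) (p x) := by
    have h1 : ContMDiffAt 𝓘(ℝ, F) 𝓘(ℝ, F) ∞ ψ (p x) := contMDiffAt_extChartAt
    have h2 : ContMDiffAt 𝓘(ℝ, F) 𝓘(ℝ, E) ∞ (a ∘ k) (ψ (p x)) :=
      (has.contDiffAt.comp y₀ hks).contMDiffAt
    have h3 : ContMDiffAt 𝓘(ℝ, E) 𝓘(ℝ, E) ∞ φ.symm (a (k (ψ (p x)))) := by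
      rw [show a (k (ψ (p x))) = φ x from hak0]
      exact (contMDiffOn_extChartAt_symm x).contMDiffAt (extChartAt_target_mem_nhds x)
    exact h3.comp (p x) (h2.comp (p x) h1)
  have cz : Tendsto (fun y ↦ φ.symm (a (k (ψ y)))) (𝓝 (p x)) (𝓝 x) := by
    have := hsm.continuousAt
    rwa [ContinuousAt, hsx] at this
  have cpz : Tendsto (fun y ↦ p (φ.symm (a (k (ψ y))))) (𝓝 (p x)) (𝓝 (p x)) :=
    (h.smooth.continuous.tendsto x).comp cz
  refine ⟨fun y ↦ φ.symm (a (k (ψ y))), hsx, hsm, ?_, fun v ↦ ?_⟩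
  · filter_upwards [cψ.eventually hkr,
      cpz.eventually (extChartAt_source_mem_nhds (I := 𝓘(ℝ, F)) (p x)),
      extChartAt_source_mem_nhds (I := 𝓘(ℝ, F)) (p x)] with y h4 h6 h7
    exact ψ.injOn h6 h7 h4
  · have hder : HasMFDerivAt 𝓘(ℝ, F) 𝓘(ℝ, E) (fun y ↦ φ.symm (a (k (ψ y)))) (p x) S' := by
      refine ⟨hsm.continuousAt, ?_⟩
      simp only [writtenInExtChartAt]
      rw [hsx, show range 𝓘(ℝ, F) = (univ : Set F) by simp]
      refine HasFDerivAt.hasFDerivWithinAt (E := F) (F := E) ?_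
      have hak : HasFDerivAt (a ∘ k) S' y₀ := by
        have h1 : HasFDerivAt a S' (k y₀) := by rw [hk0]; exact had
        simpa using h1.comp y₀ hkd
      refine hak.congr_of_eventuallyEq ?_
      have h5 : ∀ᶠ w in 𝓝 y₀, a (k w) ∈ φ.target := by
        have : Tendsto (a ∘ k) (𝓝 y₀) (𝓝 (φ x)) := by
          have := hak.continuousAt
          rwa [ContinuousAt, Function.comp_apply, hak0] at this
        exact this.eventually (extChartAt_target_mem_nhds (I := 𝓘(ℝ, E)) x)
      filter_upwards [h5, extChartAt_target_mem_nhds (I := 𝓘(ℝ, F)) (p x)] with w hw hw'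
      simp only [Function.comp_apply]
      rw [ψ.right_inv hw', φ.right_inv hw]
    rw [hder.mfderiv]
    exact (norm_toFiber_congr hsx (S' v)).trans (hS' v)

/-- A Riemannian submersion has almost isometric local sections: each point near `p x` is the image
of a point which is only slightly farther from `x`. -/
theorem eventually_exists_lift [FiniteDimensional ℝ E] [FiniteDimensional ℝ F]
    [IsManifold 𝓘(ℝ, E) ∞ M] [IsContinuousRiemannianBundle E (fun x : M ↦ TangentSpace 𝓘(ℝ, E) x)]
    [IsManifold 𝓘(ℝ, F) ∞ N] [IsContinuousRiemannianBundle F (fun x : N ↦ TangentSpace 𝓘(ℝ, F) x)]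
    [RegularSpace N] (h : DescendingMetric.DescendsTo E F p) (x : M) {r : ℝ} (hr : 1 < r) :
    ∀ᶠ y in 𝓝 (p x), ∃ z, p z = y ∧
      riemannianEDist 𝓘(ℝ, E) x z ≤ ENNReal.ofReal r * riemannianEDist 𝓘(ℝ, F) (p x) y := by
  obtain ⟨s, hsx, hs, hps, hn⟩ := exists_local_section h x
  filter_upwards [hps, eventually_riemannianEDist_map_le (hs.mdifferentiableAt (by simp))
    (fun v ↦ (hn v).le) hr] with y h1 h2
  rw [hsx] at h2
  exact ⟨s y, h1, h2⟩

end Submersion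

/-! ### Distances to the fibres of the orbit map -/

section UniformContinuity

variable {E : Type*} [NormedAddCommGroup E] [NormedSpace ℝ E]
  {M : Type*} [TopologicalSpace M] [ChartedSpace E M]
  [RiemannianBundle (fun x : M ↦ TangentSpace 𝓘(ℝ, E) x)] [IsManifold 𝓘(ℝ, E) 1 M]
  [IsContinuousRiemannianBundle E (fun x : M ↦ TangentSpace 𝓘(ℝ, E) x)]

/-- A curve on `[0, 1]` can be cut into finitely many pieces whose endpoints are close. -/
theorem exists_uniform_mesh [RegularSpace M] {γ : ℝ → M} (hγ : ContinuousOn γ (Icc 0 1)) {c : ℝ≥0∞}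
    (hc : 0 < c) : ∃ n : ℕ, 0 < n ∧ ∀ i : ℕ, i < n →
      riemannianEDist 𝓘(ℝ, E) (γ (i / n)) (γ ((i + 1 : ℕ) / n)) < c := by
  let : PseudoEMetricSpace M := PseudoEMetricSpace.ofRiemannianMetric 𝓘(ℝ, E) M
  have hu : UniformContinuousOn γ (Icc 0 1) := isCompact_Icc.uniformContinuousOn_of_continuous hγ
  obtain ⟨δ, δ0, hδ⟩ := EMetric.uniformContinuousOn_iff.1 hu c hc
  obtain ⟨δ', hδ'0, hδ'⟩ := ENNReal.lt_iff_exists_real_btwn.1 δ0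
  have hδ'p : 0 < δ' := by simpa using hδ'.1
  obtain ⟨n, hn⟩ := exists_nat_one_div_lt hδ'p
  have hn0 : (0 : ℝ) < ((n + 1 : ℕ) : ℝ) := by positivity
  refine ⟨n + 1, n.succ_pos, fun i hi ↦ ?_⟩
  have h1 : ((i + 1 : ℕ) : ℝ) ≤ ((n + 1 : ℕ) : ℝ) := by exact_mod_cast hi
  have h2 : (i : ℝ) ≤ ((n + 1 : ℕ) : ℝ) := by exact_mod_cast hi.le
  refine hδ ⟨by positivity, (div_le_one hn0).2 h2⟩ ⟨by positivity, (div_le_one hn0).2 h1⟩ ?_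
  rw [edist_dist, Real.dist_eq, ← sub_div, abs_div, abs_of_pos hn0]
  refine lt_of_le_of_lt (ENNReal.ofReal_le_ofReal ?_) hδ'.2
  have : (1 : ℝ) / ((n + 1 : ℕ) : ℝ) < δ' := by push_cast; exact hn
  refine le_trans (le_of_eq ?_) this.le
  push_cast
  rw [show (i : ℝ) - (i + 1) = -1 by ring, abs_neg, abs_one]

end UniformContinuity

section Algebra

variable {G : Type*} [Group G] {B : Type*} [MulAction Gᵐᵒᵖ B]

theorem orbitMap_mul (b : B) (x g : G) : DescendingMetric.orbitMap b (x * g) =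
    MulOpposite.op g • DescendingMetric.orbitMap b x := by
  simp [DescendingMetric.orbitMap, mul_smul]

theorem orbitMap_one (b : B) : DescendingMetric.orbitMap b (1 : G) = b := by
  simp [DescendingMetric.orbitMap]

theorem exists_orbitMap_eq [MulAction.IsPretransitive Gᵐᵒᵖ B] (b y : B) :
    ∃ g : G, DescendingMetric.orbitMap b g = y := by
  obtain ⟨g, hg⟩ := MulAction.exists_smul_eq Gᵐᵒᵖ b y
  exact ⟨g.unop, hg⟩

end Algebra

theorem contMDiff_action
    {E : Type*} [NormedAddCommGroup E] [NormedSpace ℝ E]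
    {G : Type*} [TopologicalSpace G] [ChartedSpace E G] [Group G]
    {F : Type*} [NormedAddCommGroup F] [NormedSpace ℝ F]
    {B : Type*} [TopologicalSpace B] [ChartedSpace F B] [MulAction Gᵐᵒᵖ B]
    (hact : ContMDiff (𝓘(ℝ, F).prod 𝓘(ℝ, E)) 𝓘(ℝ, F) ∞
    (fun p : B × G ↦ MulOpposite.op p.2 • p.1)) (g : G) :
    ContMDiff 𝓘(ℝ, F) 𝓘(ℝ, F) ∞ (fun y : B ↦ MulOpposite.op g • y) :=
  hact.comp (contMDiff_id.prodMk contMDiff_const)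

section Action

variable {E : Type*} [NormedAddCommGroup E] [NormedSpace ℝ E]
  {G : Type*} [TopologicalSpace G] [ChartedSpace E G] [Group G]
  [RiemannianBundle (fun x : G ↦ TangentSpace 𝓘(ℝ, E) x)]

theorem norm_mfderiv_mul_right (hinv : DescendingMetric.IsRightInvariantMetric E G) (g x : G)
    (v : TangentSpace 𝓘(ℝ, E) x) :
    ‖mfderiv 𝓘(ℝ, E) 𝓘(ℝ, E) (fun y : G ↦ y * g) x v‖ = ‖v‖ := by
  have := hinv g x v v
  rw [real_inner_self_eq_norm_sq, real_inner_self_eq_norm_sq] at this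
  exact (sq_eq_sq₀ (norm_nonneg _) (norm_nonneg _)).1 this

variable {F : Type*} [NormedAddCommGroup F] [NormedSpace ℝ F]
  {B : Type*} [TopologicalSpace B] [ChartedSpace F B]
  [RiemannianBundle (fun x : B ↦ TangentSpace 𝓘(ℝ, F) x)] [MulAction Gᵐᵒᵖ B]

theorem riemannianEDist_orbitMap_le [FiniteDimensional ℝ E] {b : B}
    (hdesc : DescendingMetric.DescendsTo E F (DescendingMetric.orbitMap (G := G) b)) (x y : G) :
    riemannianEDist 𝓘(ℝ, F) (DescendingMetric.orbitMap b x) (DescendingMetric.orbitMap b y) ≤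
      riemannianEDist 𝓘(ℝ, E) x y :=
  riemannianEDist_map_le (hdesc.smooth.of_le (by simp)) (norm_mfderiv_le_of_descendsTo hdesc) x y

variable [LieGroup 𝓘(ℝ, E) ∞ G]

theorem riemannianEDist_mul_right (hinv : DescendingMetric.IsRightInvariantMetric E G) (x y g : G) :
    riemannianEDist 𝓘(ℝ, E) (x * g) (y * g) = riemannianEDist 𝓘(ℝ, E) x y := by
  have key : ∀ x y g : G,
      riemannianEDist 𝓘(ℝ, E) (x * g) (y * g) ≤ riemannianEDist 𝓘(ℝ, E) x y := fun x y g ↦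
    riemannianEDist_map_le (f := fun y : G ↦ y * g)
      ((contMDiff_mul_right (I := 𝓘(ℝ, E)) (n := ∞)).of_le (by simp))
      (fun x v ↦ (norm_mfderiv_mul_right hinv g x v).le) x y
  refine le_antisymm (key x y g) ?_
  simpa using key (x * g) (y * g) g⁻¹

variable [FiniteDimensional ℝ E] [MulAction.IsPretransitive Gᵐᵒᵖ B]

/-- The group acts on the quotient by isometries: a tangent vector of the quotient is moved by
moving its horizontal lift by the corresponding right translation. -/
theorem norm_mfderiv_action_le (hact : ContMDiff (𝓘(ℝ, F).prod 𝓘(ℝ, E)) 𝓘(ℝ, F) ∞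
      (fun p : B × G ↦ MulOpposite.op p.2 • p.1))
    (hinv : DescendingMetric.IsRightInvariantMetric E G) {b : B}
    (hdesc : DescendingMetric.DescendsTo E F (DescendingMetric.orbitMap (G := G) b)) (g : G) (y : B)
    (v : TangentSpace 𝓘(ℝ, F) y) :
    ‖mfderiv 𝓘(ℝ, F) 𝓘(ℝ, F) (fun y : B ↦ MulOpposite.op g • y) y v‖ ≤ ‖v‖ := by
  obtain ⟨x, rfl⟩ := exists_orbitMap_eq (G := G) b y
  obtain ⟨S, hPS, hS⟩ := exists_isometric_rightInverse_mfderiv hdesc x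
  have hdp : ∀ x : G, MDifferentiableAt 𝓘(ℝ, E) 𝓘(ℝ, F) (DescendingMetric.orbitMap (G := G) b) x :=
    fun x ↦ hdesc.smooth.mdifferentiableAt (by simp)
  have hdR : MDifferentiableAt 𝓘(ℝ, E) 𝓘(ℝ, E) (fun y : G ↦ y * g) x :=
    (contMDiff_mul_right (I := 𝓘(ℝ, E)) (n := ∞)).mdifferentiableAt (by simp)
  have hdA : MDifferentiableAt 𝓘(ℝ, F) 𝓘(ℝ, F) (fun y : B ↦ MulOpposite.op g • y)
      (DescendingMetric.orbitMap b x) := (contMDiff_action hact g).mdifferentiableAt (by simp)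
  have hcomm : (fun y : B ↦ MulOpposite.op g • y) ∘ DescendingMetric.orbitMap (G := G) b =
      DescendingMetric.orbitMap (G := G) b ∘ fun y : G ↦ y * g := by
    funext z; exact (orbitMap_mul b z g).symm
  have h1 := mfderiv_comp x hdA (hdp x)
  have h2 := mfderiv_comp x (hdp (x * g)) hdR
  have e0 : ∀ f f' : G → B, f = f' → ∀ u : TangentSpace 𝓘(ℝ, E) x,
      ‖mfderiv 𝓘(ℝ, E) 𝓘(ℝ, F) f x u‖ = ‖mfderiv 𝓘(ℝ, E) 𝓘(ℝ, F) f' x u‖ := by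
    rintro f _ rfl u; rfl
  have e : mfderiv 𝓘(ℝ, F) 𝓘(ℝ, F) (fun y : B ↦ MulOpposite.op g • y)
      (DescendingMetric.orbitMap b x) v = mfderiv 𝓘(ℝ, E) 𝓘(ℝ, F)
        ((fun y : B ↦ MulOpposite.op g • y) ∘ DescendingMetric.orbitMap (G := G) b) x (S v) := by
    rw [h1]
    exact congrArg _ (hPS v).symm
  rw [e]
  refine (e0 _ _ hcomm (S v)).trans_le ?_
  rw [h2]
  refine (norm_mfderiv_le_of_descendsTo hdesc (x * g) _).trans ?_
  exact (norm_mfderiv_mul_right hinv g x (S v)).le.trans (hS v).le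

/-- The group acts on the quotient by isometries. -/
theorem riemannianEDist_action (hact : ContMDiff (𝓘(ℝ, F).prod 𝓘(ℝ, E)) 𝓘(ℝ, F) ∞
      (fun p : B × G ↦ MulOpposite.op p.2 • p.1))
    (hinv : DescendingMetric.IsRightInvariantMetric E G) {b : B}
    (hdesc : DescendingMetric.DescendsTo E F (DescendingMetric.orbitMap (G := G) b)) (g : Gᵐᵒᵖ)
    (y z : B) :
    riemannianEDist 𝓘(ℝ, F) (g • y) (g • z) = riemannianEDist 𝓘(ℝ, F) y z := by
  have key : ∀ (g : Gᵐᵒᵖ) (y z : B),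
      riemannianEDist 𝓘(ℝ, F) (g • y) (g • z) ≤ riemannianEDist 𝓘(ℝ, F) y z := fun g y z ↦
    riemannianEDist_map_le (f := fun y : B ↦ MulOpposite.op g.unop • y)
      ((contMDiff_action hact g.unop).of_le (by simp))
      (norm_mfderiv_action_le hact hinv hdesc g.unop) y z
  refine le_antisymm (key g y z) ?_
  simpa using key g⁻¹ (g • y) (g • z)

variable [FiniteDimensional ℝ F] [RegularSpace B]
  [IsContinuousRiemannianBundle E (fun x : G ↦ TangentSpace 𝓘(ℝ, E) x)]
  [IsManifold 𝓘(ℝ, F) ∞ B]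
  [IsContinuousRiemannianBundle F (fun x : B ↦ TangentSpace 𝓘(ℝ, F) x)]

/-- Points over a nearby base point can be found at almost the distance of the base points,
uniformly in the base point. -/
theorem exists_uniform_lift (hact : ContMDiff (𝓘(ℝ, F).prod 𝓘(ℝ, E)) 𝓘(ℝ, F) ∞
      (fun p : B × G ↦ MulOpposite.op p.2 • p.1))
    (hinv : DescendingMetric.IsRightInvariantMetric E G) {b : B}
    (hdesc : DescendingMetric.DescendsTo E F (DescendingMetric.orbitMap (G := G) b)) {r : ℝ}
    (hr : 1 < r) :
    ∃ c : ℝ≥0∞, 0 < c ∧ ∀ (x : G) (y : B),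
      riemannianEDist 𝓘(ℝ, F) (DescendingMetric.orbitMap b x) y < c →
        ∃ z, DescendingMetric.orbitMap b z = y ∧ riemannianEDist 𝓘(ℝ, E) x z ≤
          ENNReal.ofReal r * riemannianEDist 𝓘(ℝ, F) (DescendingMetric.orbitMap b x) y := by
  obtain ⟨c, c0, hc⟩ := setOfPred_riemannianEDist_lt_subset_nhds' 𝓘(ℝ, F)
    (eventually_exists_lift hdesc 1 hr)
  refine ⟨c, c0, fun x y hxy ↦ ?_⟩
  -- translate to the base point
  have e : riemannianEDist 𝓘(ℝ, F) (DescendingMetric.orbitMap b (1 : G))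
      (MulOpposite.op x⁻¹ • y) = riemannianEDist 𝓘(ℝ, F) (DescendingMetric.orbitMap b x) y := by
    rw [← riemannianEDist_action hact hinv hdesc (MulOpposite.op x), ← orbitMap_mul, one_mul,
      smul_smul]
    simp
  obtain ⟨z, hz, hd⟩ := hc (show _ < c from e.trans_lt hxy)
  refine ⟨z * x, ?_, ?_⟩
  · rw [orbitMap_mul, hz, smul_smul]; simp
  · rw [e, ← riemannianEDist_mul_right hinv _ _ x, one_mul] at hd
    exact hd

/-- The distance from `x` to the fibre over `y` is at most the distance from `π x` to `y`, where `π`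
is the orbit map: lift the points of a fine partition of a short curve from `π x` to `y` one after
the other. -/
theorem exists_lift_lt (hact : ContMDiff (𝓘(ℝ, F).prod 𝓘(ℝ, E)) 𝓘(ℝ, F) ∞
      (fun p : B × G ↦ MulOpposite.op p.2 • p.1))
    (hinv : DescendingMetric.IsRightInvariantMetric E G) {b : B}
    (hdesc : DescendingMetric.DescendsTo E F (DescendingMetric.orbitMap (G := G) b)) {x : G} {y : B}
    {L : ℝ≥0∞} (hL : riemannianEDist 𝓘(ℝ, F) (DescendingMetric.orbitMap b x) y < L) :
    ∃ z, DescendingMetric.orbitMap b z = y ∧ riemannianEDist 𝓘(ℝ, E) x z < L := by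
  obtain ⟨γ, γ0, γ1, γs, hγ⟩ := exists_lt_of_riemannianEDist_lt hL
  set ℓ := pathELength 𝓘(ℝ, F) γ 0 1 with hℓ
  obtain ⟨r, hr, hrL⟩ : ∃ r : ℝ, 1 < r ∧ ENNReal.ofReal r * ℓ < L := by
    have h1 : Tendsto (fun r : ℝ ↦ ENNReal.ofReal r * ℓ) (𝓝 1) (𝓝 (ENNReal.ofReal 1 * ℓ)) :=
      ENNReal.Tendsto.mul_const (ENNReal.tendsto_ofReal tendsto_id) (Or.inr hγ.ne_top)
    rw [ENNReal.ofReal_one, one_mul] at h1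
    obtain ⟨s, hs, hs'⟩ := (((h1.mono_left nhdsWithin_le_nhds).eventually_lt_const hγ).and
      (self_mem_nhdsWithin (s := Ioi (1 : ℝ)))).exists
    exact ⟨s, hs', hs⟩
  obtain ⟨c, c0, hc⟩ := exists_uniform_lift hact hinv hdesc hr
  obtain ⟨n, n0, hn⟩ := exists_uniform_mesh (E := F) γs.continuousOn c0
  have hn0 : (0 : ℝ) < n := by exact_mod_cast n0
  have key : ∀ i : ℕ, i ≤ n → ∃ z, DescendingMetric.orbitMap b z = γ (i / n) ∧
      riemannianEDist 𝓘(ℝ, E) x z ≤ ENNReal.ofReal r * pathELength 𝓘(ℝ, F) γ 0 (i / n) := by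
    intro i
    induction i with
    | zero => exact fun _ ↦ ⟨x, by simp [γ0], by simp [riemannianEDist_self]⟩
    | succ i ih =>
      intro hi
      obtain ⟨z, hz, hxz⟩ := ih (by omega)
      have hlt := hn i (by omega)
      rw [← hz] at hlt
      obtain ⟨w, hw, hzw⟩ := hc z _ hlt
      refine ⟨w, hw, riemannianEDist_triangle.trans ((add_le_add hxz hzw).trans ?_)⟩
      have h1 : ((i + 1 : ℕ) : ℝ) / n ≤ 1 := (div_le_one hn0).2 (by exact_mod_cast hi)
      have h0 : (0 : ℝ) ≤ i / n := by positivity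
      have h2 : (i : ℝ) / n ≤ (i + 1 : ℕ) / n := by gcongr; simp
      rw [← mul_add, ← pathELength_add h0 h2]
      gcongr
      rw [hz]
      exact riemannianEDist_le_pathELength (γs.mono (Icc_subset_Icc h0 h1)) rfl rfl h2
  obtain ⟨z, hz, hxz⟩ := key n le_rfl
  rw [div_self hn0.ne'] at hz hxz
  exact ⟨z, hz.trans γ1, hxz.trans_lt hrL⟩

/-- A metric geodesic in the quotient can be lifted at equidistant times, with distances exceeding
those in the quotient by little. -/
theorem exists_discrete_lift (hact : ContMDiff (𝓘(ℝ, F).prod 𝓘(ℝ, E)) 𝓘(ℝ, F) ∞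
      (fun p : B × G ↦ MulOpposite.op p.2 • p.1))
    (hinv : DescendingMetric.IsRightInvariantMetric E G) {b : B}
    (hdesc : DescendingMetric.DescendsTo E F (DescendingMetric.orbitMap (G := G) b)) {d : ℝ}
    {η : ℝ → B} (hη : IsMetricGeodesic F d η) (h0 : η 0 = b) {N : ℕ} (hN : 0 < N) :
    ∃ y : ℕ → G, y 0 = 1 ∧ (∀ i ≤ N, DescendingMetric.orbitMap b (y i) = η (i / N)) ∧
      ∀ i j : ℕ, i ≤ j → j ≤ N → riemannianEDist 𝓘(ℝ, E) (y i) (y j) ≤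
        ENNReal.ofReal ((j - i) * (d / N + 1 / N ^ 2)) := by
  -- a point over a base point at distance `d / N` can be found at less than `d / N + 1 / N ^ 2`,
  -- and `N` steps accumulate only the error `1 / N`
  have hN0 : (0 : ℝ) < N := by exact_mod_cast hN
  have hstep : ∀ (i : ℕ) (x : G), ∃ z : G, i < N → DescendingMetric.orbitMap b x = η (i / N) →
      DescendingMetric.orbitMap b z = η ((i + 1 : ℕ) / N) ∧
        riemannianEDist 𝓘(ℝ, E) x z ≤ ENNReal.ofReal (d / N + 1 / N ^ 2) := by
    intro i x
    by_cases h : i < N ∧ DescendingMetric.orbitMap b x = η (i / N)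
    · have h1 : ((i + 1 : ℕ) : ℝ) / N ∈ Icc (0 : ℝ) 1 :=
        ⟨by positivity, (div_le_one hN0).2 (by exact_mod_cast h.1)⟩
      have h2 : (i : ℝ) / N ∈ Icc (0 : ℝ) 1 :=
        ⟨by positivity, (div_le_one hN0).2 (by exact_mod_cast h.1.le)⟩
      have hlt : riemannianEDist 𝓘(ℝ, F) (DescendingMetric.orbitMap b x) (η ((i + 1 : ℕ) / N)) <
          ENNReal.ofReal (d / N + 1 / N ^ 2) := by
        rw [h.2, hη.2 _ h2 _ h1, ← sub_div, abs_div, abs_of_pos hN0]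
        have hd0 := hη.1
        rw [ENNReal.ofReal_lt_ofReal_iff (by positivity)]
        have : (0 : ℝ) < 1 / N ^ 2 := by positivity
        push_cast
        rw [add_sub_cancel_left, abs_one, mul_one_div]
        linarith
      obtain ⟨z, hz, hxz⟩ := exists_lift_lt hact hinv hdesc hlt
      exact ⟨z, fun _ _ ↦ ⟨hz, hxz.le⟩⟩
    · exact ⟨1, fun h1 h2 ↦ absurd ⟨h1, h2⟩ h⟩
  choose f hf using hstep
  let y : ℕ → G := fun n ↦ Nat.rec 1 f n
  have hy : ∀ i ≤ N, DescendingMetric.orbitMap b (y i) = η (i / N) := by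
    intro i
    induction i with
    | zero => intro _; simp [y, orbitMap_one, h0]
    | succ i ih => intro hi; exact (hf i (y i) (by omega) (ih (by omega))).1
  refine ⟨y, rfl, hy, fun i j hij ↦ ?_⟩
  have hd0 := hη.1
  induction j, hij using Nat.le_induction with
  | base => intro _; simp [riemannianEDist_self]
  | succ j hij ih =>
    intro hj
    have h1 := ih (by omega)
    have h2 := (hf j (y j) (by omega) (hy j (by omega))).2
    refine riemannianEDist_triangle.trans ((add_le_add h1 h2).trans ?_)
    have h3 : (0 : ℝ) ≤ j - i := sub_nonneg.2 (by exact_mod_cast hij)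
    rw [← ENNReal.ofReal_add (by positivity) (by positivity)]
    exact ENNReal.ofReal_le_ofReal (le_of_eq (by push_cast; ring))

end Action

/-! ### Existence of metric geodesics and of lifts -/

section Compactness

variable {E : Type*} [NormedAddCommGroup E] [NormedSpace ℝ E] [FiniteDimensional ℝ E]
  {G : Type*} [TopologicalSpace G] [ChartedSpace E G] [Group G]
  [LieGroup 𝓘(ℝ, E) ∞ G] [RiemannianBundle (fun x : G ↦ TangentSpace 𝓘(ℝ, E) x)]
  [IsContinuousRiemannianBundle E (fun x : G ↦ TangentSpace 𝓘(ℝ, E) x)] [RegularSpace G]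

/-- A Lie group with a right-invariant metric is proper. A ball of some radius `ρ` around `1` is
compact, and a ball of radius `R + ρ / 2` is contained in the product of the balls of radii `ρ` and
`R`. -/
theorem isCompact_closedBall (hinv : DescendingMetric.IsRightInvariantMetric E G) (R : ℝ) :
    IsCompact {y : G | riemannianEDist 𝓘(ℝ, E) 1 y ≤ ENNReal.ofReal R} := by
  have : LocallyCompactSpace G := Manifold.locallyCompact_of_finiteDimensional 𝓘(ℝ, E)
  have : IsTopologicalGroup G := topologicalGroup_of_lieGroup 𝓘(ℝ, E) ∞
  have hclosed : ∀ R : ℝ, IsClosed {y : G | riemannianEDist 𝓘(ℝ, E) 1 y ≤ ENNReal.ofReal R} :=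
    fun R ↦ isClosed_le (continuous_riemannianEDist.comp (continuous_const.prodMk continuous_id))
      continuous_const
  have hcont : ∀ x : G, Continuous fun y ↦ riemannianEDist 𝓘(ℝ, E) x y := fun x ↦
    continuous_riemannianEDist.comp (continuous_const.prodMk continuous_id)
  obtain ⟨K, hK, hK1⟩ := exists_compact_mem_nhds (1 : G)
  obtain ⟨c, c0, hc⟩ := setOfPred_riemannianEDist_lt_subset_nhds 𝓘(ℝ, E) hK1
  -- closed balls of small radius lie in a compact neighbourhood
  obtain ⟨ρ, ρ0, hρ⟩ : ∃ ρ : ℝ, 0 < ρ ∧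
      IsCompact {y : G | riemannianEDist 𝓘(ℝ, E) 1 y ≤ ENNReal.ofReal ρ} := by
    have c0' : (0 : ℝ) < c := c0
    refine ⟨c / 2, by positivity, hK.of_isClosed_subset (hclosed _) fun y hy ↦ hc ?_⟩
    refine lt_of_le_of_lt (show riemannianEDist 𝓘(ℝ, E) 1 y ≤ _ from hy) ?_
    rw [← ENNReal.ofReal_coe_nnreal]
    exact (ENNReal.ofReal_lt_ofReal_iff c0').2 (by linarith)
  have step : ∀ R : ℝ, 0 ≤ R → IsCompact {y : G | riemannianEDist 𝓘(ℝ, E) 1 y ≤ ENNReal.ofReal R} →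
      IsCompact {y : G | riemannianEDist 𝓘(ℝ, E) 1 y ≤ ENNReal.ofReal (R + ρ / 2)} := by
    intro R hR hRc
    refine (hρ.mul hRc).of_isClosed_subset (hclosed _) fun y hy ↦ ?_
    suffices ∃ x : G, riemannianEDist 𝓘(ℝ, E) 1 x ≤ ENNReal.ofReal R ∧
        riemannianEDist 𝓘(ℝ, E) x y ≤ ENNReal.ofReal ρ by
      obtain ⟨x, hx, hxy⟩ := this
      refine ⟨y * x⁻¹, ?_, x, hx, by simp⟩
      rw [← riemannianEDist_mul_right hinv _ _ x⁻¹, mul_inv_cancel] at hxy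
      exact hxy
    rcases le_total (riemannianEDist 𝓘(ℝ, E) 1 y) (ENNReal.ofReal R) with h | h
    · exact ⟨y, h, by simp [riemannianEDist_self]⟩
    have hlt : riemannianEDist 𝓘(ℝ, E) 1 y < ENNReal.ofReal (R + ρ) :=
      lt_of_le_of_lt hy ((ENNReal.ofReal_lt_ofReal_iff (by linarith)).2 (by linarith))
    obtain ⟨γ, γ0, γ1, γs, hγ⟩ := exists_lt_of_riemannianEDist_lt hlt
    -- `x` is the point at distance `R` on a curve to `y` of length less than `R + ρ`
    obtain ⟨τ, hτ, he⟩ := intermediate_value_Icc zero_le_one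
      ((hcont 1).comp_continuousOn γs.continuousOn)
      (show ENNReal.ofReal R ∈ _ from ⟨by simp [γ0, riemannianEDist_self], by simpa [γ1] using h⟩)
    refine ⟨γ τ, he.le, ?_⟩
    have h1 : ENNReal.ofReal R ≤ pathELength 𝓘(ℝ, E) γ 0 τ := by
      rw [← he]
      exact riemannianEDist_le_pathELength (γs.mono (Icc_subset_Icc_right hτ.2)) γ0 rfl hτ.1
    have h2 : riemannianEDist 𝓘(ℝ, E) (γ τ) y ≤ pathELength 𝓘(ℝ, E) γ τ 1 :=
      riemannianEDist_le_pathELength (γs.mono (Icc_subset_Icc_left hτ.1)) rfl γ1 hτ.2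
    have h3 : ENNReal.ofReal R + riemannianEDist 𝓘(ℝ, E) (γ τ) y ≤
        ENNReal.ofReal R + ENNReal.ofReal ρ := by
      rw [← ENNReal.ofReal_add hR ρ0.le]
      refine (add_le_add h1 h2).trans ?_
      rw [pathELength_add hτ.1 hτ.2]
      exact hγ.le
    exact (ENNReal.add_le_add_iff_left ENNReal.ofReal_ne_top).1 h3
  have main : ∀ n : ℕ,
      IsCompact {y : G | riemannianEDist 𝓘(ℝ, E) 1 y ≤ ENNReal.ofReal (n * (ρ / 2))} := by
    intro n
    induction n with
    | zero =>
      refine hρ.of_isClosed_subset (hclosed _) fun y hy ↦ ?_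
      refine (show riemannianEDist 𝓘(ℝ, E) 1 y ≤ _ from hy).trans ?_
      exact ENNReal.ofReal_le_ofReal (by simpa using ρ0.le)
    | succ n ih =>
      have := step _ (by positivity) ih
      rwa [show (n : ℝ) * (ρ / 2) + ρ / 2 = ((n + 1 : ℕ) : ℝ) * (ρ / 2) by push_cast; ring] at this
  obtain ⟨n, hn⟩ := exists_nat_ge (R / (ρ / 2))
  refine (main n).of_isClosed_subset (hclosed _) fun y hy ↦ ?_
  refine (show riemannianEDist 𝓘(ℝ, E) 1 y ≤ _ from hy).trans ?_
  exact ENNReal.ofReal_le_ofReal ((div_le_iff₀ (by positivity)).1 hn)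

/-- A sequence of curves starting at `1` which are `d`-Lipschitz up to errors tending to zero
converges pointwise along an ultrafilter, and the limit is `d`-Lipschitz. -/
theorem exists_tendsto_hyperfilter (hinv : DescendingMetric.IsRightInvariantMetric E G) {d : ℝ}
    (d0 : 0 ≤ d) {ε : ℕ → ℝ} (hε : Tendsto ε atTop (𝓝 0)) {σ : ℕ → ℝ → G} (h0 : ∀ n, σ n 0 = 1)
    (hσ : ∀ n, ∀ s ∈ Icc (0 : ℝ) 1, ∀ t ∈ Icc (0 : ℝ) 1, s ≤ t →
      riemannianEDist 𝓘(ℝ, E) (σ n s) (σ n t) ≤ ENNReal.ofReal (d * (t - s) + ε n)) :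
    ∃ τ : ℝ → G, (∀ t ∈ Icc (0 : ℝ) 1, Tendsto (fun n ↦ σ n t) (hyperfilter ℕ) (𝓝 (τ t))) ∧
      ∀ s ∈ Icc (0 : ℝ) 1, ∀ t ∈ Icc (0 : ℝ) 1, s ≤ t →
        riemannianEDist 𝓘(ℝ, E) (τ s) (τ t) ≤ ENNReal.ofReal (d * (t - s)) := by
  obtain ⟨C, hC⟩ := hε.bddAbove_range
  have hC' : ∀ n, ε n ≤ C := fun n ↦ hC (mem_range_self n)
  have hlim : ∀ t : ℝ, ∃ x : G, t ∈ Icc (0 : ℝ) 1 →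
      Tendsto (fun n ↦ σ n t) (hyperfilter ℕ) (𝓝 x) := by
    intro t
    by_cases ht : t ∈ Icc (0 : ℝ) 1
    · have hmem : ∀ n, σ n t ∈ {y : G | riemannianEDist 𝓘(ℝ, E) 1 y ≤ ENNReal.ofReal (d + C)} := by
        intro n
        have := hσ n 0 (by simp) t ht ht.1
        rw [h0] at this
        refine le_trans this (ENNReal.ofReal_le_ofReal ?_)
        have := mul_le_of_le_one_right d0 ht.2
        linarith [hC' n]
      obtain ⟨x, -, hx⟩ := isCompact_iff_ultrafilter_le_nhds.1 (isCompact_closedBall hinv (d + C))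
        ((hyperfilter ℕ).map fun n ↦ σ n t)
        (by
          rw [Ultrafilter.coe_map, le_principal_iff]
          exact Filter.mem_map.2 (univ_mem' hmem))
      exact ⟨x, fun _ ↦ hx⟩
    · exact ⟨1, fun h ↦ absurd h ht⟩
  choose τ hτ using hlim
  refine ⟨τ, hτ, fun s hs t ht hst ↦ ?_⟩
  have h1 : Tendsto (fun n ↦ riemannianEDist 𝓘(ℝ, E) (σ n s) (σ n t)) (hyperfilter ℕ)
      (𝓝 (riemannianEDist 𝓘(ℝ, E) (τ s) (τ t))) :=
    (continuous_riemannianEDist.tendsto (τ s, τ t)).comp ((hτ s hs).prodMk_nhds (hτ t ht))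
  have h2 : Tendsto (fun n ↦ ENNReal.ofReal (d * (t - s) + ε n)) (hyperfilter ℕ)
      (𝓝 (ENNReal.ofReal (d * (t - s) + 0))) :=
    ENNReal.tendsto_ofReal ((hε.mono_left Nat.hyperfilter_le_atTop).const_add _)
  rw [add_zero] at h2
  exact le_of_tendsto_of_tendsto h1 h2 (univ_mem' fun n ↦ hσ n s hs t ht hst)

variable [T2Space G]

/-- In a Lie group with a right-invariant metric, points at finite distance from `1` are joined to
`1` by metric geodesics. -/
theorem exists_isMetricGeodesic (hinv : DescendingMetric.IsRightInvariantMetric E G) {x : G} {d : ℝ}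
    (d0 : 0 ≤ d) (hd : riemannianEDist 𝓘(ℝ, E) 1 x = ENNReal.ofReal d) :
    ∃ τ : ℝ → G, τ 0 = 1 ∧ τ 1 = x ∧ IsMetricGeodesic E d τ := by
  have := fun n : ℕ ↦ exists_almost_geodesic d0 (Nat.one_div_pos_of_nat (α := ℝ) (n := n)) hd
  choose σ h0 h1 hσ using this
  obtain ⟨τ, hτ, hl⟩ := exists_tendsto_hyperfilter hinv d0 tendsto_one_div_add_atTop_nhds_zero_nat
    h0 hσ
  have e0 : τ 0 = 1 := tendsto_nhds_unique (hτ 0 (by simp))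
    (by simpa only [h0] using tendsto_const_nhds)
  have e1 : τ 1 = x := tendsto_nhds_unique (hτ 1 (by simp))
    (by simpa only [h1] using tendsto_const_nhds)
  refine ⟨τ, e0, e1, isMetricGeodesic_of_le d0 hl ?_⟩
  rw [e0, e1, hd]

variable {F : Type*} [NormedAddCommGroup F] [NormedSpace ℝ F] [FiniteDimensional ℝ F]
  {B : Type*} [TopologicalSpace B] [ChartedSpace F B] [T2Space B] [RegularSpace B]
  [IsManifold 𝓘(ℝ, F) ∞ B] [RiemannianBundle (fun x : B ↦ TangentSpace 𝓘(ℝ, F) x)]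
  [IsContinuousRiemannianBundle F (fun x : B ↦ TangentSpace 𝓘(ℝ, F) x)]
  [MulAction Gᵐᵒᵖ B] [MulAction.IsPretransitive Gᵐᵒᵖ B]

/-- A metric geodesic in the quotient starting at the base point lifts to a metric geodesic of the
same speed in the group, starting at `1`. -/
theorem exists_lift (hact : ContMDiff (𝓘(ℝ, F).prod 𝓘(ℝ, E)) 𝓘(ℝ, F) ∞
      (fun p : B × G ↦ MulOpposite.op p.2 • p.1))
    (hinv : DescendingMetric.IsRightInvariantMetric E G) {b : B}
    (hdesc : DescendingMetric.DescendsTo E F (DescendingMetric.orbitMap (G := G) b)) {d : ℝ}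
    {η : ℝ → B} (hη : IsMetricGeodesic F d η) (hc : ContinuousOn η (Icc 0 1)) (h0 : η 0 = b) :
    ∃ τ : ℝ → G, τ 0 = 1 ∧ (∀ t ∈ Icc (0 : ℝ) 1, DescendingMetric.orbitMap b (τ t) = η t) ∧
      IsMetricGeodesic E d τ := by
  have := fun n : ℕ ↦ exists_discrete_lift hact hinv hdesc hη h0 n.succ_pos
  choose y y0 hy hyd using this
  have hd0 := hη.1
  have hfl : ∀ (n : ℕ), ∀ t ∈ Icc (0 : ℝ) 1, ⌊t * (n + 1 : ℕ)⌋₊ ≤ n + 1 := fun n t ht ↦ by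
    refine Nat.floor_le_of_le ?_
    exact mul_le_of_le_one_left (by positivity) ht.2
  -- the approximate lifts take the lifted value at the last multiple of `1 / (n + 1)`; rounding
  -- contributes one more step, and this is the additive error `ε n`
  let ε : ℕ → ℝ := fun n ↦ (d + 2) * (1 / ((n : ℝ) + 1))
  have hε : Tendsto ε atTop (𝓝 0) := by
    simpa [ε] using tendsto_one_div_add_atTop_nhds_zero_nat.const_mul (d + 2)
  obtain ⟨τ, hτ, hl⟩ := exists_tendsto_hyperfilter (σ := fun n t ↦ y n ⌊t * (n + 1 : ℕ)⌋₊) hinv hd0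
    hε (fun n ↦ by simp [y0]) (fun n s hs t ht hst ↦ by
      have hN : (0 : ℝ) < (n + 1 : ℕ) := by positivity
      have hmono : ⌊s * (n + 1 : ℕ)⌋₊ ≤ ⌊t * (n + 1 : ℕ)⌋₊ := Nat.floor_le_floor (by gcongr)
      refine (hyd n _ _ hmono (hfl n t ht)).trans (ENNReal.ofReal_le_ofReal ?_)
      have h1 : (⌊t * (n + 1 : ℕ)⌋₊ : ℝ) ≤ t * (n + 1 : ℕ) :=
        Nat.floor_le (mul_nonneg ht.1 hN.le)
      have h2 : s * (n + 1 : ℕ) < (⌊s * (n + 1 : ℕ)⌋₊ : ℝ) + 1 := Nat.lt_floor_add_one _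
      have h3 : (⌊t * (n + 1 : ℕ)⌋₊ : ℝ) - ⌊s * (n + 1 : ℕ)⌋₊ ≤ (t - s) * (n + 1 : ℕ) + 1 := by
        linarith
      refine (mul_le_mul_of_nonneg_right h3 (by positivity)).trans ?_
      have hN1 : (1 : ℝ) ≤ (n + 1 : ℕ) := by simp
      simp only [ε]
      rw [← Nat.cast_add_one]
      set N : ℝ := ((n + 1 : ℕ) : ℝ)
      have e : ((t - s) * N + 1) * (d / N + 1 / N ^ 2) =
          d * (t - s) + (d + (t - s) + 1 / N) * (1 / N) := by
        field_simp
        ring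
      rw [e]
      have h4 : 1 / N ≤ 1 := (div_le_one hN).2 hN1
      have h5 : t - s ≤ 1 := by linarith [ht.2, hs.1]
      exact add_le_add le_rfl (mul_le_mul_of_nonneg_right (by linarith) (by positivity)))
  have e0 : τ 0 = 1 := tendsto_nhds_unique (hτ 0 (by simp)) (by
    simpa only [zero_mul, Nat.floor_zero, y0] using tendsto_const_nhds)
  have hp : ∀ t ∈ Icc (0 : ℝ) 1, DescendingMetric.orbitMap b (τ t) = η t := by
    intro t ht
    have h1 : Tendsto (fun n ↦ DescendingMetric.orbitMap b (y n ⌊t * (n + 1 : ℕ)⌋₊))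
        (hyperfilter ℕ) (𝓝 (DescendingMetric.orbitMap b (τ t))) :=
      (hdesc.smooth.continuous.tendsto (τ t)).comp (hτ t ht)
    have h2 : Tendsto (fun n : ℕ ↦ (⌊t * (n + 1 : ℕ)⌋₊ : ℝ) / (n + 1 : ℕ)) atTop (𝓝 t) :=
      ((tendsto_nat_floor_mul_div_atTop ht.1).comp tendsto_natCast_atTop_atTop).comp
        (tendsto_add_atTop_nat 1)
    have h3 : Tendsto (fun n : ℕ ↦ η ((⌊t * (n + 1 : ℕ)⌋₊ : ℝ) / (n + 1 : ℕ))) atTop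
        (𝓝 (η t)) := by
      refine (hc t ht).tendsto.comp (tendsto_nhdsWithin_iff.2 ⟨h2, univ_mem' fun n ↦ ?_⟩)
      refine ⟨by positivity, (div_le_one (by positivity)).2 ?_⟩
      exact_mod_cast hfl n t ht
    refine tendsto_nhds_unique h1 ((h3.mono_left Nat.hyperfilter_le_atTop).congr fun n ↦ ?_)
    exact (hy n _ (hfl n t ht)).symm
  refine ⟨τ, e0, hp, isMetricGeodesic_of_le hd0 hl ?_⟩
  rw [← hη.edist_zero_one, ← hp 0 (by simp), ← hp 1 (by simp)]
  exact riemannianEDist_orbitMap_le hdesc _ _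

end Compactness

/-! ### The velocity of lifts -/

section HorizontalVelocity

variable {E : Type*} [NormedAddCommGroup E] [NormedSpace ℝ E]
  {M : Type*} [TopologicalSpace M] [ChartedSpace E M]
  [RiemannianBundle (fun x : M ↦ TangentSpace 𝓘(ℝ, E) x)]
  [IsManifold 𝓘(ℝ, E) 1 M] [IsContinuousRiemannianBundle E (fun x : M ↦ TangentSpace 𝓘(ℝ, E) x)]

theorem IsMetricGeodesic.continuousOn [RegularSpace M] {d : ℝ} {f : ℝ → M}
    (h : IsMetricGeodesic E d f) : ContinuousOn f (Icc 0 1) := by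
  intro t ht s hs
  obtain ⟨c, c0, hc⟩ := setOfPred_riemannianEDist_lt_subset_nhds' 𝓘(ℝ, E) hs
  have h1 : Tendsto (fun u : ℝ ↦ ENNReal.ofReal (d * |u - t|)) (𝓝[Icc 0 1] t) (𝓝 0) := by
    have : Continuous (fun u : ℝ ↦ ENNReal.ofReal (d * |u - t|)) :=
      ENNReal.continuous_ofReal.comp (by fun_prop)
    exact (this.tendsto' t 0 (by simp)).mono_left nhdsWithin_le_nhds
  rw [mem_map]
  filter_upwards [h1.eventually_lt_const c0, self_mem_nhdsWithin] with u hu hu'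
  exact hc (show riemannianEDist 𝓘(ℝ, E) (f t) (f u) < c by rwa [h.2 t ht u hu'])

variable {F : Type*} [NormedAddCommGroup F] [NormedSpace ℝ F]
  {N : Type*} [TopologicalSpace N] [ChartedSpace F N]
  [RiemannianBundle (fun x : N ↦ TangentSpace 𝓘(ℝ, F) x)] {p : M → N}

/-- A metric geodesic over a differentiable curve of the same speed is differentiable, and its
velocity `u` is horizontal. The difference quotients `q` of the metric geodesic have norm at most
about `d = ‖u‖`, and since `u` is horizontal, `⟪u, q⟫` only depends on the projection of `q`, which
converges to that of `u`. Hence `‖q - u‖ ^ 2 = ‖q‖ ^ 2 - 2 ⟪u, q⟫ + ‖u‖ ^ 2` tends to zero. -/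
theorem IsMetricGeodesic.hasDerivWithinAt_of_map [FiniteDimensional ℝ E] [FiniteDimensional ℝ F]
    [RegularSpace M] (h : DescendingMetric.DescendsTo E F p) {d : ℝ} {τ : ℝ → M}
    (hτ : IsMetricGeodesic E d τ) {t : ℝ} (ht : t ∈ Icc (0 : ℝ) 1) {u : E} {v : F}
    (hv : HasDerivWithinAt (extChartAt 𝓘(ℝ, F) (p (τ t)) ∘ p ∘ τ) v (Icc 0 1) t)
    (huv : mfderiv 𝓘(ℝ, E) 𝓘(ℝ, F) p (τ t) (toFiber E (τ t) u) = toFiber F (p (τ t)) v)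
    (hu : ‖toFiber E (τ t) u‖ = d) (hvd : ‖toFiber F (p (τ t)) v‖ = d) :
    HasDerivWithinAt (extChartAt 𝓘(ℝ, E) (τ t) ∘ τ) u (Icc 0 1) t := by
  have : FiniteDimensional ℝ (TangentSpace 𝓘(ℝ, F) (p (τ t))) :=
    inferInstanceAs (FiniteDimensional ℝ F)
  have : FiniteDimensional ℝ (TangentSpace 𝓘(ℝ, E) (τ t)) :=
    inferInstanceAs (FiniteDimensional ℝ E)
  set x := τ t with hx
  set φ := extChartAt 𝓘(ℝ, E) x with hφ
  set ψ := extChartAt 𝓘(ℝ, F) (p x) with hψ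
  set l := 𝓝[Icc (0 : ℝ) 1 \ {t}] t with hl
  have hmem : ∀ᶠ s in l, s ∈ Icc (0 : ℝ) 1 \ {t} := self_mem_nhdsWithin
  have hcτ : Tendsto τ l (𝓝 x) :=
    (hτ.continuousOn t ht).mono_left (nhdsWithin_mono _ sdiff_subset)
  let q : ℝ → E := slope (φ ∘ τ) t
  have hq : ∀ s, q s = (s - t)⁻¹ • (φ (τ s) - φ x) := fun s ↦ by simp [q, slope, hx]
  -- the difference quotients are bounded by `d` in the limit
  have hbound : ∀ r : ℝ, 1 < r → ∀ᶠ s in l, ‖toFiber E x (q s)‖ ≤ r * d := by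
    intro r hr
    filter_upwards [((tendsto_const_nhds (x := x)).prodMk_nhds hcτ).eventually
      (eventually_norm_toFiber_le (E := E) x hr), hmem] with s h1 hs
    have hpos : 0 < |s - t| := abs_pos.2 (sub_ne_zero.2 hs.2)
    rw [hx, hτ.2 t ht s hs.1, ← ENNReal.ofReal_mul (by linarith),
      ENNReal.ofReal_le_ofReal_iff (by have := hτ.1; positivity)] at h1
    rw [hq, map_smul, norm_smul, norm_inv, Real.norm_eq_abs, inv_mul_le_iff₀ hpos]
    exact h1.trans_eq (by ring)
  -- their projections converge
  let P : E →L[ℝ] F := mfderiv 𝓘(ℝ, E) 𝓘(ℝ, F) p x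
  have hP : HasFDerivAt (ψ ∘ p ∘ φ.symm) P (φ x) := by
    have : HasFDerivWithinAt (E := E) (F := F) (ψ ∘ p ∘ φ.symm) P (range 𝓘(ℝ, E)) (φ x) :=
      (h.smooth.mdifferentiableAt (x := x) (by simp)).hasMFDerivAt.2
    rwa [show range 𝓘(ℝ, E) = (univ : Set E) by simp, hasFDerivWithinAt_univ] at this
  have hbig : (fun s ↦ φ (τ s) - φ x) =O[l] fun s ↦ s - t := by
    let C : ℝ := ‖((toFiber E x).symm : TangentSpace 𝓘(ℝ, E) x →L[ℝ] E)‖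
    have C0 : 0 ≤ C := ContinuousLinearMap.opNorm_nonneg _
    refine Asymptotics.IsBigO.of_bound (C * (2 * d)) ?_
    filter_upwards [hbound 2 (by norm_num), hmem] with s hs hs'
    have h1 : φ (τ s) - φ x = (s - t) • q s := by
      rw [hq, smul_inv_smul₀ (sub_ne_zero.2 hs'.2)]
    have h2 : ‖q s‖ ≤ C * ‖toFiber E x (q s)‖ :=
      ((toFiber E x).symm : TangentSpace 𝓘(ℝ, E) x →L[ℝ] E).le_opNorm (toFiber E x (q s))
    rw [h1, norm_smul, mul_comm]
    gcongr
    exact h2.trans (by gcongr)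
  have hPq : Tendsto (fun s ↦ P (q s)) l (𝓝 v) := by
    have h1 : (fun s ↦ (ψ ∘ p ∘ φ.symm) (φ (τ s)) - (ψ ∘ p ∘ φ.symm) (φ x) -
        P (φ (τ s) - φ x)) =o[l] fun s ↦ s - t :=
      (hP.isLittleO.comp_tendsto ((continuousAt_extChartAt x).tendsto.comp hcτ)).trans_isBigO hbig
    have h2 := (hasDerivWithinAt_iff_tendsto_slope.1 hv).sub h1.tendsto_inv_smul_nhds_zero
    rw [sub_zero] at h2
    refine h2.congr' ?_
    filter_upwards [hcτ.eventually (extChartAt_source_mem_nhds (I := 𝓘(ℝ, E)) x)] with s hs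
    simp only [Function.comp_apply, slope, vsub_eq_sub]
    rw [φ.left_inv hs, φ.left_inv (mem_extChartAt_source x), ← hx, hq, map_smul, ← smul_sub,
      sub_sub_cancel]
  -- the inner product with `u` only depends on the projection
  obtain ⟨S, hPS, hS⟩ := exists_isometric_rightInverse_mfderiv h x
  let U : TangentSpace 𝓘(ℝ, E) x := toFiber E x u
  let m : TangentSpace 𝓘(ℝ, F) (p x) →L[ℝ] ℝ :=
    LinearMap.toContinuousLinearMap ((innerₗ (TangentSpace 𝓘(ℝ, E) x) U) ∘ₗ S)
  have hhor := inner_eq_zero_of_norm_eq (fun u v hu hv ↦ h.inner_eq x u v hu hv)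
    (show ‖mfderiv 𝓘(ℝ, E) 𝓘(ℝ, F) p x U‖ = ‖U‖ by rw [huv, hvd, hu])
  have hm : ∀ w : E, inner ℝ U (toFiber E x w) = m (toFiber F (p x) (P w)) := by
    intro w
    have h1 := hhor (toFiber E x w - S (toFiber F (p x) (P w))) (by
      rw [map_sub, hPS]; exact sub_self (P w))
    rw [inner_sub_right] at h1
    exact sub_eq_zero.1 h1
  have hinner : Tendsto (fun s ↦ inner ℝ U (toFiber E x (q s))) l (𝓝 (d ^ 2)) := by
    have h1 : Tendsto (fun s ↦ m (toFiber F (p x) (P (q s)))) l (𝓝 (m (toFiber F (p x) v))) :=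
      ((m.continuous.comp (toFiber F (p x)).continuous).tendsto v).comp hPq
    have h2 : m (toFiber F (p x) v) = d ^ 2 := by
      rw [← huv, ← hu, ← real_inner_self_eq_norm_sq]
      exact (hm u).symm
    rw [h2] at h1
    exact h1.congr fun s ↦ (hm (q s)).symm
  rw [hasDerivWithinAt_iff_tendsto_slope]
  have hz : Tendsto (fun s ↦ ‖toFiber E x (q s) - U‖ ^ 2) l (𝓝 0) := by
    rw [Metric.tendsto_nhds]
    intro ε ε0
    obtain ⟨r, hr1, hr⟩ : ∃ r : ℝ, 1 < r ∧ (r * d) ^ 2 < d ^ 2 + ε / 2 := by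
      have h1 := (tendsto_mul_nhdsGT_one d).pow 2
      obtain ⟨s, hs, hs'⟩ := ((h1.eventually_lt_const (show d ^ 2 < d ^ 2 + ε / 2 by linarith)).and
        (self_mem_nhdsWithin (s := Ioi (1 : ℝ)))).exists
      exact ⟨s, hs', hs⟩
    filter_upwards [hbound r hr1,
      hinner.eventually_const_lt (show d ^ 2 - ε / 4 < d ^ 2 by linarith)] with s h1 h2
    rw [Real.dist_eq, sub_zero, abs_of_nonneg (by positivity), norm_sub_sq_real,
      real_inner_comm, hu]
    have h3 := pow_le_pow_left₀ (norm_nonneg _) h1 2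
    linarith
  have hz' : Tendsto (fun s ↦ ‖toFiber E x (q s) - U‖) l (𝓝 0) := by
    have := hz.sqrt
    simpa using this
  have h4 : Tendsto (fun s ↦ toFiber E x (q s)) l (𝓝 U) := tendsto_iff_norm_sub_tendsto_zero.2 hz'
  exact ((toFiber E x).symm.continuous.tendsto U).comp h4

end HorizontalVelocity

/-! ### The differential equation of lifts -/

section HorizontalField

variable {E : Type*} [NormedAddCommGroup E] [NormedSpace ℝ E] [FiniteDimensional ℝ E]
  {G : Type*} [TopologicalSpace G] [ChartedSpace E G] [Group G] [LieGroup 𝓘(ℝ, E) ∞ G]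
  [RiemannianBundle (fun x : G ↦ TangentSpace 𝓘(ℝ, E) x)]
  {F : Type*} [NormedAddCommGroup F] [NormedSpace ℝ F] [FiniteDimensional ℝ F]
  {B : Type*} [TopologicalSpace B] [ChartedSpace F B] [IsManifold 𝓘(ℝ, F) ∞ B]
  [RiemannianBundle (fun x : B ↦ TangentSpace 𝓘(ℝ, F) x)]
  [MulAction Gᵐᵒᵖ B] [MulAction.IsPretransitive Gᵐᵒᵖ B]

/-- There is a family `Ψ (g, ·)` of local sections of the orbit map, depending smoothly on a point
`g` through which the section passes, and infinitesimally isometric at that point: it is obtained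
from a single section near `1` by translation. -/
theorem exists_section_family (hact : ContMDiff (𝓘(ℝ, F).prod 𝓘(ℝ, E)) 𝓘(ℝ, F) ∞
      (fun p : B × G ↦ MulOpposite.op p.2 • p.1))
    (hinv : DescendingMetric.IsRightInvariantMetric E G) {b : B}
    (hdesc : DescendingMetric.DescendsTo E F (DescendingMetric.orbitMap (G := G) b)) :
    ∃ Ψ : G × B → G, ∀ g : G,
      ContMDiffAt (𝓘(ℝ, E).prod 𝓘(ℝ, F)) 𝓘(ℝ, E) ∞ Ψ (g, DescendingMetric.orbitMap b g) ∧
      Ψ (g, DescendingMetric.orbitMap b g) = g ∧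
      (∀ᶠ y in 𝓝 (DescendingMetric.orbitMap b g), DescendingMetric.orbitMap b (Ψ (g, y)) = y) ∧
      ∀ v : TangentSpace 𝓘(ℝ, F) (DescendingMetric.orbitMap b g),
        ‖mfderiv 𝓘(ℝ, F) 𝓘(ℝ, E) (fun y ↦ Ψ (g, y)) (DescendingMetric.orbitMap b g) v‖ ≤ ‖v‖ := by
  obtain ⟨s, hs1, hs, hps, hn⟩ := exists_local_section hdesc 1
  have hs' : ∀ y, y = DescendingMetric.orbitMap b (1 : G) →
      s y = 1 ∧ ContMDiffAt 𝓘(ℝ, F) 𝓘(ℝ, E) ∞ s y ∧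
      ∀ v : TangentSpace 𝓘(ℝ, F) y, ‖mfderiv 𝓘(ℝ, F) 𝓘(ℝ, E) s y v‖ = ‖v‖ := by
    rintro _ rfl; exact ⟨hs1, hs, hn⟩
  have hback : ∀ g : G, MulOpposite.op g⁻¹ • DescendingMetric.orbitMap b g =
      DescendingMetric.orbitMap b (1 : G) := fun g ↦ by rw [← orbitMap_mul, mul_inv_cancel]
  refine ⟨fun q ↦ s (MulOpposite.op q.1⁻¹ • q.2) * q.1, fun g ↦ ?_⟩
  obtain ⟨e1, e2, e3⟩ := hs' _ (hback g)
  refine ⟨?_, ?_, ?_, fun v ↦ ?_⟩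
  · have h1 : ContMDiff (𝓘(ℝ, E).prod 𝓘(ℝ, F)) 𝓘(ℝ, F) ∞
        (fun q : G × B ↦ MulOpposite.op q.1⁻¹ • q.2) :=
      hact.comp (contMDiff_snd.prodMk ((contMDiff_inv 𝓘(ℝ, E) ∞).comp contMDiff_fst))
    exact (e2.comp (g, DescendingMetric.orbitMap b g) h1.contMDiffAt).mul contMDiffAt_fst
  · show s (MulOpposite.op g⁻¹ • DescendingMetric.orbitMap b g) * g = g
    rw [e1, one_mul]
  · have hc : Tendsto (fun y : B ↦ MulOpposite.op g⁻¹ • y) (𝓝 (DescendingMetric.orbitMap b g))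
        (𝓝 (DescendingMetric.orbitMap b (1 : G))) := by
      rw [← hback g]; exact (contMDiff_action hact g⁻¹).continuous.tendsto _
    filter_upwards [hc.eventually hps] with y hy
    rw [orbitMap_mul, hy, smul_smul]; simp
  · have dR : MDifferentiableAt 𝓘(ℝ, E) 𝓘(ℝ, E) (fun y : G ↦ y * g)
        (s (MulOpposite.op g⁻¹ • DescendingMetric.orbitMap b g)) :=
      (contMDiff_mul_right (I := 𝓘(ℝ, E)) (n := ∞)).mdifferentiableAt (by simp)
    have dA : MDifferentiableAt 𝓘(ℝ, F) 𝓘(ℝ, F) (fun y : B ↦ MulOpposite.op g⁻¹ • y)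
        (DescendingMetric.orbitMap b g) := (contMDiff_action hact g⁻¹).mdifferentiableAt (by simp)
    have ds := e2.mdifferentiableAt (by simp)
    have h1 := mfderiv_comp (DescendingMetric.orbitMap b g) (g := (fun y : G ↦ y * g) ∘ s)
      (dR.comp _ ds) dA
    have h2 := mfderiv_comp (MulOpposite.op g⁻¹ • DescendingMetric.orbitMap b g) dR ds
    have h3 : mfderiv 𝓘(ℝ, F) 𝓘(ℝ, E) (fun y ↦ s (MulOpposite.op g⁻¹ • y) * g)
        (DescendingMetric.orbitMap b g) v = mfderiv 𝓘(ℝ, E) 𝓘(ℝ, E) (fun y : G ↦ y * g)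
          (s (MulOpposite.op g⁻¹ • DescendingMetric.orbitMap b g))
          (mfderiv 𝓘(ℝ, F) 𝓘(ℝ, E) s (MulOpposite.op g⁻¹ • DescendingMetric.orbitMap b g)
            (mfderiv 𝓘(ℝ, F) 𝓘(ℝ, F) (fun y : B ↦ MulOpposite.op g⁻¹ • y)
              (DescendingMetric.orbitMap b g) v)) :=
      (congrArg (fun L ↦ L v) h1).trans (congrArg (fun L ↦ L (mfderiv 𝓘(ℝ, F) 𝓘(ℝ, F)
        (fun y : B ↦ MulOpposite.op g⁻¹ • y) (DescendingMetric.orbitMap b g) v)) h2)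
    refine (congrArg norm h3).trans_le ?_
    refine (norm_mfderiv_mul_right hinv _ _ _).trans_le ?_
    exact (e3 _).trans_le (norm_mfderiv_action_le hact hinv hdesc _ _ _)

variable [RegularSpace G] [IsContinuousRiemannianBundle E (fun x : G ↦ TangentSpace 𝓘(ℝ, E) x)]
  [RegularSpace B] [IsContinuousRiemannianBundle F (fun x : B ↦ TangentSpace 𝓘(ℝ, F) x)]

/-- In charts, metric geodesics over metric geodesics of the same speed solve an ordinary
differential equation with a Lipschitz right-hand side: the velocity of the projection determines
the velocity upstairs, as its horizontal lift. -/
theorem exists_horizontal_field (hact : ContMDiff (𝓘(ℝ, F).prod 𝓘(ℝ, E)) 𝓘(ℝ, F) ∞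
      (fun p : B × G ↦ MulOpposite.op p.2 • p.1))
    (hinv : DescendingMetric.IsRightInvariantMetric E G) {b : B}
    (hdesc : DescendingMetric.DescendsTo E F (DescendingMetric.orbitMap (G := G) b)) (p : G) :
    ∃ (V : E × F → F →L[ℝ] E) (K : ℝ≥0) (T : Set (E × F)),
      T ∈ 𝓝 (extChartAt 𝓘(ℝ, E) p p,
        extChartAt 𝓘(ℝ, F) (DescendingMetric.orbitMap b p) (DescendingMetric.orbitMap b p)) ∧
      LipschitzOnWith K V T ∧
      ∀ (d : ℝ) (τ : ℝ → G), IsMetricGeodesic E d τ →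
        IsMetricGeodesic F d (DescendingMetric.orbitMap b ∘ τ) → ∀ t ∈ Icc (0 : ℝ) 1,
        τ t ∈ (extChartAt 𝓘(ℝ, E) p).source →
        DescendingMetric.orbitMap b (τ t) ∈
          (extChartAt 𝓘(ℝ, F) (DescendingMetric.orbitMap b p)).source →
        (extChartAt 𝓘(ℝ, E) p (τ t), extChartAt 𝓘(ℝ, F) (DescendingMetric.orbitMap b p)
          (DescendingMetric.orbitMap b (τ t))) ∈ T →
        MDifferentiableWithinAt 𝓘(ℝ, ℝ) 𝓘(ℝ, F) (DescendingMetric.orbitMap b ∘ τ) (Icc 0 1) t →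
        ∀ v : F, HasDerivWithinAt (extChartAt 𝓘(ℝ, F) (DescendingMetric.orbitMap b p) ∘
          DescendingMetric.orbitMap b ∘ τ) v (Icc 0 1) t →
        HasDerivWithinAt (extChartAt 𝓘(ℝ, E) p ∘ τ)
          (V (extChartAt 𝓘(ℝ, E) p (τ t), extChartAt 𝓘(ℝ, F) (DescendingMetric.orbitMap b p)
            (DescendingMetric.orbitMap b (τ t))) v) (Icc 0 1) t := by
  obtain ⟨Ψ, hΨ⟩ := exists_section_family hact hinv hdesc
  set φ := extChartAt 𝓘(ℝ, E) p with hφ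
  set pr : G → B := DescendingMetric.orbitMap b with hpr
  set ψ := extChartAt 𝓘(ℝ, F) (pr p) with hψ
  -- the family of sections read in the charts, and its derivative along `B`
  let Θ : E × F → E := fun z ↦ φ (Ψ (φ.symm z.1, ψ.symm z.2))
  have hΘ : ContDiffAt ℝ 2 Θ (φ p, ψ (pr p)) := by
    obtain ⟨h1, h2, -⟩ := hΨ p
    have h3 := (contMDiffAt_iff.1 h1).2
    rw [h2] at h3
    have h4 : ContDiffAt ℝ ∞ Θ (φ p, ψ (pr p)) := by
      rw [show range (𝓘(ℝ, E).prod 𝓘(ℝ, F)) = (univ : Set (E × F)) by simp] at h3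
      exact contDiffWithinAt_univ.1 h3
    exact h4.of_le (WithTop.coe_le_coe.2 le_top)
  let V : E × F → F →L[ℝ] E := fun z ↦ (fderiv ℝ Θ z).comp (ContinuousLinearMap.inr ℝ E F)
  have hV : ContDiffAt ℝ 1 V (φ p, ψ (pr p)) :=
    (hΘ.fderiv_right (m := 1) (by norm_num)).clm_comp contDiffAt_const
  obtain ⟨K, T₁, hT₁, hK⟩ := hV.exists_lipschitzOnWith
  have hdiff : ∀ᶠ z in 𝓝 (φ p, ψ (pr p)), DifferentiableAt ℝ Θ z := by
    filter_upwards [hΘ.eventually (by simp)] with z hz using hz.differentiableAt (by simp)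
  refine ⟨V, K, T₁ ∩ {z | DifferentiableAt ℝ Θ z}, inter_mem hT₁ hdiff,
    hK.mono inter_subset_left, ?_⟩
  rintro d τ hτ hprτ t ht hts hps ⟨-, hd⟩ hη v hv
  obtain ⟨h1, h2, h3, h4⟩ := hΨ (τ t)
  set g := τ t with hg
  have hne := neBot_nhdsWithin_Icc_sdiff ht
  -- the velocity `w` of the projection, and its lift `u`
  have hL := hη.hasMFDerivWithinAt
  let w : F := mfderivWithin 𝓘(ℝ, ℝ) 𝓘(ℝ, F) (pr ∘ τ) (Icc 0 1) t (1 : ℝ)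
  obtain ⟨hcη, hdw⟩ := hasMFDerivWithinAt_curve_iff.1 hL
  have hdw' : HasDerivWithinAt (extChartAt 𝓘(ℝ, F) (pr g) ∘ pr ∘ τ) w (Icc 0 1) t :=
    HasFDerivWithinAt.hasDerivWithinAt (F := F) hdw
  let DΨ : F →L[ℝ] E := mfderiv 𝓘(ℝ, F) 𝓘(ℝ, E) (fun y ↦ Ψ (g, y)) (pr g)
  have hΨg : MDifferentiableAt 𝓘(ℝ, F) 𝓘(ℝ, E) (fun y ↦ Ψ (g, y)) (pr g) :=
    (ContMDiffAt.comp (pr g) h1 (contMDiffAt_const.prodMk contMDiffAt_id)).mdifferentiableAt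
      (by simp)
  let P : G → E →L[ℝ] F := fun x ↦ mfderiv 𝓘(ℝ, E) 𝓘(ℝ, F) pr x
  -- `DΨ` is a right inverse of the derivative of the orbit map, since `Ψ (g, ·)` is a section
  have hPΨ : ∀ y, P g (DΨ y) = y := by
    intro y
    have e1 : HasMFDerivAt 𝓘(ℝ, F) 𝓘(ℝ, F) (pr ∘ fun y ↦ Ψ (g, y)) (pr g)
        ((P (Ψ (g, pr g))).comp DΨ) :=
      HasMFDerivAt.comp (pr g) (hdesc.smooth.mdifferentiableAt (by simp)).hasMFDerivAt
        hΨg.hasMFDerivAt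
    have e2 : HasMFDerivAt 𝓘(ℝ, F) 𝓘(ℝ, F) (pr ∘ fun y ↦ Ψ (g, y)) (pr g)
        (ContinuousLinearMap.id ℝ F) := (hasMFDerivAt_id (pr g)).congr_of_eventuallyEq h3
    have e3 := hasMFDerivAt_unique e1 e2
    rw [h2] at e3
    exact congrArg (fun L : F →L[ℝ] F ↦ L y) e3
  have hwn : ‖toFiber F (pr g) w‖ = d := hprτ.norm_deriv subset_rfl ht hne hcη hdw'
  let u : E := DΨ w
  have hun : ‖toFiber E g u‖ = d := by
    refine le_antisymm ?_ ?_
    · rw [← norm_toFiber_congr h2 u, ← hwn]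
      exact h4 w
    · rw [← hwn]
      refine le_of_eq_of_le ?_ (norm_mfderiv_le_of_descendsTo hdesc g (toFiber E g u))
      exact congrArg (fun y ↦ ‖toFiber F (pr g) y‖) (hPΨ w).symm
  have hτu : HasDerivWithinAt (extChartAt 𝓘(ℝ, E) g ∘ τ) u (Icc 0 1) t :=
    hτ.hasDerivWithinAt_of_map hdesc ht hdw' (hPΨ w) hun hwn
  -- pass from the chart at `g` to the chart at `p`
  have hmτ : HasMFDerivWithinAt 𝓘(ℝ, ℝ) 𝓘(ℝ, E) τ (Icc 0 1) t
      (ContinuousLinearMap.toSpanSingleton ℝ u : ℝ →L[ℝ] E) :=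
    hasMFDerivWithinAt_curve_iff.2 ⟨hτ.continuousOn t ht, hτu.hasFDerivWithinAt⟩
  let Dφ : G → E →L[ℝ] E := fun x ↦ mfderiv 𝓘(ℝ, E) 𝓘(ℝ, E) φ x
  have hφd : ∀ x ∈ φ.source, HasMFDerivAt 𝓘(ℝ, E) 𝓘(ℝ, E) φ x (Dφ x) := fun x hx ↦
    (mdifferentiableAt_extChartAt (by simpa [φ] using hx)).hasMFDerivAt
  have hφτ : HasDerivWithinAt (φ ∘ τ) (Dφ g u) (Icc 0 1) t := by
    have e1 := (hφd g hts).comp_hasMFDerivWithinAt t hmτ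
    have e2 : HasFDerivWithinAt (F := E) (φ ∘ τ)
        ((Dφ g).comp (ContinuousLinearMap.toSpanSingleton ℝ u)) (Icc 0 1) t :=
      hasMFDerivWithinAt_iff_hasFDerivWithinAt.1 e1
    simpa using e2.hasDerivWithinAt
  -- the same for the curve which lies in the section through `g`
  have hφk : HasDerivWithinAt (φ ∘ (fun y ↦ Ψ (g, y)) ∘ pr ∘ τ) (Dφ g u) (Icc 0 1) t := by
    have e0 : HasMFDerivWithinAt 𝓘(ℝ, ℝ) 𝓘(ℝ, E) ((fun y ↦ Ψ (g, y)) ∘ pr ∘ τ) (Icc 0 1) t _ :=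
      HasMFDerivAt.comp_hasMFDerivWithinAt (g := fun y ↦ Ψ (g, y)) (f := pr ∘ τ) t
        hΨg.hasMFDerivAt hL
    have e1 : HasMFDerivWithinAt 𝓘(ℝ, ℝ) 𝓘(ℝ, E) (φ ∘ (fun y ↦ Ψ (g, y)) ∘ pr ∘ τ) (Icc 0 1) t _ :=
      HasMFDerivAt.comp_hasMFDerivWithinAt (g := φ) t (hφd (Ψ (g, pr g)) (by rwa [h2])) e0
    let L : ℝ →L[ℝ] F := mfderivWithin 𝓘(ℝ, ℝ) 𝓘(ℝ, F) (pr ∘ τ) (Icc 0 1) t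
    have e2 : HasFDerivWithinAt (F := E) (φ ∘ (fun y ↦ Ψ (g, y)) ∘ pr ∘ τ)
        ((Dφ (Ψ (g, pr g))).comp (DΨ.comp L)) (Icc 0 1) t :=
      hasMFDerivWithinAt_iff_hasFDerivWithinAt.1 e1
    have e3 : HasDerivWithinAt (φ ∘ (fun y ↦ Ψ (g, y)) ∘ pr ∘ τ) (Dφ (Ψ (g, pr g)) (DΨ w))
      (Icc 0 1) t := e2.hasDerivWithinAt
    rwa [h2] at e3
  have hφk' : HasDerivWithinAt (φ ∘ (fun y ↦ Ψ (g, y)) ∘ pr ∘ τ)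
      (V (φ g, ψ (pr g)) v) (Icc 0 1) t := by
    have e0 : HasDerivWithinAt (fun s ↦ (φ g, (ψ ∘ pr ∘ τ) s)) ((0 : E), v) (Icc 0 1) t :=
      (hasDerivWithinAt_const t _ (φ g)).prodMk hv
    have e1 : HasDerivWithinAt (Θ ∘ fun s ↦ (φ g, (ψ ∘ pr ∘ τ) s))
        (fderiv ℝ Θ (φ g, ψ (pr g)) (0, v)) (Icc 0 1) t :=
      HasFDerivAt.comp_hasDerivWithinAt t hd.hasFDerivAt e0
    refine HasDerivWithinAt.congr_of_eventuallyEq (f := Θ ∘ fun s ↦ (φ g, (ψ ∘ pr ∘ τ) s)) e1 ?_ ?_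
    · filter_upwards [hcη.eventually
        ((isOpen_extChartAt_source (I := 𝓘(ℝ, F)) (pr p)).mem_nhds hps)] with s hs
      simp only [Θ, Function.comp_apply] at hs ⊢
      rw [φ.left_inv hts, ψ.left_inv hs]
    · simp only [Θ, Function.comp_apply]
      rw [φ.left_inv hts, ψ.left_inv hps]
  rwa [← (uniqueDiffOn_Icc_zero_one t ht).eq_deriv _ hφk hφk']

end HorizontalField

/-! ### Regularity and uniqueness of lifts -/

section HorizontalCurves

variable {F : Type*} [NormedAddCommGroup F] [NormedSpace ℝ F]
  {B : Type*} [TopologicalSpace B] [ChartedSpace F B]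

/-- A `C¹` curve on `[0, 1]` has, in the chart around one of its points, a continuous velocity
nearby. -/
theorem exists_continuousOn_hasDerivWithinAt {η : ℝ → B} {t₀ : ℝ} (ht₀ : t₀ ∈ Icc (0 : ℝ) 1)
    (hη : ContMDiffWithinAt 𝓘(ℝ, ℝ) 𝓘(ℝ, F) 1 η (Icc 0 1) t₀) :
    ∃ W : ℝ → F, ∃ u ∈ 𝓝[Icc 0 1] t₀, u ⊆ Icc 0 1 ∧ ContinuousOn W u ∧ ∀ s ∈ u,
      HasDerivWithinAt (extChartAt 𝓘(ℝ, F) (η t₀) ∘ η) (W s) (Icc 0 1) s := by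
  obtain ⟨-, W, u, hu, hW, hd⟩ := (contMDiffWithinAt_curve_iff ht₀).1 hη
  refine ⟨W, (u ∩ Icc 0 1) ∩ {s | u ∈ 𝓝[Icc 0 1] s},
    inter_mem (inter_mem hu self_mem_nhdsWithin) (eventually_eventually_nhdsWithin.2 hu),
    fun s hs ↦ hs.1.2, hW.mono fun s hs ↦ hs.1.1, fun s hs ↦ ?_⟩
  exact (hd s hs.1.1).mono_of_mem_nhdsWithin hs.2

theorem IsMetricGeodesic.eventually_mem
    {E : Type*} [NormedAddCommGroup E] [NormedSpace ℝ E]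
    {M : Type*} [TopologicalSpace M] [ChartedSpace E M] [RegularSpace M] [IsManifold 𝓘(ℝ, E) 1 M]
    [RiemannianBundle (fun x : M ↦ TangentSpace 𝓘(ℝ, E) x)]
    [IsContinuousRiemannianBundle E (fun x : M ↦ TangentSpace 𝓘(ℝ, E) x)] {d : ℝ} {τ : ℝ → M}
    (hτ : IsMetricGeodesic E d τ) {p : M → B} (hp : Continuous p) {t₀ : ℝ}
    (ht₀ : t₀ ∈ Icc (0 : ℝ) 1) {T : Set (E × F)} (hT : T ∈ 𝓝 (extChartAt 𝓘(ℝ, E) (τ t₀) (τ t₀),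
      extChartAt 𝓘(ℝ, F) (p (τ t₀)) (p (τ t₀)))) :
    ∀ᶠ s in 𝓝[Icc 0 1] t₀, τ s ∈ (extChartAt 𝓘(ℝ, E) (τ t₀)).source ∧
      p (τ s) ∈ (extChartAt 𝓘(ℝ, F) (p (τ t₀))).source ∧
      (extChartAt 𝓘(ℝ, E) (τ t₀) (τ s), extChartAt 𝓘(ℝ, F) (p (τ t₀)) (p (τ s))) ∈ T := by
  have hc : Tendsto τ (𝓝[Icc 0 1] t₀) (𝓝 (τ t₀)) := hτ.continuousOn t₀ ht₀
  have hc' : Tendsto (fun s ↦ p (τ s)) (𝓝[Icc 0 1] t₀) (𝓝 (p (τ t₀))) :=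
    (hp.tendsto (τ t₀)).comp hc
  exact (hc.eventually (extChartAt_source_mem_nhds (I := 𝓘(ℝ, E)) (τ t₀))).and
    ((hc'.eventually (extChartAt_source_mem_nhds (I := 𝓘(ℝ, F)) (p (τ t₀)))).and
      ((((continuousAt_extChartAt (τ t₀)).tendsto.comp hc).prodMk_nhds
        ((continuousAt_extChartAt (p (τ t₀))).tendsto.comp hc')).eventually hT))

variable [FiniteDimensional ℝ F] [IsManifold 𝓘(ℝ, F) ∞ B] [RegularSpace B]
  [RiemannianBundle (fun x : B ↦ TangentSpace 𝓘(ℝ, F) x)]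
  [IsContinuousRiemannianBundle F (fun x : B ↦ TangentSpace 𝓘(ℝ, F) x)]
  {E : Type*} [NormedAddCommGroup E] [NormedSpace ℝ E] [FiniteDimensional ℝ E]
  {G : Type*} [TopologicalSpace G] [ChartedSpace E G] [Group G] [LieGroup 𝓘(ℝ, E) ∞ G]
  [RegularSpace G] [RiemannianBundle (fun x : G ↦ TangentSpace 𝓘(ℝ, E) x)]
  [IsContinuousRiemannianBundle E (fun x : G ↦ TangentSpace 𝓘(ℝ, E) x)]
  [MulAction Gᵐᵒᵖ B] [MulAction.IsPretransitive Gᵐᵒᵖ B]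

/-- Lifts of `C¹` curves are `C¹`: their velocity is a continuous function of the position and of
the velocity of the projection. -/
theorem IsMetricGeodesic.contMDiffOn_of_map (hact : ContMDiff (𝓘(ℝ, F).prod 𝓘(ℝ, E)) 𝓘(ℝ, F) ∞
      (fun p : B × G ↦ MulOpposite.op p.2 • p.1))
    (hinv : DescendingMetric.IsRightInvariantMetric E G) {b : B}
    (hdesc : DescendingMetric.DescendsTo E F (DescendingMetric.orbitMap (G := G) b))
    {d : ℝ} {τ : ℝ → G} (hτ : IsMetricGeodesic E d τ)
    (hbτ : IsMetricGeodesic F d (DescendingMetric.orbitMap b ∘ τ))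
    (hs : ContMDiffOn 𝓘(ℝ, ℝ) 𝓘(ℝ, F) 1 (DescendingMetric.orbitMap b ∘ τ) (Icc 0 1)) :
    ContMDiffOn 𝓘(ℝ, ℝ) 𝓘(ℝ, E) 1 τ (Icc 0 1) := by
  intro t₀ ht₀
  obtain ⟨V, K, T, hT, hK, hV⟩ := exists_horizontal_field hact hinv hdesc (τ t₀)
  obtain ⟨W, u, hu, huI, hWc, hW⟩ := exists_continuousOn_hasDerivWithinAt ht₀ (hs t₀ ht₀)
  have hgood := hτ.eventually_mem hdesc.smooth.continuous ht₀ hT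
  let A : Set ℝ := u ∩ {s | τ s ∈ (extChartAt 𝓘(ℝ, E) (τ t₀)).source ∧
      DescendingMetric.orbitMap b (τ s) ∈
        (extChartAt 𝓘(ℝ, F) (DescendingMetric.orbitMap b (τ t₀))).source ∧
      (extChartAt 𝓘(ℝ, E) (τ t₀) (τ s), extChartAt 𝓘(ℝ, F) (DescendingMetric.orbitMap b (τ t₀))
        (DescendingMetric.orbitMap b (τ s))) ∈ T}
  have hAI : A ⊆ Icc 0 1 := fun s h ↦ huI h.1
  have hder : ∀ s ∈ A, HasDerivWithinAt (extChartAt 𝓘(ℝ, E) (τ t₀) ∘ τ)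
      (V (extChartAt 𝓘(ℝ, E) (τ t₀) (τ s), extChartAt 𝓘(ℝ, F) (DescendingMetric.orbitMap b (τ t₀))
        (DescendingMetric.orbitMap b (τ s))) (W s)) (Icc 0 1) s := fun s h ↦
    hV d τ hτ hbτ s (hAI h) h.2.1 h.2.2.1 h.2.2.2
      ((hs s (hAI h)).mdifferentiableWithinAt (by simp)) (W s) (hW s h.1)
  refine (contMDiffWithinAt_curve_iff ht₀).2 ⟨hτ.continuousOn t₀ ht₀, _, A, inter_mem hu hgood, ?_,
    fun s h ↦ (hder s h).mono hAI⟩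
  refine ContinuousOn.clm_apply (hK.continuousOn.comp (fun s h ↦ ?_) fun s h ↦ h.2.2.2)
    (hWc.mono inter_subset_left)
  exact ((hder s h).continuousWithinAt.mono hAI).prodMk
    ((hW s h.1).continuousWithinAt.mono hAI)

/-- Two lifts of the same `C¹` metric geodesic, with the same speed, which start at the same point
agree: the set of times where they agree is closed, and it is open to the right by uniqueness of the
solutions of an ordinary differential equation. -/
theorem IsMetricGeodesic.eqOn_of_map [T2Space G]
    (hact : ContMDiff (𝓘(ℝ, F).prod 𝓘(ℝ, E)) 𝓘(ℝ, F) ∞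
      (fun p : B × G ↦ MulOpposite.op p.2 • p.1))
    (hinv : DescendingMetric.IsRightInvariantMetric E G) {b : B}
    (hdesc : DescendingMetric.DescendsTo E F (DescendingMetric.orbitMap (G := G) b))
    {d : ℝ} {η : ℝ → B} (hη : IsMetricGeodesic F d η)
    (hs : ContMDiffOn 𝓘(ℝ, ℝ) 𝓘(ℝ, F) 1 η (Icc 0 1)) {τ σ : ℝ → G}
    (hτ : IsMetricGeodesic E d τ) (hσ : IsMetricGeodesic E d σ)
    (hτη : ∀ t ∈ Icc (0 : ℝ) 1, DescendingMetric.orbitMap b (τ t) = η t)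
    (hση : ∀ t ∈ Icc (0 : ℝ) 1, DescendingMetric.orbitMap b (σ t) = η t) (h0 : τ 0 = σ 0) :
    EqOn τ σ (Icc 0 1) := by
  have hclosed : IsClosed ({t | τ t = σ t} ∩ Icc 0 1) := by
    have := (hτ.continuousOn.prodMk hσ.continuousOn).preimage_isClosed_of_isClosed isClosed_Icc
      (isClosed_diagonal (X := G))
    rwa [inter_comm] at this
  refine hclosed.Icc_subset_of_forall_mem_nhdsWithin h0 ?_
  rintro t₀ ⟨ht₀, hI⟩
  have hI' : t₀ ∈ Icc (0 : ℝ) 1 := Ico_subset_Icc_self hI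
  replace ht₀ : τ t₀ = σ t₀ := ht₀
  obtain ⟨V, K, T, hT, hK, hV⟩ := exists_horizontal_field hact hinv hdesc (τ t₀)
  obtain ⟨W, u, hu, huI, hWc, hW⟩ := exists_continuousOn_hasDerivWithinAt hI' (hs t₀ hI')
  rw [← hτη t₀ hI'] at hW
  have hgτ := hτ.eventually_mem hdesc.smooth.continuous hI' hT
  have hgσ := hσ.eventually_mem (p := DescendingMetric.orbitMap b) hdesc.smooth.continuous hI'
    (by rw [← ht₀]; exact hT)
  rw [← ht₀] at hgσ
  set φ := extChartAt 𝓘(ℝ, E) (τ t₀) with hφ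
  set ψ := extChartAt 𝓘(ℝ, F) (DescendingMetric.orbitMap b (τ t₀)) with hψ
  have hWb : ∀ᶠ s in 𝓝[Icc 0 1] t₀, ‖W s‖ < ‖W t₀‖ + 1 := by
    have h1 : ContinuousWithinAt W (Icc 0 1) t₀ :=
      (hWc t₀ (mem_of_mem_nhdsWithin hI' hu)).mono_of_mem_nhdsWithin hu
    exact h1.norm.eventually_lt_const (lt_add_one _)
  obtain ⟨c, hc, hcA⟩ : ∃ c ∈ Ioc t₀ 1, ∀ s ∈ Icc t₀ c, s ∈ u ∧ ‖W s‖ < ‖W t₀‖ + 1 ∧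
      (τ s ∈ φ.source ∧ DescendingMetric.orbitMap b (τ s) ∈ ψ.source ∧
        (φ (τ s), ψ (DescendingMetric.orbitMap b (τ s))) ∈ T) ∧
      (σ s ∈ φ.source ∧ DescendingMetric.orbitMap b (σ s) ∈ ψ.source ∧
        (φ (σ s), ψ (DescendingMetric.orbitMap b (σ s))) ∈ T) := by
    have h1 : Icc (0 : ℝ) 1 ∈ 𝓝[≥] t₀ := Icc_mem_nhdsGE_of_mem hI
    have h2 := ((show ∀ᶠ s in 𝓝[Icc 0 1] t₀, s ∈ u from hu).and
      (hWb.and (hgτ.and hgσ))).filter_mono (nhdsWithin_le_of_mem h1)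
    obtain ⟨c, hc, hcA⟩ := (mem_nhdsGE_iff_exists_mem_Ioc_Ico_subset hI.2).1 h2
    refine ⟨(t₀ + c) / 2, ⟨by linarith [hc.1], by linarith [hc.1, hc.2]⟩, fun s hs ↦ hcA ⟨hs.1, ?_⟩⟩
    have h1 := hs.2
    have h2 := hc.1
    linarith
  have hcI : ∀ s ∈ Icc t₀ c, s ∈ Icc (0 : ℝ) 1 := fun s hs ↦
    ⟨hI.1.trans hs.1, hs.2.trans hc.2⟩
  have hlift : ∀ ρ : ℝ → G, IsMetricGeodesic E d ρ →
      (∀ t ∈ Icc (0 : ℝ) 1, DescendingMetric.orbitMap b (ρ t) = η t) →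
      ∀ s ∈ Icc t₀ c, (ρ s ∈ φ.source ∧ DescendingMetric.orbitMap b (ρ s) ∈ ψ.source ∧
        (φ (ρ s), ψ (DescendingMetric.orbitMap b (ρ s))) ∈ T) →
      HasDerivWithinAt (φ ∘ ρ) (V (φ (ρ s), ψ (η s)) (W s)) (Icc 0 1) s := by
    intro ρ hρ hρη s hs' h
    have hsI := hcI s hs'
    have := hV d ρ hρ (hη.congr fun t ht ↦ (hρη t ht).symm) s hsI h.1 h.2.1 h.2.2
      (((hs s hsI).congr hρη (hρη s hsI)).mdifferentiableWithinAt (by simp)) (W s)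
      (HasDerivWithinAt.congr (f := ψ ∘ η) (hW s (hcA s hs').1)
        (fun t ht ↦ congrArg ψ (hρη t ht)) (congrArg ψ (hρη s hsI)))
    rwa [hρη s hsI] at this
  have hdτ := fun s hs ↦ hlift τ hτ hτη s hs (hcA s hs).2.2.1
  have hdσ := fun s hs ↦ hlift σ hσ hση s hs (hcA s hs).2.2.2
  have hnhds : ∀ s ∈ Ico t₀ c, Icc (0 : ℝ) 1 ∈ 𝓝[≥] s := fun s hs ↦
    Icc_mem_nhdsGE_of_mem ⟨hI.1.trans hs.1, hs.2.trans_le hc.2⟩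
  have hmem : ∀ ρ : ℝ → G, (∀ t ∈ Icc (0 : ℝ) 1, DescendingMetric.orbitMap b (ρ t) = η t) →
      ∀ s ∈ Icc t₀ c, (φ (ρ s), ψ (DescendingMetric.orbitMap b (ρ s))) ∈ T →
      φ (ρ s) ∈ {x | (x, ψ (η s)) ∈ T} := by
    intro ρ hρη s hs' h
    rwa [hρη s (hcI s hs')] at h
  -- both curves solve the equation `x' = V (x, ψ (η s)) (W s)`, whose right-hand side is Lipschitz
  -- in `x` with constant `K * (‖W t₀‖ + 1)`
  have heq : EqOn (φ ∘ τ) (φ ∘ σ) (Icc t₀ c) := by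
    refine ODE_solution_unique_of_mem_Icc_right (v := fun s x ↦ V (x, ψ (η s)) (W s))
      (s := fun s ↦ {x | (x, ψ (η s)) ∈ T}) (K := K * (‖W t₀‖₊ + 1)) ?_
      (fun s h ↦ (hdτ s h).continuousWithinAt.mono hcI)
      (fun s h ↦ (hdτ s (Ico_subset_Icc_self h)).mono_of_mem_nhdsWithin (hnhds s h))
      (fun s h ↦ hmem τ hτη s (Ico_subset_Icc_self h) (hcA s (Ico_subset_Icc_self h)).2.2.1.2.2)
      (fun s h ↦ (hdσ s h).continuousWithinAt.mono hcI)
      (fun s h ↦ (hdσ s (Ico_subset_Icc_self h)).mono_of_mem_nhdsWithin (hnhds s h))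
      (fun s h ↦ hmem σ hση s (Ico_subset_Icc_self h) (hcA s (Ico_subset_Icc_self h)).2.2.2.2.2)
      (congrArg φ ht₀)
    intro s hs'
    refine LipschitzOnWith.of_dist_le_mul fun x hx y hy ↦ ?_
    have h1 := hK.dist_le_mul _ hx _ hy
    rw [dist_eq_norm, ← sub_apply]
    refine (ContinuousLinearMap.le_opNorm _ _).trans ?_
    rw [dist_eq_norm] at h1
    have h2 : dist (x, ψ (η s)) (y, ψ (η s)) = dist x y := by simp [Prod.dist_eq]
    rw [h2] at h1
    have h3 := (hcA s (Ico_subset_Icc_self hs')).2.1.le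
    push_cast
    calc _ ≤ K * dist x y * (‖W t₀‖ + 1) := by gcongr
      _ = _ := by ring
  refine mem_of_superset (Icc_mem_nhdsGT hc.1) fun s hs' ↦ ?_
  exact φ.injOn (hcA s hs').2.2.1.1 (hcA s hs').2.2.2.1 (heq hs')

end HorizontalCurves

/-! ### Factorizations -/

section Factorization

variable {G : Type*} [Group G] {B : Type*} [MulAction Gᵐᵒᵖ B] [MulAction.IsPretransitive Gᵐᵒᵖ B]

/-- Each fibre of the orbit map contains exactly one point of `K` if and only if each group element
has a unique factorization with factors in the isotropy group and in `K`. The predicate `Q` is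
carried along for these points. -/
theorem existsUnique_transport_iff_factorization {b : B} {K : Set G} {Q : G → Prop} :
    (∀ b' : B, ∃ T : G, ((DescendingMetric.orbitMap b T = b' ∧ T ∈ K) ∧
      ∀ S : G, DescendingMetric.orbitMap b S = b' ∧ S ∈ K → S = T) ∧ Q T) ↔
    (∀ g : G, ∃! p : G × G, p.1 ∈ DescendingMetric.isotropy G b ∧ p.2 ∈ K ∧ g = p.1 * p.2) ∧
      ∀ k ∈ K, Q k := by
  have hfac : ∀ g k : G, DescendingMetric.orbitMap b k = DescendingMetric.orbitMap b g →
      g * k⁻¹ ∈ DescendingMetric.isotropy G b := fun g k h ↦ by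
    show DescendingMetric.orbitMap b (g * k⁻¹) = b
    rw [orbitMap_mul, ← h, ← orbitMap_mul, mul_inv_cancel, orbitMap_one]
  have hmul : ∀ h k : G, h ∈ DescendingMetric.isotropy G b →
      DescendingMetric.orbitMap b (h * k) = DescendingMetric.orbitMap b k := fun h k hh ↦ by
    rw [orbitMap_mul, show DescendingMetric.orbitMap b h = b from hh]; rfl
  constructor
  · intro H
    refine ⟨fun g ↦ ?_, fun k hk ↦ ?_⟩
    · obtain ⟨T, ⟨⟨hT, hTK⟩, huniq⟩, -⟩ := H (DescendingMetric.orbitMap b g)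
      refine ⟨(g * T⁻¹, T), ⟨hfac g T hT, hTK, by simp⟩, ?_⟩
      rintro ⟨h, k⟩ ⟨hh, hk, rfl⟩
      obtain rfl : k = T := huniq k ⟨(hmul h k hh).symm, hk⟩
      simp
    · obtain ⟨T, ⟨-, huniq⟩, hQ⟩ := H (DescendingMetric.orbitMap b k)
      rwa [huniq k ⟨rfl, hk⟩]
  · rintro ⟨H, hQ⟩ b'
    obtain ⟨g, rfl⟩ := exists_orbitMap_eq (G := G) b b'
    obtain ⟨⟨h, k⟩, ⟨hh, hk, hg⟩, huniq⟩ := H g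
    refine ⟨k, ⟨⟨?_, hk⟩, fun S hS ↦ ?_⟩, hQ k hk⟩
    · rw [hg]; exact (hmul h k hh).symm
    · have := huniq (g * S⁻¹, S) ⟨hfac g S hS.1, hS.2, by simp⟩
      exact congrArg Prod.snd this

end Factorization

/-! ### Optimal transport and minimal geodesics -/

theorem isContinuousRiemannianBundle_tangentSpace
    {E : Type*} [NormedAddCommGroup E] [NormedSpace ℝ E]
    {M : Type*} [TopologicalSpace M] [ChartedSpace E M] [IsManifold 𝓘(ℝ, E) 1 M]
    [RiemannianBundle (fun x : M ↦ TangentSpace 𝓘(ℝ, E) x)]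
    [h : IsContMDiffRiemannianBundle 𝓘(ℝ, E) ∞ E (fun x : M ↦ TangentSpace 𝓘(ℝ, E) x)] :
    IsContinuousRiemannianBundle E (fun x : M ↦ TangentSpace 𝓘(ℝ, E) x) := by
  obtain ⟨g, hg, h⟩ := h.exists_contMDiff
  exact ⟨g, hg.continuous, h⟩

section Transport

variable {E : Type*} [NormedAddCommGroup E] [NormedSpace ℝ E] [FiniteDimensional ℝ E]
  {G : Type*} [TopologicalSpace G] [ChartedSpace E G] [Group G]
  [RiemannianBundle (fun x : G ↦ TangentSpace 𝓘(ℝ, E) x)]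
  {F : Type*} [NormedAddCommGroup F] [NormedSpace ℝ F]
  {B : Type*} [TopologicalSpace B] [ChartedSpace F B]
  [RiemannianBundle (fun x : B ↦ TangentSpace 𝓘(ℝ, F) x)] [MulAction Gᵐᵒᵖ B]

/-- A metric geodesic in `G` whose endpoints are no farther apart than their projections projects to
a metric geodesic. -/
theorem IsMetricGeodesic.orbitMap_comp {b : B}
    (hdesc : DescendingMetric.DescendsTo E F (DescendingMetric.orbitMap (G := G) b)) {d : ℝ}
    {τ : ℝ → G} (hτ : IsMetricGeodesic E d τ)
    (hd : ENNReal.ofReal d ≤ riemannianEDist 𝓘(ℝ, F) (DescendingMetric.orbitMap b (τ 0))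
      (DescendingMetric.orbitMap b (τ 1))) :
    IsMetricGeodesic F d (DescendingMetric.orbitMap b ∘ τ) := by
  refine isMetricGeodesic_of_le hτ.1 (fun s hs t ht hst ↦ ?_) hd
  refine (riemannianEDist_orbitMap_le hdesc (τ s) (τ t)).trans_eq ?_
  rw [hτ.2 s hs t ht, abs_of_nonneg (sub_nonneg.2 hst)]

variable [LieGroup 𝓘(ℝ, E) ∞ G] [MulAction.IsPretransitive Gᵐᵒᵖ B]

theorem IsMinGeodesic.action (hact : ContMDiff (𝓘(ℝ, F).prod 𝓘(ℝ, E)) 𝓘(ℝ, F) ∞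
      (fun p : B × G ↦ MulOpposite.op p.2 • p.1))
    (hinv : DescendingMetric.IsRightInvariantMetric E G) {b : B}
    (hdesc : DescendingMetric.DescendsTo E F (DescendingMetric.orbitMap (G := G) b)) {x y : B}
    {f : ℝ → B} (hf : IsMinGeodesic F x y f) (g : Gᵐᵒᵖ) :
    IsMinGeodesic F (g • x) (g • y) (fun t ↦ g • f t) := by
  obtain ⟨d, hd⟩ := hf.exists_isMetricGeodesic
  refine ⟨by rw [hf.map_zero], by rw [hf.map_one], ?_, d, hd.1, fun s hs t ht ↦ ?_⟩
  · exact ((contMDiff_action hact g.unop).of_le (by simp)).comp_contMDiffOn hf.contMDiffOn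
  · rw [riemannianEDist_action hact hinv hdesc, hd.2 s hs t ht]

variable [RegularSpace B] [IsManifold 𝓘(ℝ, F) ∞ B]
  [IsContinuousRiemannianBundle F (fun x : B ↦ TangentSpace 𝓘(ℝ, F) x)]

theorem hasUniqueMinimalGeodesic_action (hact : ContMDiff (𝓘(ℝ, F).prod 𝓘(ℝ, E)) 𝓘(ℝ, F) ∞
      (fun p : B × G ↦ MulOpposite.op p.2 • p.1))
    (hinv : DescendingMetric.IsRightInvariantMetric E G) {b : B}
    (hdesc : DescendingMetric.DescendsTo E F (DescendingMetric.orbitMap (G := G) b)) {x y : B}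
    (h : DescendingMetric.HasUniqueMinimalGeodesic F x y) (g : Gᵐᵒᵖ) :
    DescendingMetric.HasUniqueMinimalGeodesic F (g • x) (g • y) := by
  rw [hasUniqueMinimalGeodesic_iff] at h ⊢
  obtain ⟨⟨f, hf⟩, huniq⟩ := h
  refine ⟨⟨_, hf.action hact hinv hdesc g⟩, fun f₁ f₂ h₁ h₂ t ht ↦ ?_⟩
  have e₁ := h₁.action hact hinv hdesc g⁻¹
  have e₂ := h₂.action hact hinv hdesc g⁻¹
  rw [inv_smul_smul, inv_smul_smul] at e₁ e₂
  exact smul_left_cancel g⁻¹ (huniq _ _ e₁ e₂ ht)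

variable [IsContinuousRiemannianBundle E (fun x : G ↦ TangentSpace 𝓘(ℝ, E) x)]
  [FiniteDimensional ℝ F]

/-- The distance of a point to a fibre is the distance of the projections. -/
theorem forall_le_riemannianEDist_iff (hact : ContMDiff (𝓘(ℝ, F).prod 𝓘(ℝ, E)) 𝓘(ℝ, F) ∞
      (fun p : B × G ↦ MulOpposite.op p.2 • p.1))
    (hinv : DescendingMetric.IsRightInvariantMetric E G) {b : B}
    (hdesc : DescendingMetric.DescendsTo E F (DescendingMetric.orbitMap (G := G) b)) (x : G) (y : B)
    (c : ℝ≥0∞) :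
    (∀ z : G, DescendingMetric.orbitMap b z = y → c ≤ riemannianEDist 𝓘(ℝ, E) x z) ↔
      c ≤ riemannianEDist 𝓘(ℝ, F) (DescendingMetric.orbitMap b x) y := by
  constructor
  · intro h
    by_contra! hlt
    obtain ⟨z, hz, hxz⟩ := exists_lift_lt hact hinv hdesc hlt
    exact absurd (h z hz) (not_le.2 hxz)
  · rintro h z rfl
    exact h.trans (riemannianEDist_orbitMap_le hdesc x z)

/-- The polar cone consists of the `k` which are as far from `1` as their projections are apart. -/
theorem mem_polarCone_iff (hact : ContMDiff (𝓘(ℝ, F).prod 𝓘(ℝ, E)) 𝓘(ℝ, F) ∞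
      (fun p : B × G ↦ MulOpposite.op p.2 • p.1))
    (hinv : DescendingMetric.IsRightInvariantMetric E G) {b : B}
    (hdesc : DescendingMetric.DescendsTo E F (DescendingMetric.orbitMap (G := G) b)) {k : G} :
    k ∈ DescendingMetric.polarCone E G b ↔ riemannianEDist 𝓘(ℝ, E) 1 k =
      riemannianEDist 𝓘(ℝ, F) b (DescendingMetric.orbitMap b k) := by
  have h1 := riemannianEDist_orbitMap_le hdesc 1 k
  rw [orbitMap_one] at h1
  have h2 := forall_le_riemannianEDist_iff hact hinv hdesc k b (riemannianEDist 𝓘(ℝ, E) 1 k)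
  rw [riemannianEDist_comm (x := DescendingMetric.orbitMap b k)] at h2
  simp only [riemannianEDist_comm (x := k)] at h2
  rw [← h1.ge_iff_eq', ← h2]
  rfl

/-- The optimal transports to `b'` are the points of the polar cone over `b'`. -/
theorem isOptimalTransport_iff (hact : ContMDiff (𝓘(ℝ, F).prod 𝓘(ℝ, E)) 𝓘(ℝ, F) ∞
      (fun p : B × G ↦ MulOpposite.op p.2 • p.1))
    (hinv : DescendingMetric.IsRightInvariantMetric E G) {b : B}
    (hdesc : DescendingMetric.DescendsTo E F (DescendingMetric.orbitMap (G := G) b)) {b' : B}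
    {T : G} :
    DescendingMetric.IsOptimalTransport (fun x y : G ↦ DescendingMetric.dist (E := E) x y ^ 2)
      b b' T ↔ DescendingMetric.orbitMap b T = b' ∧ T ∈ DescendingMetric.polarCone E G b := by
  refine and_congr_right ?_
  rintro rfl
  have h1 := riemannianEDist_orbitMap_le hdesc 1 T
  have h2 := forall_le_riemannianEDist_iff hact hinv hdesc 1 (DescendingMetric.orbitMap b T)
    (riemannianEDist 𝓘(ℝ, E) 1 T)
  rw [orbitMap_one] at h1 h2
  rw [mem_polarCone_iff hact hinv hdesc, ← h1.ge_iff_eq', ← h2]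
  exact forall₂_congr fun S _ ↦ ENNReal.pow_le_pow_left_iff two_ne_zero

variable [T2Space G] [RegularSpace G] [T2Space B]

/-- A minimal geodesic from `b` to `b'` lifts to a minimal geodesic from `1` to a point of the polar
cone. -/
theorem IsMinGeodesic.exists_lift (hact : ContMDiff (𝓘(ℝ, F).prod 𝓘(ℝ, E)) 𝓘(ℝ, F) ∞
      (fun p : B × G ↦ MulOpposite.op p.2 • p.1))
    (hinv : DescendingMetric.IsRightInvariantMetric E G) {b : B}
    (hdesc : DescendingMetric.DescendsTo E F (DescendingMetric.orbitMap (G := G) b)) {b' : B}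
    {η : ℝ → B} (hη : IsMinGeodesic F b b' η) :
    ∃ (T : G) (σ : ℝ → G), IsMinGeodesic E 1 T σ ∧
      (∀ t ∈ Icc (0 : ℝ) 1, DescendingMetric.orbitMap b (σ t) = η t) ∧
      DescendingMetric.orbitMap b T = b' ∧ T ∈ DescendingMetric.polarCone E G b := by
  obtain ⟨d, hd⟩ := hη.exists_isMetricGeodesic
  obtain ⟨σ, h0, hση, hσ⟩ := RiemannianDescent.exists_lift hact hinv hdesc hd
    hη.contMDiffOn.continuousOn hη.map_zero
  have h1 : DescendingMetric.orbitMap b (σ 1) = b' := by rw [hση 1 (by simp), hη.map_one]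
  refine ⟨σ 1, σ, ⟨h0, rfl, ?_, d, hσ⟩, hση, h1, ?_⟩
  · exact hσ.contMDiffOn_of_map hact hinv hdesc (hd.congr fun t ht ↦ (hση t ht).symm)
      (hη.contMDiffOn.congr hση)
  · rw [mem_polarCone_iff hact hinv hdesc, h1, ← h0, hσ.edist_zero_one, ← hd.edist_zero_one,
      hη.map_zero, hη.map_one]

/-- Unique minimal geodesics in the quotient from unique optimal transport: minimal geodesics are
projections of minimal geodesics from `1` to the optimal `T`. -/
theorem hasUniqueMinimalGeodesic_of_transport
    (hact : ContMDiff (𝓘(ℝ, F).prod 𝓘(ℝ, E)) 𝓘(ℝ, F) ∞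
      (fun p : B × G ↦ MulOpposite.op p.2 • p.1))
    (hinv : DescendingMetric.IsRightInvariantMetric E G) {b : B}
    (hdesc : DescendingMetric.DescendsTo E F (DescendingMetric.orbitMap (G := G) b)) {b' : B}
    {T : G} (hT : DescendingMetric.orbitMap b T = b' ∧ T ∈ DescendingMetric.polarCone E G b)
    (huniq : ∀ S : G, DescendingMetric.orbitMap b S = b' ∧ S ∈ DescendingMetric.polarCone E G b →
      S = T) (hgeo : DescendingMetric.HasUniqueMinimalGeodesic E (1 : G) T) :
    DescendingMetric.HasUniqueMinimalGeodesic F b b' := by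
  rw [hasUniqueMinimalGeodesic_iff] at hgeo ⊢
  obtain ⟨⟨ζ, hζ⟩, hζu⟩ := hgeo
  refine ⟨⟨DescendingMetric.orbitMap b ∘ ζ, ?_, ?_, ?_, ?_⟩, fun η₁ η₂ h₁ h₂ t ht ↦ ?_⟩
  · simp [hζ.map_zero, orbitMap_one]
  · simp [hζ.map_one, hT.1]
  · exact (hdesc.smooth.of_le (by simp)).comp_contMDiffOn hζ.contMDiffOn
  · obtain ⟨d, hd⟩ := hζ.exists_isMetricGeodesic
    refine ⟨d, hd.orbitMap_comp hdesc ?_⟩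
    rw [← hd.edist_zero_one, hζ.map_zero, hζ.map_one, orbitMap_one]
    exact ((mem_polarCone_iff hact hinv hdesc).1 hT.2).le
  · obtain ⟨T₁, σ₁, hσ₁, e₁, hT₁⟩ := h₁.exists_lift hact hinv hdesc
    obtain ⟨T₂, σ₂, hσ₂, e₂, hT₂⟩ := h₂.exists_lift hact hinv hdesc
    rw [huniq T₁ hT₁] at hσ₁
    rw [huniq T₂ hT₂] at hσ₂
    rw [← e₁ t ht, ← e₂ t ht, hζu σ₁ σ₂ hσ₁ hσ₂ ht]

/-- Unique optimal transport from unique minimal geodesics in the quotient: an optimal `S` is joined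
to `1` by a metric geodesic, which projects to a metric geodesic in the quotient, hence to the
unique minimal geodesic `η`, so that it is the unique horizontal lift of `η`. -/
theorem exists_transport_of_hasUniqueMinimalGeodesic
    (hact : ContMDiff (𝓘(ℝ, F).prod 𝓘(ℝ, E)) 𝓘(ℝ, F) ∞
      (fun p : B × G ↦ MulOpposite.op p.2 • p.1))
    (hinv : DescendingMetric.IsRightInvariantMetric E G) {b : B}
    (hdesc : DescendingMetric.DescendsTo E F (DescendingMetric.orbitMap (G := G) b))
    (H : ∀ x y : B, DescendingMetric.HasUniqueMinimalGeodesic F x y) (b' : B) :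
    ∃ T : G, ((DescendingMetric.orbitMap b T = b' ∧ T ∈ DescendingMetric.polarCone E G b) ∧
      ∀ S : G, DescendingMetric.orbitMap b S = b' ∧ S ∈ DescendingMetric.polarCone E G b → S = T) ∧
      DescendingMetric.HasUniqueMinimalGeodesic E (1 : G) T := by
  simp only [hasUniqueMinimalGeodesic_iff] at H ⊢
  obtain ⟨⟨η, hη⟩, huniq⟩ := H b b'
  obtain ⟨T, σ, hσ, hση, hT⟩ := hη.exists_lift hact hinv hdesc
  have hηd := hη.isMetricGeodesic
  set d := (riemannianEDist 𝓘(ℝ, F) b b').toReal with hd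
  have hdd : ENNReal.ofReal d = riemannianEDist 𝓘(ℝ, F) b b' :=
    ENNReal.ofReal_toReal hη.edist_ne_top
  have hdist : ∀ S : G, DescendingMetric.orbitMap b S = b' ∧
      S ∈ DescendingMetric.polarCone E G b → riemannianEDist 𝓘(ℝ, E) 1 S = ENNReal.ofReal d := by
    rintro S ⟨rfl, hS⟩
    rw [hdd, (mem_polarCone_iff hact hinv hdesc).1 hS]
  have hσd := hσ.isMetricGeodesic
  rw [hdist T hT, ENNReal.toReal_ofReal hηd.1] at hσd
  -- all metric geodesics from `1` to the fibre with the right speed agree with `σ`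
  have key : ∀ ρ : ℝ → G, IsMetricGeodesic E d ρ → ρ 0 = 1 →
      DescendingMetric.orbitMap b (ρ 1) = b' → EqOn ρ σ (Icc 0 1) := by
    intro ρ hρ h0 h1
    have e0 : DescendingMetric.orbitMap b (ρ 0) = b := by rw [h0, orbitMap_one]
    have hbρ := hρ.orbitMap_comp hdesc (by rw [e0, h1, hdd])
    have hρη := hbρ.eqOn_of_unique (fun x y ↦ (H x y).1) (fun f hf ↦ huniq f η hf hη) e0 h1
    exact hηd.eqOn_of_map hact hinv hdesc hη.contMDiffOn hρ hσd hρη hση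
      (h0.trans hσ.map_zero.symm)
  refine ⟨T, ⟨hT, fun S hS ↦ ?_⟩, ⟨σ, hσ⟩, fun f g hf hg ↦ ?_⟩
  · obtain ⟨ρ, h0, h1, hρ⟩ := exists_isMetricGeodesic hinv hηd.1 (hdist S hS)
    rw [← h1, ← hσ.map_one]
    exact key ρ hρ h0 (by rw [h1, hS.1]) (by simp)
  · have key' : ∀ f, IsMinGeodesic E 1 T f → EqOn f σ (Icc 0 1) := by
      intro f hf
      have hfd := hf.isMetricGeodesic
      rw [hdist T hT, ENNReal.toReal_ofReal hηd.1] at hfd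
      exact key f hfd hf.map_zero (by rw [hf.map_one, hT.1])
    exact (key' f hf).trans (key' g hg).symm

end Transport

end RiemannianDescent

end

theorem proposition5p2
    {E : Type*} [NormedAddCommGroup E] [NormedSpace ℝ E] [FiniteDimensional ℝ E]
    {F : Type*} [NormedAddCommGroup F] [NormedSpace ℝ F] [FiniteDimensional ℝ F]
    -- a Lie group `G` with a smooth Riemannian metric
    {G : Type*} [TopologicalSpace G] [ChartedSpace E G] [T2Space G] [Group G]
    [LieGroup 𝓘(ℝ, E) ∞ G]
    [Bundle.RiemannianBundle (fun x : G ↦ TangentSpace 𝓘(ℝ, E) x)]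
    [IsContMDiffRiemannianBundle 𝓘(ℝ, E) ∞ E (fun x : G ↦ TangentSpace 𝓘(ℝ, E) x)]
    -- a manifold `B` with a smooth Riemannian metric
    {B : Type*} [TopologicalSpace B] [ChartedSpace F B] [T2Space B] [IsManifold 𝓘(ℝ, F) ∞ B]
    [Bundle.RiemannianBundle (fun x : B ↦ TangentSpace 𝓘(ℝ, F) x)]
    [IsContMDiffRiemannianBundle 𝓘(ℝ, F) ∞ F (fun x : B ↦ TangentSpace 𝓘(ℝ, F) x)]
    -- a smooth transitive right action of `G` on `B`
    [MulAction Gᵐᵒᵖ B] [MulAction.IsPretransitive Gᵐᵒᵖ B]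
    (hact : ContMDiff (𝓘(ℝ, F).prod 𝓘(ℝ, E)) 𝓘(ℝ, F) ∞
      (fun p : B × G ↦ MulOpposite.op p.2 • p.1))
    (b : B)
    (hinv : DescendingMetric.IsRightInvariantMetric E G)
    (hdesc : DescendingMetric.DescendsTo E F (DescendingMetric.orbitMap (G := G) b)) :
    List.TFAE [
      ∀ b' : B, DescendingMetric.HasUniqueMinimalGeodesic F b b',
      ∀ b'' b' : B, DescendingMetric.HasUniqueMinimalGeodesic F b'' b',
      ∀ b' : B, ∃ T : G,
        (DescendingMetric.IsOptimalTransport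
            (fun x y : G ↦ DescendingMetric.dist (E := E) x y ^ 2) b b' T ∧
          ∀ S : G, DescendingMetric.IsOptimalTransport
            (fun x y : G ↦ DescendingMetric.dist (E := E) x y ^ 2) b b' S → S = T) ∧
        DescendingMetric.HasUniqueMinimalGeodesic E (1 : G) T,
      (∀ g : G, ∃! p : G × G,
        p.1 ∈ DescendingMetric.isotropy G b ∧ p.2 ∈ DescendingMetric.polarCone E G b ∧
          g = p.1 * p.2) ∧
        ∀ k ∈ DescendingMetric.polarCone E G b,
          DescendingMetric.HasUniqueMinimalGeodesic E (1 : G) k] := by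
  -- together with the Hausdorff axiom, local compactness makes `G` and `B` regular
  have : LocallyCompactSpace G := Manifold.locallyCompact_of_finiteDimensional 𝓘(ℝ, E)
  have : LocallyCompactSpace B := Manifold.locallyCompact_of_finiteDimensional 𝓘(ℝ, F)
  have := RiemannianDescent.isContinuousRiemannianBundle_tangentSpace (E := E) (M := G)
  have := RiemannianDescent.isContinuousRiemannianBundle_tangentSpace (E := F) (M := B)
  simp only [RiemannianDescent.isOptimalTransport_iff hact hinv hdesc]
  tfae_have 1 → 2 := fun H b'' b' ↦ by
    obtain ⟨g, rfl⟩ := MulAction.exists_smul_eq Gᵐᵒᵖ b b''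
    have := RiemannianDescent.hasUniqueMinimalGeodesic_action hact hinv hdesc (H (g⁻¹ • b')) g
    rwa [smul_inv_smul] at this
  tfae_have 2 → 3 :=
    RiemannianDescent.exists_transport_of_hasUniqueMinimalGeodesic hact hinv hdesc
  tfae_have 3 → 1 := fun H b' ↦ by
    obtain ⟨T, ⟨hT, huniq⟩, hgeo⟩ := H b'
    exact RiemannianDescent.hasUniqueMinimalGeodesic_of_transport hact hinv hdesc hT huniq hgeo
  tfae_have 3 ↔ 4 := RiemannianDescent.existsUnique_transport_iff_factorization
  tfae_finish
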